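/- Let $v>0$ and let $\{a(x,y):x\le y,\ x,y\in\mathbb Z\}$ be jointly independent real Gaussian random variables with ${\bf E}\,a(x,y)=0$ and ${\bf E}\,a(x,y)^2=v(1+\delta_{xy})$. Let $u:\mathbb R\to[0,\infty)$ be even, bounded, monotone on $[0,\infty)$, continuous at $0$, with $\int_{\mathbb R}u(t)\,dt=1$. For $n\in\mathbb N$ and $b>0$ put $N=2n+1$ and let $H=H^{(n,b)}$ be the real symmetric $N\times N$ matrix with $$H(x,y)=a(x,y)\sqrt{\tfrac1b\,u\!\left(\tfrac{x-y}{b}\right)},\qquad x\le y,\quad |x|,|y|\le n.$$ For $\operatorname{Im}z\ne0$ let $\langle G(z)\rangle=\frac1N\operatorname{Tr}(H-z)^{-1}$, let $$C_{n,b}(z_1,z_2)={\bf E}\langle G(z_1)\rangle\langle G(z_2)\rangle-{\bf E}\langle G(z_1)\rangle\,{\bf E}\langle G(z_2)\rangle ,$$ and let $w(z)$ be the unique solution of $w=\frac{1}{-z-vw}$ with $\operatorname{Im}w\cdot\operatorname{Im}z\ge0$. **Theorem 3.2.** Let $1/3<\chi<1$ and let $z_1,z_2\in\mathbb C$ satisfy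 $|\operatorname{Im}z_i|\ge 2\sqrt v+1$ for $i=1,2$. Then, for $b=n^\chi$ and $n\to\infty$, $$C_{n,b}(z_1,z_2)=\frac{1}{Nb}S(z_1,z_2)+o\!\left(\frac1{Nb}\right),$$ where, with $w_j=w(z_j)$ and $\tilde u_F(p)=\int_{\mathbb R}u(t)e^{ipt}\,dt$, $$S(z_1,z_2)=\frac{2v}{(1-vw_1^2)(1-vw_2^2)}\cdot\frac1{2\pi}\int_{\mathbb R}\frac{w_1^2w_2^2\,\tilde u_F(p)}{[1-vw_1w_2\tilde u_F(p)]^2}\,dp ,$$ and the integral over $\mathbb R$ converges as an improper integral, $\lim_{A,B\to\infty}\int_{-A}^{B}$. -/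

import Mathlib

open MeasureTheory ProbabilityTheory Filter Topology Asymptotics
open scoped NNReal

namespace BandMatrix

/-- The pairs `(x, y)` of integers with `x ≤ y`, which index the independent entries. -/
abbrev UpperPair : Type := {p : ℤ × ℤ // p.1 ≤ p.2}

/-- `a(x, y)`, `x ≤ y`, are jointly independent centred Gaussian random variables with
`E a(x, y)² = v (1 + δ_{xy})`. -/
structure IsGaussianFamily {Ω : Type*} [MeasurableSpace Ω] (P : Measure Ω) (v : ℝ≥0)
    (a : UpperPair → Ω → ℝ) : Prop where
  hasLaw : ∀ p : UpperPair,
    HasLaw (a p) (gaussianReal 0 (v * (1 + if p.1.1 = p.1.2 then 1 else 0))) P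
  indep : iIndepFun a P

/-- The profile functions `u`: even, nonnegative, bounded, of integral one (in particular
integrable, because the integral of a non-integrable function is `0` by convention), monotone
on `[0, ∞)` (necessarily nonincreasing), and continuous at the origin. -/
structure IsProfile (u : ℝ → ℝ) : Prop where
  even : ∀ t, u (-t) = u t
  nonneg : ∀ t, 0 ≤ u t
  bounded : BddAbove (Set.range u)
  integral_eq_one : ∫ t, u t = 1
  antitoneOn : AntitoneOn u (Set.Ici 0)
  continuousAt_zero : ContinuousAt u 0

/-- `U^{(b)}(x, y) = b⁻¹ u((x - y) / b)`. -/
noncomputable def bandKernel (u : ℝ → ℝ) (b : ℝ) (x y : ℤ) : ℝ :=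
  1 / b * u (((x : ℝ) - (y : ℝ)) / b)

/-- The index set `{x ∈ ℤ : |x| ≤ n}`, with `N = 2 n + 1` elements. -/
abbrev Site (n : ℕ) : Type := Finset.Icc (-(n : ℤ)) (n : ℤ)

/-- The unordered pair `{x, y}`, written in increasing order. -/
def sortedPair (x y : ℤ) : UpperPair := ⟨(min x y, max x y), min_le_max⟩

/-- The real symmetric band matrix with `H(x, y) = a(x, y) √(U^{(b)}(x, y))` for `x ≤ y`,
`|x|, |y| ≤ n`. -/
noncomputable def bandMatrix {Ω : Type*} (a : UpperPair → Ω → ℝ) (u : ℝ → ℝ) (n : ℕ) (b : ℝ)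
    (ω : Ω) : Matrix (Site n) (Site n) ℝ :=
  Matrix.of fun x y =>
    a (sortedPair x y) ω * Real.sqrt (bandKernel u b (min (x : ℤ) y) (max (x : ℤ) y))

/-- The resolvent `G(z) = (H - z I)⁻¹`. -/
noncomputable def resolventMatrix {Ω : Type*} (a : UpperPair → Ω → ℝ) (u : ℝ → ℝ) (n : ℕ)
    (b : ℝ) (z : ℂ) (ω : Ω) : Matrix (Site n) (Site n) ℂ :=
  ((bandMatrix a u n b ω).map Complex.ofReal - z • (1 : Matrix (Site n) (Site n) ℂ))⁻¹

/-- The normalized trace `⟨G(z)⟩ = N⁻¹ Tr G(z)`, `N = 2 n + 1`. -/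
noncomputable def normalizedTrace {Ω : Type*} (a : UpperPair → Ω → ℝ) (u : ℝ → ℝ) (n : ℕ)
    (b : ℝ) (z : ℂ) (ω : Ω) : ℂ :=
  1 / (2 * (n : ℂ) + 1) * (resolventMatrix a u n b z ω).trace

/-- `C_{n,b}(z₁, z₂) = E ⟨G(z₁)⟩⟨G(z₂)⟩ - E ⟨G(z₁)⟩ E ⟨G(z₂)⟩` (no complex conjugation). -/
noncomputable def correlation {Ω : Type*} [MeasurableSpace Ω] (P : Measure Ω)
    (a : UpperPair → Ω → ℝ) (u : ℝ → ℝ) (n : ℕ) (b : ℝ) (z₁ z₂ : ℂ) : ℂ :=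
  (∫ ω, normalizedTrace a u n b z₁ ω * normalizedTrace a u n b z₂ ω ∂P) -
    (∫ ω, normalizedTrace a u n b z₁ ω ∂P) * ∫ ω, normalizedTrace a u n b z₂ ω ∂P

/-- `w` solves `w = 1 / (-z - v w)` and satisfies `Im w · Im z ≥ 0`. -/
def IsSemicircleSolution (v : ℝ) (z w : ℂ) : Prop :=
  w = 1 / (-z - v * w) ∧ 0 ≤ w.im * z.im

/-- Off the real axis the equation has exactly one admissible solution. -/
theorem existsUnique_isSemicircleSolution {v : ℝ} (hv : 0 < v) {z : ℂ} (hz : z.im ≠ 0) :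
    ∃! w : ℂ, IsSemicircleSolution v z w := by
  have hz0 : z ≠ 0 := fun h => hz (by simp [h])
  have hvC : (v : ℂ) ≠ 0 := by exact_mod_cast hv.ne'
  -- the equation is equivalent to a quadratic one
  have key : ∀ w : ℂ, w = 1 / (-z - v * w) ↔ v * w ^ 2 + z * w + 1 = 0 := by
    intro w
    constructor
    · intro h
      have hd : -z - v * w ≠ 0 := by
        intro h0
        rw [h0, div_zero] at h
        rw [h] at h0
        exact hz0 (by simpa using h0)
      rw [eq_div_iff hd] at h
      linear_combination -h
    · intro h
      have hd : -z - v * w ≠ 0 := by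
        intro h0
        have : (1 : ℂ) = 0 := by linear_combination h + w * h0
        exact one_ne_zero this
      rw [eq_div_iff hd]
      linear_combination -h
  obtain ⟨s, hs⟩ := IsAlgClosed.exists_pow_nat_eq (z ^ 2 - 4 * v) (n := 2) (by norm_num)
  -- every root is nonreal
  have him : ∀ w : ℂ, v * w ^ 2 + z * w + 1 = 0 → w.im ≠ 0 := by
    intro w h h0
    have h1 := congrArg Complex.im h
    have h2 := congrArg Complex.re h
    simp [pow_two, h0] at h1 h2
    rcases h1 with h1 | h1
    · exact hz h1
    · simp [h1] at h2
  -- Vieta: two distinct roots have imaginary parts of opposite signs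
  have hopp : ∀ w w' : ℂ, (v : ℂ) * (w * w') = 1 → w'.im * Complex.normSq w = -(w.im / v) := by
    intro w w' h
    have h1 : (Complex.normSq w : ℂ) * w' * v = (starRingEnd ℂ) w := by
      rw [Complex.normSq_eq_conj_mul_self]
      linear_combination (starRingEnd ℂ) w * h
    have h2 := congrArg Complex.im h1
    simp at h2
    field_simp
    linear_combination h2
  have hsign : ∀ w w' : ℂ, (v : ℂ) * (w * w') = 1 → w.im ≠ 0 →
      (0 < w'.im * z.im ↔ w.im * z.im < 0) := by
    intro w w' h hw
    have hn : 0 < Complex.normSq w := Complex.normSq_pos.mpr (fun h0 => hw (by simp [h0]))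
    have e : w'.im * z.im * (Complex.normSq w * v) = -(w.im * z.im) := by
      have := hopp w w' h
      field_simp at this
      linear_combination z.im * this
    constructor
    · intro h1
      have := mul_pos h1 (mul_pos hn hv)
      linarith
    · intro h1
      have h3 : 0 < w'.im * z.im * (Complex.normSq w * v) := by linarith
      exact pos_of_mul_pos_left h3 (mul_pos hn hv).le
  have hroot : ∀ w : ℂ, v * w ^ 2 + z * w + 1 = 0 →
      ∃ w', v * w' ^ 2 + z * w' + 1 = 0 ∧ (v : ℂ) * (w * w') = 1 ∧ v * (w + w') = -z := by
    intro w h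
    have e : (v : ℂ) * (-z / v) = -z := by field_simp
    refine ⟨-z / v - w, ?_, ?_, ?_⟩
    · linear_combination h + (-z / v - 2 * w) * e
    · linear_combination w * e - h
    · linear_combination e
  obtain ⟨w₀, h₀⟩ : ∃ w : ℂ, v * w ^ 2 + z * w + 1 = 0 := by
    refine ⟨(-z + s) / (2 * v), ?_⟩
    field_simp
    linear_combination hs
  obtain ⟨w, hw, hwpos⟩ : ∃ w : ℂ, v * w ^ 2 + z * w + 1 = 0 ∧ 0 ≤ w.im * z.im := by
    rcases le_or_gt 0 (w₀.im * z.im) with h | h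
    · exact ⟨w₀, h₀, h⟩
    · obtain ⟨w', h1, h2, -⟩ := hroot w₀ h₀
      exact ⟨w', h1, ((hsign w₀ w' h2 (him _ h₀)).2 h).le⟩
  refine ⟨w, ⟨(key w).2 hw, hwpos⟩, ?_⟩
  rintro y ⟨hy, hypos⟩
  rw [key] at hy
  obtain ⟨w', h1, h2, h3⟩ := hroot w hw
  by_contra hne
  have hyw : y = w' := by
    have : (y - w) * (v * (y - w')) = 0 := by
      linear_combination hy + h2 - y * h3
    rcases mul_eq_zero.1 this with h | h
    · exact absurd (sub_eq_zero.1 h) hne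
    · rcases mul_eq_zero.1 h with h | h
      · exact absurd h hvC
      · exact sub_eq_zero.1 h
  have hlt : 0 < y.im * z.im :=
    lt_of_le_of_ne hypos (Ne.symm (mul_ne_zero (him y hy) hz))
  rw [hyw] at hlt
  have := (hsign w w' h2 (him w hw)).1 hlt
  linarith

/-- The semicircle transform `w(z)`: the solution of `w = 1 / (-z - v w)` with
`Im w · Im z ≥ 0`, unique for `Im z ≠ 0`. -/
noncomputable def semicircleTransform (v : ℝ) (z : ℂ) : ℂ :=
  Classical.epsilon (IsSemicircleSolution v z)

/-- The defining property of `w(z)` holds off the real axis. -/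
theorem semicircleTransform_spec {v : ℝ} (hv : 0 < v) {z : ℂ} (hz : z.im ≠ 0) :
    IsSemicircleSolution v z (semicircleTransform v z) :=
  Classical.epsilon_spec (existsUnique_isSemicircleSolution hv hz).exists

/-- The Fourier transform `∫ u(t) e^{i p t} dt`. -/
noncomputable def fourierTransform (u : ℝ → ℝ) (p : ℝ) : ℂ :=
  ∫ t : ℝ, (u t : ℂ) * Complex.exp (Complex.I * p * t)

/-- `I` is the (possibly only conditionally convergent) improper integral of `f` over `ℝ`:
the limit of `∫_{-A}^{B} f` as `A` and `B` tend to infinity independently. -/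
def HasImproperIntegral (f : ℝ → ℂ) (I : ℂ) : Prop :=
  Tendsto (fun q : ℝ × ℝ => ∫ p in (-q.1)..q.2, f p) (atTop ×ˢ atTop) (𝓝 I)

/-- The integrand `w₁² w₂² û(p) / [1 - v w₁ w₂ û(p)]²`. -/
noncomputable def leadingIntegrand (v : ℝ) (u : ℝ → ℝ) (z₁ z₂ : ℂ) (p : ℝ) : ℂ :=
  semicircleTransform v z₁ ^ 2 * semicircleTransform v z₂ ^ 2 * fourierTransform u p /
    (1 - v * semicircleTransform v z₁ * semicircleTransform v z₂ * fourierTransform u p) ^ 2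

/-- `2 v Q / ((1 - v w₁²)(1 - v w₂²))`. -/
noncomputable def leadingTerm (v : ℝ) (z₁ z₂ Q : ℂ) : ℂ :=
  2 * v / ((1 - v * semicircleTransform v z₁ ^ 2) * (1 - v * semicircleTransform v z₂ ^ 2)) * Q

end BandMatrix

namespace BandMatrix

set_option linter.unusedSectionVars false

/-! The covariance is an exact integral along a rotation. If `H'` is an independent copy of `H`,
then `cos θ H + sin θ H'` runs from `H` to `H'` with constant law, and the expectation of a product
of an entry of `G₁(H)` and one of `G₂(cos θ H + sin θ H')` runs from the joint expectation to the
product of expectations. The velocity `-sin θ H + cos θ H'` is uncorrelated with the rotated matrix,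
so Gaussian integration by parts differentiates only `G₁`. The result (`covariance_resolv`,
`traceCov_eq_integral`) is that the covariance of the traces is the integral over `[0, π/2]` of `2 v
sin θ ∑ U(x,y) E (G₁²)(x,y) (G₂²)(x,y)`.

Since `G²` is the `z`-derivative of `G`, it suffices to find the limit of `b N⁻¹ ∑ U(x,y) E G₁(x,y)
G₂(x,y)` and to differentiate it in `z₁` and `z₂`; remainders quadratic in the step, uniform in `n`,
allow this (`tendsto_of_second_order`). The two-point function `F = E G₁ G₂` solves `F = w₁ w₂ + k U
F + error` with `k = v w₁ w₂ cos θ`. The error has `ℓ¹` norm `o(N)` over all pairs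
(`sum_sum_norm_twoPoint_sub_le`), because diagonal entries fluctuate by `O(b^{-1/2})` and, on
average over the sites, are close to `w`. As `|k| ≤ 1/4` and the rows of `U` sum to at most 2, `U (1
- k U)⁻¹` has entries `O(1/b)`, and the overlap reduces to `w₁ w₂ b N⁻¹ Tr U (1 - k U)⁻¹`
(`norm_overlap_sub_le`).

In this trace the term `Tr U` is explicit, and `Tr U (1 - k U)⁻¹ U` is expanded in plane waves,
which are approximate eigenvectors of `U` with eigenvalue `û(p)`. Edge effects vanish because `b / N
→ 0`, and monotonicity of `u` gives decay like `1/|p|`, so that quadratic quantities can be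
dominated (`tendsto_trace`).

After the two differentiations the `θ`-integrand is an exact derivative
(`integral_sin_mul_profileDeriv`), leaving `overlapProfile u a` at `a = v w₁ w₂`. This equals
`(2π)⁻¹ ∫ û / (1 - a û)²` once the integrand is split as `û + 2 a û² / (1 - a û) + a² û³ / (1 - a
û)²`: the last two terms are absolutely integrable, and `∫ û = 2π u(0)` as an improper integral
(`hasImproperIntegral_fourierTransform`). -/

/-- Bounded continuous complex functions. -/
def BCont {X : Type*} [TopologicalSpace X] (f : X → ℂ) : Prop :=
  Continuous f ∧ ∃ C : ℝ, ∀ x, ‖f x‖ ≤ C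

/-! ### Closure and integrability of bounded continuous functions. -/

namespace BCont

variable {X : Type*} [TopologicalSpace X] {f g : X → ℂ}

theorem const (c : ℂ) : BCont (fun _ : X => c) := ⟨continuous_const, ‖c‖, fun _ => le_rfl⟩

theorem add (hf : BCont f) (hg : BCont g) : BCont (fun x => f x + g x) := by
  obtain ⟨hf, C, hC⟩ := hf
  obtain ⟨hg, D, hD⟩ := hg
  exact ⟨hf.add hg, C + D, fun x => (norm_add_le _ _).trans (add_le_add (hC x) (hD x))⟩

theorem mul (hf : BCont f) (hg : BCont g) : BCont (fun x => f x * g x) := by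
  obtain ⟨hf, C, hC⟩ := hf
  obtain ⟨hg, D, hD⟩ := hg
  refine ⟨hf.mul hg, C * D, fun x => ?_⟩
  rw [norm_mul]
  exact mul_le_mul (hC x) (hD x) (norm_nonneg _) ((norm_nonneg _).trans (hC x))

theorem neg (hf : BCont f) : BCont (fun x => -f x) := by
  obtain ⟨hf, C, hC⟩ := hf
  exact ⟨hf.neg, C, fun x => by simpa using hC x⟩

theorem sub (hf : BCont f) (hg : BCont g) : BCont (fun x => f x - g x) := by
  simpa [sub_eq_add_neg] using hf.add hg.neg

theorem sum {ι : Type*} (s : Finset ι) {f : ι → X → ℂ} (h : ∀ i ∈ s, BCont (f i)) :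
    BCont (fun x => ∑ i ∈ s, f i x) := by
  classical
  induction s using Finset.induction_on with
  | empty => simpa using const 0
  | insert a s ha ih =>
    simp only [Finset.sum_insert ha]
    exact (h a (by simp)).add (ih fun i hi => h i (by simp [hi]))

theorem comp {Y : Type*} [TopologicalSpace Y] (hf : BCont f) {φ : Y → X} (hφ : Continuous φ) :
    BCont (fun y => f (φ y)) :=
  ⟨hf.1.comp hφ, hf.2.imp fun _ h y => h (φ y)⟩

theorem aestronglyMeasurable {X : Type*} [TopologicalSpace X] [MeasurableSpace X]
    [OpensMeasurableSpace X] {f : X → ℂ} (hf : BCont f) (μ : Measure X) :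
    AEStronglyMeasurable f μ :=
  hf.1.measurable.aestronglyMeasurable

theorem integrable {X : Type*} [TopologicalSpace X] [MeasurableSpace X]
    [OpensMeasurableSpace X] {f : X → ℂ} (hf : BCont f) (μ : Measure X) [IsFiniteMeasure μ] :
    Integrable f μ := by
  obtain ⟨C, hC⟩ := hf.2
  exact Integrable.of_bound (hf.aestronglyMeasurable μ) C (ae_of_all _ hC)

theorem integrable_mul {X : Type*} [TopologicalSpace X] [MeasurableSpace X]
    [OpensMeasurableSpace X] {f g : X → ℂ} (hf : BCont f) {μ : Measure X}
    (hg : Integrable g μ) : Integrable (fun x => g x * f x) μ := by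
  obtain ⟨C, hC⟩ := hf.2
  exact hg.mul_bdd (hf.aestronglyMeasurable μ) (ae_of_all _ hC)

end BCont

/-! ### Gaussian integration by parts in one and several variables. -/

/-- Gaussian integration by parts on the line. -/
theorem integral_id_mul_gaussianReal {f f' : ℝ → ℂ} (hd : ∀ t, HasDerivAt f (f' t) t)
    (hf : BCont f) (hf' : BCont f') :
    ∫ t, (t : ℂ) * f t ∂(gaussianReal 0 1) = ∫ t, f' t ∂(gaussianReal 0 1) := by
  have h1 : (1 : ℝ≥0) ≠ 0 := one_ne_zero
  rw [integral_gaussianReal_eq_integral_smul h1, integral_gaussianReal_eq_integral_smul h1]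
  have hpdf : ∀ t : ℝ, HasDerivAt (fun t : ℝ => (gaussianPDFReal 0 1 t : ℂ))
      (-(t : ℂ) * gaussianPDFReal 0 1 t) t := by
    intro t
    have : HasDerivAt (gaussianPDFReal 0 1) (-t * gaussianPDFReal 0 1 t) t := by
      simp only [gaussianPDFReal_def]
      have h := (HasDerivAt.exp (f := fun x : ℝ => -(x - 0) ^ 2 / (2 * ((1 : ℝ≥0) : ℝ)))
        (((((hasDerivAt_id t).sub_const 0).pow 2).neg.div_const (2 * ((1 : ℝ≥0) : ℝ))))).const_mul
        ((√(2 * Real.pi * ((1 : ℝ≥0) : ℝ)))⁻¹)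
      refine h.congr_deriv ?_
      simp
      ring
    have h2 := this.ofReal_comp
    refine h2.congr_deriv ?_
    push_cast
    rfl
  have hint : Integrable (fun t : ℝ => (gaussianPDFReal 0 1 t : ℂ)) :=
    (integrable_gaussianPDFReal 0 1).ofReal
  have hint2 : Integrable (fun t : ℝ => -(t : ℂ) * (gaussianPDFReal 0 1 t : ℂ)) := by
    have : Integrable (fun t : ℝ => t * Real.exp (-(1 / 2) * t ^ 2)) :=
      integrable_mul_exp_neg_mul_sq (by norm_num)
    have h3 : Integrable (fun t : ℝ => -(t * gaussianPDFReal 0 1 t)) := by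
      refine (this.const_mul (-((√(2 * Real.pi))⁻¹))).congr (ae_of_all _ fun t => ?_)
      simp only [gaussianPDFReal_def]
      simp
      ring_nf
    refine h3.ofReal.congr (ae_of_all _ fun t => ?_)
    simp
  have key := integral_mul_deriv_eq_deriv_mul_of_integrable (u := fun t : ℝ => (gaussianPDFReal 0 1 t : ℂ))
    (v := f) (fun x _ => hpdf x) (fun x _ => hd x) (hf'.integrable_mul hint) (hf.integrable_mul hint2) (hf.integrable_mul hint)
  simp only [Complex.real_smul]
  rw [key, ← integral_neg]
  congr 1
  ext t
  ring

section Pi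

variable {κ : Type*} [Fintype κ]

/-- The standard Gaussian measure on `κ → ℝ`. -/
noncomputable def stdGauss (κ : Type*) [Fintype κ] : Measure (κ → ℝ) :=
  Measure.pi fun _ : κ => gaussianReal 0 1

instance : IsProbabilityMeasure (stdGauss κ) := by
  unfold stdGauss
  infer_instance

/-- Resampling a single coordinate preserves a product measure. Using `Function.update` keeps the
index set fixed, so no coordinate has to be split off when Fubini is applied. -/
theorem map_update_stdGauss [DecidableEq κ] (q : κ) :
    ((gaussianReal 0 1).prod (stdGauss κ)).map
      (fun p : ℝ × (κ → ℝ) => Function.update p.2 q p.1) = stdGauss κ := by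
  have hm : Measurable (fun p : ℝ × (κ → ℝ) => Function.update p.2 q p.1) := by
    rw [measurable_pi_iff]
    intro i
    by_cases h : i = q
    · subst h; simpa using measurable_fst
    · simp only [Function.update_of_ne h]
      exact (measurable_pi_apply i).comp measurable_snd
  refine (Measure.pi_eq fun s hs => ?_).symm
  rw [Measure.map_apply hm (MeasurableSet.univ_pi hs)]
  have : (fun p : ℝ × (κ → ℝ) => Function.update p.2 q p.1) ⁻¹' Set.univ.pi s =
      s q ×ˢ Set.univ.pi (Function.update s q Set.univ) := by
    ext ⟨t, ζ⟩
    simp only [Set.mem_preimage, Set.mem_pi, Set.mem_univ, true_imp_iff, Set.mem_prod]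
    constructor
    · intro h
      refine ⟨by simpa using h q, fun i => ?_⟩
      by_cases hi : i = q
      · subst hi; simp
      · simpa [hi] using h i
    · rintro ⟨h1, h2⟩ i
      by_cases hi : i = q
      · subst hi; simpa using h1
      · simpa [hi] using h2 i
  rw [this, Measure.prod_prod, stdGauss, Measure.pi_pi,
    ← Finset.mul_prod_erase Finset.univ (fun i => gaussianReal 0 1 (s i)) (Finset.mem_univ q),
    ← Finset.mul_prod_erase Finset.univ _ (Finset.mem_univ q)]
  simp only [Function.update_self, measure_univ, one_mul]
  congr 1
  refine Finset.prod_congr rfl fun i hi => ?_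
  rw [Function.update_of_ne (Finset.ne_of_mem_erase hi)]

theorem integrable_coord (q : κ) : Integrable (fun ζ : κ → ℝ => (ζ q : ℂ)) (stdGauss κ) := by
  have h1 : Integrable (fun t : ℝ => (t : ℂ)) (gaussianReal 0 1) := by
    have := (memLp_id_gaussianReal (μ := 0) (v := 1) 1)
    simpa using ((memLp_one_iff_integrable.1 this).ofReal (𝕜 := ℂ))
  exact (measurePreserving_eval (fun _ : κ => gaussianReal 0 1) q).integrable_comp_of_integrable h1

/-- Resample coordinate `q` independently and integrate it first: the one-dimensional formula
applies with the other coordinates frozen. -/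
theorem integral_coord_mul [DecidableEq κ] (q : κ) {f f' : (κ → ℝ) → ℂ}
    (hd : ∀ ζ, HasDerivAt (fun t : ℝ => f (Function.update ζ q t)) (f' ζ) (ζ q))
    (hf : BCont f) (hf' : BCont f') :
    ∫ ζ, (ζ q : ℂ) * f ζ ∂(stdGauss κ) = ∫ ζ, f' ζ ∂(stdGauss κ) := by
  have hc : Continuous (fun p : ℝ × (κ → ℝ) => Function.update p.2 q p.1) :=
    continuous_snd.update q continuous_fst
  have hm := hc.measurable
  have e := map_update_stdGauss (κ := κ) q
  have hi1 : Integrable (fun ζ : κ → ℝ => (ζ q : ℂ) * f ζ) (stdGauss κ) :=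
    hf.integrable_mul (integrable_coord q)
  have hi2 : Integrable f' (stdGauss κ) := hf'.integrable _
  have A : ∀ F : (κ → ℝ) → ℂ, Integrable F (stdGauss κ) → ∫ ζ, F ζ ∂(stdGauss κ) =
      ∫ ζ, ∫ t, F (Function.update ζ q t) ∂(gaussianReal 0 1) ∂(stdGauss κ) := by
    intro F hF
    conv_lhs => rw [← e]
    rw [← e] at hF
    rw [integral_map hm.aemeasurable hF.aestronglyMeasurable, integral_prod_symm]
    exact hF.comp_measurable hm
  rw [A _ hi1, A _ hi2]
  congr 1
  ext ζ
  simp only [Function.update_self]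
  have hu : Continuous (fun t : ℝ => Function.update ζ q t) :=
    continuous_const.update q continuous_id
  refine integral_id_mul_gaussianReal (fun t => ?_) (hf.comp hu) (hf'.comp hu)
  have := hd (Function.update ζ q t)
  simpa using this

end Pi

/-! ### Resolvents of real symmetric matrices: operator bounds, continuity, derivatives. -/

section Resolvent

variable {S : Type*} [Fintype S] [DecidableEq S]

/-- Squared `ℓ²` norm. -/
noncomputable def sqNorm {S : Type*} [Fintype S] (f : S → ℂ) : ℝ := ∑ x, ‖f x‖ ^ 2

/-- `K` bounds the `ℓ²` operator norm of `M`. -/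
def OpBound (M : Matrix S S ℂ) (K : ℝ) : Prop :=
  0 ≤ K ∧ ∀ f : S → ℂ, sqNorm (M.mulVec f) ≤ K ^ 2 * sqNorm f

theorem OpBound.mul {M M' : Matrix S S ℂ} {K K' : ℝ} (h : OpBound M K) (h' : OpBound M' K') :
    OpBound (M * M') (K * K') := by
  refine ⟨mul_nonneg h.1 h'.1, fun f => ?_⟩
  rw [← Matrix.mulVec_mulVec]
  calc _ ≤ K ^ 2 * sqNorm (M'.mulVec f) := h.2 _
    _ ≤ K ^ 2 * (K' ^ 2 * sqNorm f) := by gcongr; exact h'.2 f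
    _ = _ := by ring

theorem OpBound.col_sq {M : Matrix S S ℂ} {K : ℝ} (h : OpBound M K) (y : S) :
    ∑ x, ‖M x y‖ ^ 2 ≤ K ^ 2 := by
  have := h.2 (Pi.single y 1)
  simpa [sqNorm, Pi.single_apply, apply_ite, ite_pow] using this

theorem OpBound.entry {M : Matrix S S ℂ} {K : ℝ} (h : OpBound M K) (x y : S) : ‖M x y‖ ≤ K := by
  refine abs_le_of_sq_le_sq' ?_ h.1 |>.2
  exact (Finset.single_le_sum (f := fun x => ‖M x y‖ ^ 2) (fun _ _ => sq_nonneg _)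
    (Finset.mem_univ x)).trans (h.col_sq y)

theorem sum_mul_le_of_sq {f g : S → ℝ} {K K' : ℝ} (hK : 0 ≤ K) (hK' : 0 ≤ K')
    (hf : ∑ x, f x ^ 2 ≤ K ^ 2) (hg : ∑ x, g x ^ 2 ≤ K' ^ 2) : ∑ x, f x * g x ≤ K * K' := by
  refine (Real.sum_mul_le_sqrt_mul_sqrt _ _ _).trans ?_
  exact mul_le_mul (Real.sqrt_le_iff.2 ⟨hK, hf⟩) (Real.sqrt_le_iff.2 ⟨hK', hg⟩)
    (Real.sqrt_nonneg _) hK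

theorem OpBound.col_mul {M M' : Matrix S S ℂ} {K K' : ℝ} (h : OpBound M K) (h' : OpBound M' K')
    (y y' : S) : ∑ x, ‖M x y‖ * ‖M' x y'‖ ≤ K * K' :=
  sum_mul_le_of_sq h.1 h'.1 (h.col_sq y) (h'.col_sq _)

/-- The resolvent of a real matrix. -/
noncomputable def resolv (H : Matrix S S ℝ) (z : ℂ) : Matrix S S ℂ :=
  (H.map Complex.ofReal - z • (1 : Matrix S S ℂ))⁻¹

/-- The form `⟨f, H f⟩` is real, so the imaginary part of `⟨f, (H - z) f⟩` is `-Im z ‖f‖²`;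
Cauchy–Schwarz finishes. Both invertibility of `H - z` and the bound `1/|Im z|` on its inverse come
from here. -/
theorem sqNorm_sub_smul_ge {H : Matrix S S ℝ} (hH : H.IsSymm) (z : ℂ) (f : S → ℂ) :
    z.im ^ 2 * sqNorm f ≤
      sqNorm ((H.map Complex.ofReal - z • (1 : Matrix S S ℂ)).mulVec f) := by
  set g := (H.map Complex.ofReal - z • (1 : Matrix S S ℂ)).mulVec f with hg
  have hgx : ∀ x, g x = ∑ y, (H x y : ℂ) * f y - z * f x := by
    intro x
    simp [hg, Matrix.sub_mulVec, Matrix.mulVec, dotProduct, Matrix.one_apply]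
  have h1 : (∑ x, (starRingEnd ℂ) (f x) * g x).im = -z.im * sqNorm f := by
    have e : ∑ x, (starRingEnd ℂ) (f x) * g x =
        (∑ x, ∑ y, (H x y : ℂ) * ((starRingEnd ℂ) (f x) * f y)) - z * (sqNorm f : ℝ) := by
      simp only [hgx, mul_sub, Finset.sum_sub_distrib, Finset.mul_sum, sqNorm, Complex.ofReal_sum]
      congr 1
      · refine Finset.sum_congr rfl fun x _ => Finset.sum_congr rfl fun y _ => by ring
      · refine Finset.sum_congr rfl fun x _ => ?_
        have := Complex.conj_mul' (f x)
        push_cast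
        rw [← this]; ring
    have hr : (starRingEnd ℂ) (∑ x, ∑ y, (H x y : ℂ) * ((starRingEnd ℂ) (f x) * f y)) =
        ∑ x, ∑ y, (H x y : ℂ) * ((starRingEnd ℂ) (f x) * f y) := by
      rw [map_sum, Finset.sum_comm]
      simp only [map_sum, map_mul, Complex.conj_ofReal, Complex.conj_conj]
      rw [Finset.sum_comm]
      conv_lhs => rw [Finset.sum_comm]
      refine Finset.sum_congr rfl fun x _ => Finset.sum_congr rfl fun y _ => ?_
      rw [← hH.apply x y]; ring
    rw [e, Complex.sub_im, Complex.conj_eq_iff_im.1 hr]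
    simp
  have h2 : |z.im| * sqNorm f ≤ √(sqNorm f) * √(sqNorm g) := by
    have hn : 0 ≤ sqNorm f := Finset.sum_nonneg fun _ _ => sq_nonneg _
    calc |z.im| * sqNorm f = |(∑ x, (starRingEnd ℂ) (f x) * g x).im| := by
          rw [h1, abs_mul, abs_neg, abs_of_nonneg hn]
      _ ≤ ‖∑ x, (starRingEnd ℂ) (f x) * g x‖ := Complex.abs_im_le_norm _
      _ ≤ ∑ x, ‖f x‖ * ‖g x‖ := by
          refine (norm_sum_le _ _).trans (le_of_eq ?_)
          simp
      _ ≤ _ := Real.sum_mul_le_sqrt_mul_sqrt _ _ _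
  have hn : 0 ≤ sqNorm f := Finset.sum_nonneg fun _ _ => sq_nonneg _
  have hn' : 0 ≤ sqNorm g := Finset.sum_nonneg fun _ _ => sq_nonneg _
  rcases hn.eq_or_lt with h0 | h0
  · rw [← h0]; simpa using hn'
  have hs : 0 < √(sqNorm f) := Real.sqrt_pos.2 h0
  have h3 : |z.im| * √(sqNorm f) ≤ √(sqNorm g) := by
    refine le_of_mul_le_mul_left ?_ hs
    calc _ = |z.im| * (√(sqNorm f) * √(sqNorm f)) := by ring
      _ = |z.im| * sqNorm f := by rw [Real.mul_self_sqrt hn]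
      _ ≤ _ := h2
  have h4 := pow_le_pow_left₀ (by positivity) h3 2
  rwa [mul_pow, sq_abs, Real.sq_sqrt hn, Real.sq_sqrt hn'] at h4

variable {H : Matrix S S ℝ} {z : ℂ}

theorem isUnit_det_sub (hH : H.IsSymm) (hz : z.im ≠ 0) :
    IsUnit (H.map Complex.ofReal - z • (1 : Matrix S S ℂ)).det := by
  rw [← Matrix.isUnit_iff_isUnit_det, ← Matrix.mulVec_injective_iff_isUnit]
  intro f g hfg
  have h := sqNorm_sub_smul_ge hH z (f - g)
  rw [Matrix.mulVec_sub, hfg, sub_self] at h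
  have h0 : sqNorm (0 : S → ℂ) = 0 := by simp [sqNorm]
  have hz2 : 0 < z.im ^ 2 := by positivity
  rw [h0] at h
  have hn : sqNorm (f - g) ≤ 0 := by
    by_contra hc
    push Not at hc
    have := mul_pos hz2 hc
    linarith
  have hn2 : sqNorm (f - g) = 0 := le_antisymm hn (Finset.sum_nonneg fun _ _ => sq_nonneg _)
  rw [sqNorm, Finset.sum_eq_zero_iff_of_nonneg (fun _ _ => sq_nonneg _)] at hn2
  ext x
  have := hn2 x (Finset.mem_univ x)
  simpa [sub_eq_zero] using this

theorem sub_mul_resolv (hH : H.IsSymm) (hz : z.im ≠ 0) :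
    (H.map Complex.ofReal - z • (1 : Matrix S S ℂ)) * resolv H z = 1 :=
  Matrix.mul_nonsing_inv _ (isUnit_det_sub hH hz)

theorem resolv_mul_sub (hH : H.IsSymm) (hz : z.im ≠ 0) :
    resolv H z * (H.map Complex.ofReal - z • (1 : Matrix S S ℂ)) = 1 :=
  Matrix.nonsing_inv_mul _ (isUnit_det_sub hH hz)

theorem resolv_opBound (hH : H.IsSymm) (hz : z.im ≠ 0) : OpBound (resolv H z) (1 / |z.im|) := by
  refine ⟨by positivity, fun f => ?_⟩
  have h := sqNorm_sub_smul_ge hH z ((resolv H z).mulVec f)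
  rw [Matrix.mulVec_mulVec, sub_mul_resolv hH hz, Matrix.one_mulVec] at h
  have hz2 : 0 < z.im ^ 2 := by positivity
  rw [div_pow, one_pow, sq_abs, one_div, inv_mul_eq_div, le_div_iff₀ hz2]
  linarith

theorem resolv_isSymm (hH : H.IsSymm) : (resolv H z).IsSymm := by
  unfold resolv Matrix.IsSymm
  rw [Matrix.transpose_nonsing_inv, Matrix.transpose_sub, Matrix.transpose_smul,
    Matrix.transpose_one, ← Matrix.transpose_map, hH.eq]

theorem resolv_symm_apply (hH : H.IsSymm) (x y : S) : resolv H z x y = resolv H z y x :=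
  (resolv_isSymm hH).apply y x

theorem resolv_sub_resolv {H' : Matrix S S ℝ} (hH : H.IsSymm) (hH' : H'.IsSymm) (hz : z.im ≠ 0) :
    resolv H' z - resolv H z =
      -(resolv H' z * (H' - H).map Complex.ofReal * resolv H z) := by
  have e : (H' - H).map Complex.ofReal = (H'.map Complex.ofReal - z • (1 : Matrix S S ℂ)) -
      (H.map Complex.ofReal - z • (1 : Matrix S S ℂ)) := by
    ext; simp
  rw [e, mul_sub, sub_mul, resolv_mul_sub hH' hz, mul_assoc, sub_mul_resolv hH hz]
  simp

theorem resolv_sub_resolv' {z' : ℂ} (hH : H.IsSymm) (hz : z.im ≠ 0) (hz' : z'.im ≠ 0) :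
    resolv H z' - resolv H z = (z' - z) • (resolv H z' * resolv H z) := by
  have e : (z' - z) • (1 : Matrix S S ℂ) = (H.map Complex.ofReal - z • (1 : Matrix S S ℂ)) -
      (H.map Complex.ofReal - z' • (1 : Matrix S S ℂ)) := by
    simp [sub_smul]
  have e2 : (z' - z) • (resolv H z' * resolv H z) =
      resolv H z' * ((z' - z) • (1 : Matrix S S ℂ)) * resolv H z := by simp
  rw [e2, e, mul_sub, sub_mul, resolv_mul_sub hH hz', mul_assoc, sub_mul_resolv hH hz]
  simp

theorem conj_resolv (hH : H.IsSymm) (x y : S) :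
    (starRingEnd ℂ) (resolv H z x y) = resolv H ((starRingEnd ℂ) z) x y := by
  have h : (resolv H z).conjTranspose = resolv H ((starRingEnd ℂ) z) := by
    unfold resolv
    rw [Matrix.conjTranspose_nonsing_inv]
    congr 1
    ext i j
    simp only [Matrix.conjTranspose_apply, Matrix.sub_apply, Matrix.map_apply, Matrix.smul_apply,
      Matrix.one_apply, star_sub, hH.apply i j, smul_eq_mul, star_mul, eq_comm (a := j)]
    split_ifs <;> simp
  rw [← h, Matrix.conjTranspose_apply, resolv_symm_apply hH, starRingEnd_apply]

/-- By the adjugate formula the entries are quotients of continuous functions; the determinant has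
to be nonzero only at `t₀`, hence symmetry is required only there. -/
theorem continuousAt_resolv {X : Type*} [TopologicalSpace X] {Hp : X → Matrix S S ℝ} {t₀ : X}
    (hs : (Hp t₀).IsSymm) (hz : z.im ≠ 0) (hc : ∀ x y, ContinuousAt (fun t => Hp t x y) t₀)
    (x y : S) : ContinuousAt (fun t => resolv (Hp t) z x y) t₀ := by
  have h1 : ContinuousAt (fun t => (Hp t).map Complex.ofReal - z • (1 : Matrix S S ℂ)) t₀ := by
    refine continuousAt_pi.2 fun i => continuousAt_pi.2 fun j => ?_
    simp only [Matrix.sub_apply, Matrix.map_apply]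
    exact (Complex.continuous_ofReal.continuousAt.comp (hc i j)).sub continuousAt_const
  have h2 : ContinuousAt (fun t => ((Hp t).map Complex.ofReal - z • (1 : Matrix S S ℂ)).det) t₀ :=
    (continuous_id.matrix_det.continuousAt).comp h1
  have h3 : ContinuousAt
      (fun t => ((Hp t).map Complex.ofReal - z • (1 : Matrix S S ℂ)).adjugate x y) t₀ :=
    ((continuous_id.matrix_adjugate.matrix_elem x y).continuousAt).comp h1
  simp only [resolv, Matrix.inv_def, Ring.inverse_eq_inv', Matrix.smul_apply, smul_eq_mul]
  exact (h2.inv₀ (isUnit_det_sub hs hz).ne_zero).mul h3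

/-- The resolvent identity expresses the slope exactly as `-G(t) · slope(H) · G(t₀)`, so
differentiability follows from continuity of `G`. -/
theorem hasDerivAt_resolv {Hp : ℝ → Matrix S S ℝ} {D : Matrix S S ℝ} {t₀ : ℝ}
    (hs : ∀ t, (Hp t).IsSymm) (hz : z.im ≠ 0)
    (hd : ∀ x y, HasDerivAt (fun t => Hp t x y) (D x y) t₀) (x y : S) :
    HasDerivAt (fun t => resolv (Hp t) z x y)
      (-(resolv (Hp t₀) z * D.map Complex.ofReal * resolv (Hp t₀) z) x y) t₀ := by
  rw [hasDerivAt_iff_tendsto_slope]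
  have e : ∀ t, slope (fun t => resolv (Hp t) z x y) t₀ t =
      -∑ b, (∑ a, resolv (Hp t) z x a * (slope (fun t => Hp t a b) t₀ t : ℝ)) *
        resolv (Hp t₀) z b y := by
    intro t
    have h := congrFun (congrFun (resolv_sub_resolv (hs t₀) (hs t) hz) x) y
    rw [Matrix.sub_apply] at h
    simp only [slope_def_module, h]
    simp only [Matrix.neg_apply, Matrix.mul_apply, Matrix.map_apply, Matrix.sub_apply,
      Finset.sum_mul, Complex.real_smul, smul_eq_mul, Finset.mul_sum, mul_neg, neg_inj]
    refine Finset.sum_congr rfl fun b _ => Finset.sum_congr rfl fun a _ => ?_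
    push_cast
    ring
  have e2 : -(resolv (Hp t₀) z * D.map Complex.ofReal * resolv (Hp t₀) z) x y =
      -∑ b, (∑ a, resolv (Hp t₀) z x a * (D a b : ℝ)) * resolv (Hp t₀) z b y := by
    simp [Matrix.mul_apply]
  rw [funext e, e2]
  refine (tendsto_finsetSum _ fun b _ => Tendsto.mul_const _ (tendsto_finsetSum _ fun a _ => ?_)).neg
  refine Tendsto.mul ?_ ?_
  · exact ((continuousAt_resolv (hs t₀) hz (fun i j => (hd i j).continuousAt) x a).tendsto).mono_left
      nhdsWithin_le_nhds
  · exact (Complex.continuous_ofReal.tendsto _).comp (hasDerivAt_iff_tendsto_slope.1 (hd a b))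

end Resolvent

/-! ### Linear Gaussian matrices and Wick contractions. -/

section GaussianMatrix

variable {κ : Type*} [Fintype κ] [DecidableEq κ]

/-- `f` is bounded and smooth enough for Gaussian integration by parts, and `F` is its derivative
in the direction `α`. -/
def HasDirDeriv (α : κ → ℝ) (f F : (κ → ℝ) → ℂ) : Prop :=
  BCont f ∧ ∃ f' : κ → (κ → ℝ) → ℂ, (∀ q, BCont (f' q)) ∧
    (∀ q ζ, HasDerivAt (fun t : ℝ => f (Function.update ζ q t)) (f' q ζ) (ζ q)) ∧
    ∀ ζ, ∑ q, (α q : ℂ) * f' q ζ = F ζ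

theorem HasDirDeriv.mul {α : κ → ℝ} {f F g G : (κ → ℝ) → ℂ} (hf : HasDirDeriv α f F)
    (hg : HasDirDeriv α g G) :
    HasDirDeriv α (fun ζ => f ζ * g ζ) (fun ζ => F ζ * g ζ + f ζ * G ζ) := by
  obtain ⟨bf, f', bf', df, sf⟩ := hf
  obtain ⟨bg, g', bg', dg, sg⟩ := hg
  refine ⟨bf.mul bg, fun q ζ => f' q ζ * g ζ + f ζ * g' q ζ,
    fun q => ((bf' q).mul bg).add (bf.mul (bg' q)), fun q ζ => ?_, fun ζ => ?_⟩
  · have := (df q ζ).mul (dg q ζ)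
    simp only [Function.update_eq_self] at this
    exact this
  · beta_reduce
    rw [← sf, ← sg, Finset.sum_mul, Finset.mul_sum, ← Finset.sum_add_distrib]
    exact Finset.sum_congr rfl fun q _ => by ring

theorem HasDirDeriv.integral_eq {α : κ → ℝ} {f F : (κ → ℝ) → ℂ} (hf : HasDirDeriv α f F) :
    ∫ ζ, ((∑ q, ζ q * α q : ℝ) : ℂ) * f ζ ∂(stdGauss κ) = ∫ ζ, F ζ ∂(stdGauss κ) := by
  obtain ⟨bf, f', bf', df, sf⟩ := hf
  have e : ∀ ζ : κ → ℝ, ((∑ q, ζ q * α q : ℝ) : ℂ) * f ζ =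
      ∑ q, (α q : ℂ) * ((ζ q : ℂ) * f ζ) := by
    intro ζ
    push_cast
    rw [Finset.sum_mul]
    exact Finset.sum_congr rfl fun q _ => by ring
  simp only [e, ← sf]
  rw [integral_finsetSum _ fun q _ => (bf.integrable_mul (integrable_coord q)).const_mul _,
    integral_finsetSum _ fun q _ => ((bf' q).integrable _).const_mul _]
  refine Finset.sum_congr rfl fun q _ => ?_
  rw [integral_const_mul, integral_const_mul, integral_coord_mul q (df q) bf (bf' q)]

variable {S : Type*} [Fintype S] [DecidableEq S]

/-- The random matrix `∑ ζ_q A_q`. -/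
def linMat (A : κ → Matrix S S ℝ) (ζ : κ → ℝ) : Matrix S S ℝ := ∑ q, ζ q • A q

theorem linMat_apply (A : κ → Matrix S S ℝ) (ζ : κ → ℝ) (x y : S) :
    linMat A ζ x y = ∑ q, ζ q * A q x y := by
  simp [linMat, Matrix.sum_apply]

theorem linMat_isSymm {A : κ → Matrix S S ℝ} (hA : ∀ q, (A q).IsSymm) (ζ : κ → ℝ) :
    (linMat A ζ).IsSymm := by
  ext x y
  rw [Matrix.transpose_apply, linMat_apply, linMat_apply]
  exact Finset.sum_congr rfl fun q _ => by rw [(hA q).apply]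

/-- The entries of `linMat A` and `linMat A'` have the covariances
`c V(x,y) (δ_{xi} δ_{yj} + δ_{xj} δ_{yi})`. -/
def CovStruct (A A' : κ → Matrix S S ℝ) (V : S → S → ℝ) (c : ℝ) : Prop :=
  ∀ x y i j, ∑ q, A q x y * A' q i j =
    c * (V x y * ((if x = i ∧ y = j then 1 else 0) + if x = j ∧ y = i then 1 else 0))

/-- The covariance forces the inner pair of indices of `P A' Q` to be `(x, y)` or `(y, x)`; these
two matchings are the two terms. -/
theorem CovStruct.contract {A A' : κ → Matrix S S ℝ} {V : S → S → ℝ} {c : ℝ}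
    (h : CovStruct A A' V c) (P Q : Matrix S S ℂ) (x y i j : S) :
    ∑ q, (A q x y : ℂ) * (P * (A' q).map Complex.ofReal * Q) i j =
      c * V x y * (P i x * Q y j + P i y * Q x j) := by
  have e : ∀ q, (A q x y : ℂ) * (P * (A' q).map Complex.ofReal * Q) i j =
      ∑ b, ∑ a, P i a * Q b j * ((A q x y * A' q a b : ℝ) : ℂ) := by
    intro q
    simp only [Matrix.mul_apply, Matrix.map_apply, Finset.sum_mul, Finset.mul_sum]
    refine Finset.sum_congr rfl fun b _ => Finset.sum_congr rfl fun a _ => ?_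
    push_cast; ring
  simp only [e]
  rw [Finset.sum_comm]
  have e2 : ∀ b, ∑ q, ∑ a, P i a * Q b j * ((A q x y * A' q a b : ℝ) : ℂ) =
      ∑ a, c * V x y * (P i a * Q b j) *
        ((if x = a ∧ y = b then 1 else 0) + if x = b ∧ y = a then 1 else 0) := by
    intro b
    rw [Finset.sum_comm]
    refine Finset.sum_congr rfl fun a _ => ?_
    rw [← Finset.mul_sum, ← Complex.ofReal_sum, h x y a b]
    push_cast
    split_ifs <;> simp <;> ring
  simp only [e2, mul_add, Finset.sum_add_distrib]
  congr 1
  · rw [Finset.sum_eq_single y, Finset.sum_eq_single x]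
    · simp
    · intro a _ ha; simp [ha.symm]
    · simp
    · intro b _ hb; simp [hb.symm]
    · simp
  · rw [Finset.sum_eq_single x, Finset.sum_eq_single y]
    · simp
    · intro a _ ha; simp [ha.symm]
    · simp
    · intro b _ hb; simp [hb.symm]
    · simp

theorem bcont_resolv {A : κ → Matrix S S ℝ} (hA : ∀ q, (A q).IsSymm) {z : ℂ} (hz : z.im ≠ 0)
    (x y : S) : BCont (fun ζ : κ → ℝ => resolv (linMat A ζ) z x y) := by
  refine ⟨continuous_iff_continuousAt.2 fun ζ =>
    continuousAt_resolv (linMat_isSymm hA ζ) hz (fun i j => ?_) x y,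
    1 / |z.im|, fun ζ => (resolv_opBound (linMat_isSymm hA ζ) hz).entry x y⟩
  simp only [linMat_apply]
  exact (continuous_finsetSum _ fun q _ =>
    (continuous_apply q).mul continuous_const).continuousAt

/-- The matrix tested against (`A`) and the matrix inside the resolvent (`A'`) may differ, with
correlation `c`. This one formula serves for equal matrices (`c = 1`), for rotated ones (`c = cos
θ`) and for uncorrelated ones (`c = 0`). -/
theorem hasDirDeriv_resolv {A A' : κ → Matrix S S ℝ} (hA' : ∀ q, (A' q).IsSymm)
    {V : S → S → ℝ} {c : ℝ} (h : CovStruct A A' V c) {z : ℂ} (hz : z.im ≠ 0) (x y i j : S) :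
    HasDirDeriv (fun q => A q x y) (fun ζ => resolv (linMat A' ζ) z i j)
      (fun ζ => -(c * V x y * (resolv (linMat A' ζ) z i x * resolv (linMat A' ζ) z y j +
        resolv (linMat A' ζ) z i y * resolv (linMat A' ζ) z x j))) := by
  refine ⟨bcont_resolv hA' hz i j, fun q ζ => -(resolv (linMat A' ζ) z *
    (A' q).map Complex.ofReal * resolv (linMat A' ζ) z) i j, fun q => ?_, fun q ζ => ?_,
    fun ζ => ?_⟩
  · simp only [Matrix.mul_apply]
    refine (BCont.sum _ fun b _ => (BCont.sum _ fun a _ => ?_).mul (bcont_resolv hA' hz _ _)).neg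
    exact (bcont_resolv hA' hz _ _).mul (BCont.const _)
  · have hd := hasDerivAt_resolv (Hp := fun t => linMat A' (Function.update ζ q t)) (D := A' q)
      (t₀ := ζ q) (z := z) (fun t => linMat_isSymm hA' _) hz (fun a b => ?_) i j
    · simpa using hd
    · simp only [linMat_apply]
      -- Each entry is affine in the single coordinate `q`, with slope the corresponding entry of
      -- `A' q`.
      have e : ∀ t : ℝ, ∑ r, Function.update ζ q t r * A' r a b =
          t * A' q a b + ∑ r ∈ Finset.univ.erase q, ζ r * A' r a b := by
        intro t
        rw [← Finset.add_sum_erase _ _ (Finset.mem_univ q), Function.update_self]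
        congr 1
        exact Finset.sum_congr rfl fun r hr => by
          rw [Function.update_of_ne (Finset.ne_of_mem_erase hr)]
      simp only [e]
      simpa using ((hasDerivAt_id (ζ q)).mul_const (A' q a b)).add_const
        (∑ r ∈ Finset.univ.erase q, ζ r * A' r a b)
  · simp only [mul_neg, Finset.sum_neg_distrib]
    rw [h.contract]

/-- Integration by parts against a matrix entry. -/
theorem integral_entry_mul {A : κ → Matrix S S ℝ} {x y : S} {f F : (κ → ℝ) → ℂ}
    (hf : HasDirDeriv (fun q => A q x y) f F) :
    ∫ ζ, (linMat A ζ x y : ℂ) * f ζ ∂(stdGauss κ) = ∫ ζ, F ζ ∂(stdGauss κ) := by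
  rw [← hf.integral_eq]
  simp only [linMat_apply]

theorem integrable_entry_mul (A : κ → Matrix S S ℝ) (x y : S) {f : (κ → ℝ) → ℂ} (hf : BCont f) :
    Integrable (fun ζ => (linMat A ζ x y : ℂ) * f ζ) (stdGauss κ) := by
  refine hf.integrable_mul ?_
  simp only [linMat_apply, Complex.ofReal_sum, Complex.ofReal_mul]
  exact integrable_finsetSum _ fun q _ => (integrable_coord q).mul_const _

/-- `z G = H G - 1`, tested against `f`. -/
theorem mul_integral_resolv {A : κ → Matrix S S ℝ} (hA : ∀ q, (A q).IsSymm) {z : ℂ}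
    (hz : z.im ≠ 0) (x y : S) {f : (κ → ℝ) → ℂ} (hf : BCont f) :
    z * ∫ ζ, resolv (linMat A ζ) z x y * f ζ ∂(stdGauss κ) =
      ∑ s, ∫ ζ, (linMat A ζ x s : ℂ) * (resolv (linMat A ζ) z s y * f ζ) ∂(stdGauss κ) -
        (if x = y then 1 else 0) * ∫ ζ, f ζ ∂(stdGauss κ) := by
  rw [← integral_finsetSum _ fun s _ => integrable_entry_mul A x s ((bcont_resolv hA hz s y).mul hf),
    ← integral_const_mul, ← integral_const_mul, ← integral_sub
      (integrable_finsetSum _ fun s _ => integrable_entry_mul A x s ((bcont_resolv hA hz s y).mul hf))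
      ((hf.integrable _).const_mul _)]
  congr 1
  ext ζ
  have h := congrFun (congrFun (sub_mul_resolv (linMat_isSymm hA ζ) hz) x) y
  rw [sub_mul, Matrix.sub_apply, Matrix.mul_apply, smul_mul_assoc, one_mul, Matrix.smul_apply,
    Matrix.one_apply, smul_eq_mul] at h
  simp only [Matrix.map_apply] at h
  have h2 : ∑ s, (linMat A ζ x s : ℂ) * (resolv (linMat A ζ) z s y * f ζ) =
      (∑ s, (linMat A ζ x s : ℂ) * resolv (linMat A ζ) z s y) * f ζ := by
    rw [Finset.sum_mul]
    exact Finset.sum_congr rfl fun s _ => by ring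
  rw [h2]
  linear_combination -f ζ * h

end GaussianMatrix

/-! ### Rotation between a matrix and an independent copy; the covariance formula. -/

section Interpolation

variable {κ : Type*} [Fintype κ] [DecidableEq κ] {S : Type*} [Fintype S] [DecidableEq S]

/-- Coefficients of `a H + b H'`, where `H'` is an independent copy of `H`. -/
def mix (a b : ℝ) (A : κ → Matrix S S ℝ) : κ ⊕ κ → Matrix S S ℝ :=
  Sum.elim (fun q => a • A q) (fun q => b • A q)

theorem linMat_mix (a b : ℝ) (A : κ → Matrix S S ℝ) (ζ : κ ⊕ κ → ℝ) :
    linMat (mix a b A) ζ =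
      a • linMat A (fun q => ζ (Sum.inl q)) + b • linMat A (fun q => ζ (Sum.inr q)) := by
  simp [linMat, mix, Finset.smul_sum, smul_smul, mul_comm]

theorem mix_isSymm {A : κ → Matrix S S ℝ} (hA : ∀ q, (A q).IsSymm) (a b : ℝ) (q : κ ⊕ κ) :
    (mix a b A q).IsSymm := by
  rcases q with q | q
  · exact (hA q).smul a
  · exact (hA q).smul b

/-- The two copies are independent with equal covariance, so the correlation of two mixtures is the
inner product of their coefficient vectors. -/
theorem CovStruct.mix {A : κ → Matrix S S ℝ} {V : S → S → ℝ} (h : CovStruct A A V 1)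
    (a b a' b' : ℝ) : CovStruct (mix a b A) (mix a' b' A) V (a * a' + b * b') := by
  intro x y i j
  have h' := h x y i j
  rw [one_mul] at h'
  rw [← h', Fintype.sum_sum_type, add_mul, Finset.mul_sum, Finset.mul_sum]
  congr 1 <;> refine Finset.sum_congr rfl fun q _ => ?_ <;>
    simp [BandMatrix.mix] <;> ring

theorem integral_inl_mul_inr {f g : (κ → ℝ) → ℂ} :
    ∫ ζ : κ ⊕ κ → ℝ, f (fun q => ζ (Sum.inl q)) * g (fun q => ζ (Sum.inr q)) ∂(stdGauss (κ ⊕ κ)) =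
      (∫ ζ, f ζ ∂(stdGauss κ)) * ∫ ζ, g ζ ∂(stdGauss κ) := by
  rw [← integral_prod_mul]
  have h := measurePreserving_sumPiEquivProdPi (fun _ : κ ⊕ κ => gaussianReal 0 1)
  exact h.integral_comp' (g := fun p : (κ → ℝ) × (κ → ℝ) => f p.1 * g p.2)

theorem integral_inl {f : (κ → ℝ) → ℂ} :
    ∫ ζ : κ ⊕ κ → ℝ, f (fun q => ζ (Sum.inl q)) ∂(stdGauss (κ ⊕ κ)) = ∫ ζ, f ζ ∂(stdGauss κ) := by
  simpa using integral_inl_mul_inr (f := f) (g := fun _ => 1)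

theorem continuous_integral_of_bcont {X Y : Type*} [TopologicalSpace X] [FirstCountableTopology X]
    [TopologicalSpace Y] [MeasurableSpace Y] [OpensMeasurableSpace Y] (μ : Measure Y)
    [IsFiniteMeasure μ] {f : X → Y → ℂ} (hf : BCont (fun p : X × Y => f p.1 p.2)) :
    Continuous (fun x => ∫ y, f x y ∂μ) := by
  obtain ⟨C, hC⟩ := hf.2
  refine continuous_of_dominated (bound := fun _ => C) (fun x => ?_) (fun x => ?_)
    (integrable_const _) ?_
  · exact (hf.comp (Continuous.prodMk_right x)).aestronglyMeasurable μ
  · exact ae_of_all _ fun y => hC (x, y)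
  · exact ae_of_all _ fun y => hf.1.comp (Continuous.prodMk_left y)

variable {A : κ → Matrix S S ℝ}

/-- The resolvent of the first matrix in the interpolated pair. -/
noncomputable def resL (A : κ → Matrix S S ℝ) (z : ℂ) (ζ : κ ⊕ κ → ℝ) : Matrix S S ℂ :=
  resolv (linMat (mix 1 0 A) ζ) z

/-- The resolvent of the rotated matrix `cos θ H + sin θ H'`. -/
noncomputable def resR (A : κ → Matrix S S ℝ) (z : ℂ) (θ : ℝ) (ζ : κ ⊕ κ → ℝ) : Matrix S S ℂ :=
  resolv (linMat (mix (Real.cos θ) (Real.sin θ) A) ζ) z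

theorem bcont_resL (hA : ∀ q, (A q).IsSymm) {z : ℂ} (hz : z.im ≠ 0) (x y : S) :
    BCont (fun p : ℝ × (κ ⊕ κ → ℝ) => resL A z p.2 x y) :=
  (bcont_resolv (mix_isSymm hA 1 0) hz x y).comp continuous_snd

theorem bcont_resR (hA : ∀ q, (A q).IsSymm) {z : ℂ} (hz : z.im ≠ 0) (x y : S) :
    BCont (fun p : ℝ × (κ ⊕ κ → ℝ) => resR A z p.1 p.2 x y) := by
  refine ⟨continuous_iff_continuousAt.2 fun p =>
    continuousAt_resolv (Hp := fun p : ℝ × (κ ⊕ κ → ℝ) =>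
      linMat (mix (Real.cos p.1) (Real.sin p.1) A) p.2)
      (linMat_isSymm (mix_isSymm hA _ _) _) hz (fun i j => ?_) x y,
    1 / |z.im|, fun p => (resolv_opBound (linMat_isSymm (mix_isSymm hA _ _) _) hz).entry x y⟩
  have e : (fun p : ℝ × (κ ⊕ κ → ℝ) => linMat (mix (Real.cos p.1) (Real.sin p.1) A) p.2 i j) =
      fun p => Real.cos p.1 * (∑ q, p.2 (Sum.inl q) * A q i j) +
        Real.sin p.1 * ∑ q, p.2 (Sum.inr q) * A q i j := by
    ext p
    rw [linMat_mix, Matrix.add_apply, Matrix.smul_apply, Matrix.smul_apply, linMat_apply,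
      linMat_apply, smul_eq_mul, smul_eq_mul]
  rw [e]
  refine Continuous.continuousAt (Continuous.add (Continuous.mul
    (Real.continuous_cos.comp continuous_fst) (continuous_finsetSum _ fun q _ => ?_))
    (Continuous.mul (Real.continuous_sin.comp continuous_fst)
      (continuous_finsetSum _ fun q _ => ?_)))
  · exact ((continuous_apply (Sum.inl q)).comp continuous_snd).mul continuous_const
  · exact ((continuous_apply (Sum.inr q)).comp continuous_snd).mul continuous_const

theorem hasDerivAt_resR (hA : ∀ q, (A q).IsSymm) {z : ℂ} (hz : z.im ≠ 0) (x y : S)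
    (ζ : κ ⊕ κ → ℝ) (θ : ℝ) :
    HasDerivAt (fun θ => resR A z θ ζ x y)
      (-(resR A z θ ζ * (linMat (mix (-Real.sin θ) (Real.cos θ) A) ζ).map Complex.ofReal *
        resR A z θ ζ) x y) θ := by
  refine hasDerivAt_resolv (Hp := fun θ => linMat (mix (Real.cos θ) (Real.sin θ) A) ζ)
    (fun t => linMat_isSymm (mix_isSymm hA _ _) _) hz (fun a b => ?_) x y
  simp only [linMat_mix, Matrix.add_apply, Matrix.smul_apply, smul_eq_mul]
  exact ((Real.hasDerivAt_cos θ).mul_const _).add ((Real.hasDerivAt_sin θ).mul_const _)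

variable {V : S → S → ℝ} {z₁ z₂ : ℂ}

/-- The vector `(-sin θ, cos θ)` is orthogonal to `(cos θ, sin θ)` and has inner product `-sin θ`
with `(1, 0)`. Hence only the first resolvent is differentiated, and the minus sign cancels the one
in the derivative of a resolvent. -/
theorem integral_dot_mul (hA : ∀ q, (A q).IsSymm) (hV : CovStruct A A V 1) (hz₁ : z₁.im ≠ 0)
    (hz₂ : z₂.im ≠ 0) (θ : ℝ) (i j k l a b : S) :
    ∫ ζ, (linMat (mix (-Real.sin θ) (Real.cos θ) A) ζ a b : ℂ) *
        (resL A z₁ ζ i j * (resR A z₂ θ ζ k a * resR A z₂ θ ζ b l)) ∂(stdGauss (κ ⊕ κ)) =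
      ∫ ζ, Real.sin θ * V a b * ((resL A z₁ ζ i a * resL A z₁ ζ b j +
        resL A z₁ ζ i b * resL A z₁ ζ a j) * (resR A z₂ θ ζ k a * resR A z₂ θ ζ b l))
        ∂(stdGauss (κ ⊕ κ)) := by
  have h1 : CovStruct (mix (-Real.sin θ) (Real.cos θ) A) (mix 1 0 A) V (-Real.sin θ) := by
    simpa using hV.mix (-Real.sin θ) (Real.cos θ) 1 0
  have h2 : CovStruct (mix (-Real.sin θ) (Real.cos θ) A)
      (mix (Real.cos θ) (Real.sin θ) A) V 0 := by
    have := hV.mix (-Real.sin θ) (Real.cos θ) (Real.cos θ) (Real.sin θ)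
    convert this using 1
    ring
  have d1 := hasDirDeriv_resolv (mix_isSymm hA _ _) h1 hz₁ a b i j
  have d2 := hasDirDeriv_resolv (mix_isSymm hA _ _) h2 hz₂ a b k a
  have d3 := hasDirDeriv_resolv (mix_isSymm hA _ _) h2 hz₂ a b b l
  refine (integral_entry_mul (d1.mul (d2.mul d3))).trans ?_
  congr 1
  ext ζ
  simp only [resL, resR]
  push_cast
  ring

theorem bcont_resL' (hA : ∀ q, (A q).IsSymm) {z : ℂ} (hz : z.im ≠ 0) (x y : S) :
    BCont (fun ζ => resL A z ζ x y) :=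
  bcont_resolv (mix_isSymm hA _ _) hz x y

theorem bcont_resR' (hA : ∀ q, (A q).IsSymm) {z : ℂ} (hz : z.im ≠ 0) (θ : ℝ) (x y : S) :
    BCont (fun ζ => resR A z θ ζ x y) :=
  bcont_resolv (mix_isSymm hA _ _) hz x y

theorem norm_resL_le (hA : ∀ q, (A q).IsSymm) {z : ℂ} (hz : z.im ≠ 0) (ζ : κ ⊕ κ → ℝ) (x y : S) :
    ‖resL A z ζ x y‖ ≤ 1 / |z.im| :=
  (resolv_opBound (linMat_isSymm (mix_isSymm hA _ _) _) hz).entry x y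

theorem norm_resR_le (hA : ∀ q, (A q).IsSymm) {z : ℂ} (hz : z.im ≠ 0) (θ : ℝ) (ζ : κ ⊕ κ → ℝ)
    (x y : S) : ‖resR A z θ ζ x y‖ ≤ 1 / |z.im| :=
  (resolv_opBound (linMat_isSymm (mix_isSymm hA _ _) _) hz).entry x y

theorem hasDerivAt_resL_mul_resR (hA : ∀ q, (A q).IsSymm) (hz₂ : z₂.im ≠ 0) (i j k l : S)
    (ζ : κ ⊕ κ → ℝ) (θ : ℝ) :
    HasDerivAt (fun θ => resL A z₁ ζ i j * resR A z₂ θ ζ k l)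
      (-∑ b, ∑ a, (linMat (mix (-Real.sin θ) (Real.cos θ) A) ζ a b : ℂ) *
          (resL A z₁ ζ i j * (resR A z₂ θ ζ k a * resR A z₂ θ ζ b l))) θ := by
  refine ((hasDerivAt_resR hA hz₂ k l ζ θ).const_mul (resL A z₁ ζ i j)).congr_deriv ?_
  simp only [Matrix.mul_apply, Matrix.map_apply, Finset.sum_mul]
  rw [mul_neg, Finset.mul_sum]
  congr 1
  refine Finset.sum_congr rfl fun b _ => ?_
  rw [Finset.mul_sum]
  exact Finset.sum_congr rfl fun a _ => by ring

/-- A majorant free of `θ`, needed to differentiate under the Gaussian integral. -/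
theorem norm_linMat_dot_le (A : κ → Matrix S S ℝ) (θ : ℝ) (ζ : κ ⊕ κ → ℝ) (a b : S) :
    ‖(linMat (mix (-Real.sin θ) (Real.cos θ) A) ζ a b : ℂ)‖ ≤
      ‖(linMat (mix 1 0 A) ζ a b : ℂ)‖ + ‖(linMat (mix 0 1 A) ζ a b : ℂ)‖ := by
  simp only [Complex.norm_real, linMat_mix, Matrix.add_apply, Matrix.smul_apply, smul_eq_mul,
    one_mul, zero_mul, add_zero, zero_add]
  refine (norm_add_le _ _).trans (add_le_add ?_ ?_) <;> rw [norm_mul]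
  · exact mul_le_of_le_one_left (norm_nonneg _) (by simpa using Real.abs_sin_le_one θ)
  · exact mul_le_of_le_one_left (norm_nonneg _) (by simpa using Real.abs_cos_le_one θ)

theorem integrable_norm_linMat (A : κ → Matrix S S ℝ) (a b : S) :
    Integrable (fun ζ => ‖(linMat A ζ a b : ℂ)‖) (stdGauss κ) := by
  simpa using (integrable_entry_mul A a b (BCont.const 1)).norm

/-- Differentiation under the integral produces the unbounded velocity matrix; integrating each of
its entries by parts leaves only resolvent entries. -/
theorem hasDerivAt_interpolation (hA : ∀ q, (A q).IsSymm) (hV : CovStruct A A V 1)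
    (hz₁ : z₁.im ≠ 0) (hz₂ : z₂.im ≠ 0) (i j k l : S) (θ : ℝ) :
    HasDerivAt (fun θ => ∫ ζ, resL A z₁ ζ i j * resR A z₂ θ ζ k l ∂(stdGauss (κ ⊕ κ)))
      (-∑ b, ∑ a, ∫ ζ, Real.sin θ * V a b * ((resL A z₁ ζ i a * resL A z₁ ζ b j +
        resL A z₁ ζ i b * resL A z₁ ζ a j) * (resR A z₂ θ ζ k a * resR A z₂ θ ζ b l))
        ∂(stdGauss (κ ⊕ κ))) θ := by
  have hb : ∀ θ a b, BCont (fun ζ =>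
      resL A z₁ ζ i j * (resR A z₂ θ ζ k a * resR A z₂ θ ζ b l)) := fun θ a b =>
    (bcont_resL' hA hz₁ i j).mul ((bcont_resR' hA hz₂ θ k a).mul (bcont_resR' hA hz₂ θ b l))
  have hint : ∀ θ b a, Integrable (fun ζ => (linMat (mix (-Real.sin θ) (Real.cos θ) A) ζ a b : ℂ) *
        (resL A z₁ ζ i j * (resR A z₂ θ ζ k a * resR A z₂ θ ζ b l))) (stdGauss (κ ⊕ κ)) :=
    fun θ b a => integrable_entry_mul _ a b (hb θ a b)
  have hF : BCont (fun ζ => resL A z₁ ζ i j * resR A z₂ θ ζ k l) :=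
    (bcont_resL' hA hz₁ i j).mul (bcont_resR' hA hz₂ θ k l)
  have key := hasDerivAt_integral_of_dominated_loc_of_deriv_le
    (μ := stdGauss (κ ⊕ κ)) (x₀ := θ) (s := Set.univ)
    (F := fun θ ζ => resL A z₁ ζ i j * resR A z₂ θ ζ k l)
    (F' := fun θ ζ => -∑ b, ∑ a, (linMat (mix (-Real.sin θ) (Real.cos θ) A) ζ a b : ℂ) *
          (resL A z₁ ζ i j * (resR A z₂ θ ζ k a * resR A z₂ θ ζ b l)))
    (bound := fun ζ => ∑ b, ∑ a, (‖(linMat (mix 1 0 A) ζ a b : ℂ)‖ +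
      ‖(linMat (mix 0 1 A) ζ a b : ℂ)‖) * (1 / |z₁.im| * (1 / |z₂.im| * (1 / |z₂.im|))))
    univ_mem (Eventually.of_forall fun θ =>
      ((bcont_resL' hA hz₁ i j).mul (bcont_resR' hA hz₂ θ k l)).aestronglyMeasurable _)
    (hF.integrable _)
    (integrable_finsetSum _ fun b _ => integrable_finsetSum _ fun a _ =>
      hint θ b a).neg.aestronglyMeasurable
    (ae_of_all _ fun ζ t _ => ?_)
    (integrable_finsetSum _ fun b _ => integrable_finsetSum _ fun a _ =>
      ((integrable_norm_linMat _ a b).add (integrable_norm_linMat _ a b)).mul_const _)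
    (ae_of_all _ fun ζ t _ => hasDerivAt_resL_mul_resR hA hz₂ i j k l ζ t)
  · refine key.2.congr_deriv ?_
    rw [integral_neg, integral_finsetSum _ fun b _ => integrable_finsetSum _ fun a _ => hint θ b a]
    congr 1
    refine Finset.sum_congr rfl fun b _ => ?_
    rw [integral_finsetSum _ fun a _ => hint θ b a]
    exact Finset.sum_congr rfl fun a _ => integral_dot_mul hA hV hz₁ hz₂ θ i j k l a b
  · rw [norm_neg]
    refine (norm_sum_le _ _).trans (Finset.sum_le_sum fun b _ => ?_)
    refine (norm_sum_le _ _).trans (Finset.sum_le_sum fun a _ => ?_)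
    rw [norm_mul, norm_mul, norm_mul]
    have h1 := norm_linMat_dot_le A t ζ a b
    have h2 := norm_resL_le hA hz₁ ζ i j
    have h3 := norm_resR_le hA hz₂ t ζ k a
    have h4 := norm_resR_le hA hz₂ t ζ b l
    gcongr

/-- The integrand of `covariance_resolv` is continuous. -/
theorem continuous_covariance_integrand (hA : ∀ q, (A q).IsSymm) (hz₁ : z₁.im ≠ 0)
    (hz₂ : z₂.im ≠ 0) (i j k l a b : S) :
    Continuous fun θ : ℝ => ∫ ζ, Real.sin θ * V a b *
      ((resL A z₁ ζ i a * resL A z₁ ζ b j + resL A z₁ ζ i b * resL A z₁ ζ a j) *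
        (resR A z₂ θ ζ k a * resR A z₂ θ ζ b l)) ∂(stdGauss (κ ⊕ κ)) := by
  have hs : BCont (fun p : ℝ × (κ ⊕ κ → ℝ) => (Real.sin p.1 : ℂ)) := by
    refine ⟨by fun_prop, 1, fun p => ?_⟩
    rw [Complex.norm_real]
    exact Real.abs_sin_le_one _
  refine continuous_integral_of_bcont _ ((hs.mul (BCont.const _)).mul (BCont.mul (BCont.add
    (BCont.mul ?_ ?_) (BCont.mul ?_ ?_)) (BCont.mul ?_ ?_)))
  · exact bcont_resL hA hz₁ _ _
  · exact bcont_resL hA hz₁ _ _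
  · exact bcont_resL hA hz₁ _ _
  · exact bcont_resL hA hz₁ _ _
  · exact bcont_resR hA hz₂ _ _
  · exact bcont_resR hA hz₂ _ _

/-- The covariance of two resolvent entries. -/
theorem covariance_resolv (hA : ∀ q, (A q).IsSymm) (hV : CovStruct A A V 1)
    (hz₁ : z₁.im ≠ 0) (hz₂ : z₂.im ≠ 0) (i j k l : S) :
    ∫ ζ, resolv (linMat A ζ) z₁ i j * resolv (linMat A ζ) z₂ k l ∂(stdGauss κ) -
      (∫ ζ, resolv (linMat A ζ) z₁ i j ∂(stdGauss κ)) *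
        ∫ ζ, resolv (linMat A ζ) z₂ k l ∂(stdGauss κ) =
    ∫ θ in (0 : ℝ)..(Real.pi / 2), ∑ b, ∑ a, ∫ ζ, Real.sin θ * V a b *
      ((resL A z₁ ζ i a * resL A z₁ ζ b j + resL A z₁ ζ i b * resL A z₁ ζ a j) *
        (resR A z₂ θ ζ k a * resR A z₂ θ ζ b l)) ∂(stdGauss (κ ⊕ κ)) := by
  have hc := continuous_covariance_integrand hA (V := V) hz₁ hz₂ i j k l
  have h := intervalIntegral.integral_eq_sub_of_hasDerivAt (a := 0) (b := Real.pi / 2)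
    (fun θ _ => hasDerivAt_interpolation hA hV hz₁ hz₂ i j k l θ)
    ((continuous_finsetSum _ fun b _ => continuous_finsetSum _ fun a _ =>
      hc a b).neg.intervalIntegrable _ _)
  rw [intervalIntegral.integral_neg] at h
  -- At `θ = 0` both resolvents are built from `H`; at `θ = π/2` the second one is built from `H'`
  -- and the expectation factorizes.
  have e0 : ∫ ζ, resL A z₁ ζ i j * resR A z₂ 0 ζ k l ∂(stdGauss (κ ⊕ κ)) =
      ∫ ζ, resolv (linMat A ζ) z₁ i j * resolv (linMat A ζ) z₂ k l ∂(stdGauss κ) := by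
    rw [← integral_inl (f := fun ζ => resolv (linMat A ζ) z₁ i j * resolv (linMat A ζ) z₂ k l)]
    simp [resL, resR, linMat_mix]
  have e1 : ∫ ζ, resL A z₁ ζ i j * resR A z₂ (Real.pi / 2) ζ k l ∂(stdGauss (κ ⊕ κ)) =
      (∫ ζ, resolv (linMat A ζ) z₁ i j ∂(stdGauss κ)) *
        ∫ ζ, resolv (linMat A ζ) z₂ k l ∂(stdGauss κ) := by
    rw [← integral_inl_mul_inr]
    simp [resL, resR, linMat_mix]
  rw [e0, e1] at h
  linear_combination h

end Interpolation

/-! ### Kernel bounds and concentration of the diagonal resolvent entries. -/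

section Loop

variable {κ : Type*} [Fintype κ] [DecidableEq κ] {S : Type*} [Fintype S] [DecidableEq S]

/-- A nonnegative symmetric kernel with entries at most `β` and row sums at most `2`. -/
structure KernelBound (U : S → S → ℝ) (β : ℝ) : Prop where
  nonneg : ∀ x y, 0 ≤ U x y
  symm : ∀ x y, U x y = U y x
  le : ∀ x y, U x y ≤ β
  row_le : ∀ x, ∑ y, U x y ≤ 2

theorem KernelBound.sum_sum_mul_le {U : S → S → ℝ} {β : ℝ} (hU : KernelBound U β) {α : S → ℝ}
    (hα : ∀ x, 0 ≤ α x) : ∑ x, ∑ s, U x s * α s ≤ 2 * ∑ x, α x := by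
  rw [Finset.sum_comm, Finset.mul_sum]
  refine Finset.sum_le_sum fun s _ => ?_
  rw [← Finset.sum_mul]
  refine mul_le_mul_of_nonneg_right ?_ (hα s)
  simpa only [hU.symm s] using hU.row_le s

/-- Cauchy–Schwarz with `∑ U² ≤ β ∑ U ≤ 2 β`. This is how an off-diagonal resolvent column weighted
by `U` gains a factor `√β`. -/
theorem KernelBound.sum_mul_le {U : S → S → ℝ} {β : ℝ} (hU : KernelBound U β) (hβ : 0 ≤ β)
    {f : S → ℝ} {K : ℝ} (hK : 0 ≤ K) (hf : ∑ s, f s ^ 2 ≤ K ^ 2) (x : S) :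
    ∑ s, U x s * f s ≤ √(2 * β) * K := by
  refine sum_mul_le_of_sq (Real.sqrt_nonneg _) hK ?_ hf
  rw [Real.sq_sqrt (by positivity)]
  calc ∑ s, U x s ^ 2 ≤ ∑ s, β * U x s := by
        refine Finset.sum_le_sum fun s _ => ?_
        rw [sq]
        exact mul_le_mul_of_nonneg_right (hU.le x s) (hU.nonneg x s)
    _ = β * ∑ s, U x s := by rw [Finset.mul_sum]
    _ ≤ β * 2 := mul_le_mul_of_nonneg_left (hU.row_le x) hβ
    _ = _ := by ring

theorem OpBound.mono {M : Matrix S S ℂ} {K K' : ℝ} (h : OpBound M K) (hK : K ≤ K') :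
    OpBound M K' := by
  refine ⟨h.1.trans hK, fun f => (h.2 f).trans ?_⟩
  have : 0 ≤ sqNorm f := Finset.sum_nonneg fun _ _ => sq_nonneg _
  have := h.1
  gcongr

theorem resolv_linMat_opBound {A : κ → Matrix S S ℝ} (hA : ∀ q, (A q).IsSymm) {z : ℂ}
    (hz : z.im ≠ 0) {K : ℝ} (hK : 1 / |z.im| ≤ K) (ζ : κ → ℝ) :
    OpBound (resolv (linMat A ζ) z) K :=
  (resolv_opBound (linMat_isSymm hA ζ) hz).mono hK

theorem integral_le_of_sq_le {X : Type*} [MeasurableSpace X] {μ : Measure X}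
    [IsProbabilityMeasure μ] {h : X → ℝ} (hi : Integrable h μ) (hi2 : Integrable (fun x => h x ^ 2) μ)
    {ρ : ℝ} (hρ : 0 < ρ) (hh : ∫ x, h x ^ 2 ∂μ ≤ ρ ^ 2) : ∫ x, h x ∂μ ≤ ρ := by
  -- The tangent line to the square at `ρ` replaces Cauchy–Schwarz.
  calc ∫ x, h x ∂μ ≤ ∫ x, (h x ^ 2 * (1 / (2 * ρ)) + ρ / 2) ∂μ := by
        refine integral_mono hi ((hi2.mul_const _).add (integrable_const _)) fun x => ?_
        have : h x ^ 2 * (1 / (2 * ρ)) + ρ / 2 - h x = (h x - ρ) ^ 2 * (1 / (2 * ρ)) := by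
          field_simp; ring
        have h2 : 0 ≤ (h x - ρ) ^ 2 * (1 / (2 * ρ)) := by positivity
        simp only
        linarith
    _ = (∫ x, h x ^ 2 ∂μ) * (1 / (2 * ρ)) + ρ / 2 := by
        rw [integral_add (hi2.mul_const _) (integrable_const _), integral_mul_const]
        simp
    _ ≤ ρ ^ 2 * (1 / (2 * ρ)) + ρ / 2 := by gcongr
    _ = ρ := by field_simp; ring

variable {U : S → S → ℝ} {β v K : ℝ} {A : κ → Matrix S S ℝ} {z : ℂ}

theorem BCont.integrable_norm {X : Type*} [TopologicalSpace X] [MeasurableSpace X]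
    [OpensMeasurableSpace X] {f : X → ℂ} (hf : BCont f) (μ : Measure X) [IsFiniteMeasure μ] :
    Integrable (fun x => ‖f x‖) μ := (hf.integrable μ).norm

theorem norm_integral_le_of_bound {X : Type*} [MeasurableSpace X] {μ : Measure X}
    [IsProbabilityMeasure μ] {f : X → ℂ} {C : ℝ} (h : ∀ x, ‖f x‖ ≤ C) : ‖∫ x, f x ∂μ‖ ≤ C := by
  simpa using norm_integral_le_of_norm_le_const (μ := μ) (ae_of_all _ h)

theorem sum_norm_integral_le {ι X : Type*} [Fintype ι] [TopologicalSpace X] [MeasurableSpace X]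
    [OpensMeasurableSpace X] {μ : Measure X} [IsFiniteMeasure μ] {f : ι → X → ℂ}
    (hf : ∀ i, BCont (f i)) {g : X → ℝ} (hg : Integrable g μ) (h : ∀ x, ∑ i, ‖f i x‖ ≤ g x) :
    ∑ i, ‖∫ x, f i x ∂μ‖ ≤ ∫ x, g x ∂μ := by
  calc ∑ i, ‖∫ x, f i x ∂μ‖ ≤ ∑ i, ∫ x, ‖f i x‖ ∂μ :=
        Finset.sum_le_sum fun i _ => norm_integral_le_integral_norm _
    _ = ∫ x, ∑ i, ‖f i x‖ ∂μ := (integral_finsetSum _ fun i _ => (hf i).integrable_norm μ).symm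
    _ ≤ ∫ x, g x ∂μ :=
        integral_mono (integrable_finsetSum _ fun i _ => (hf i).integrable_norm μ) hg h

theorem norm_sum_sum_integral_le {ι ι' X : Type*} [Fintype ι] [Fintype ι'] [TopologicalSpace X]
    [MeasurableSpace X] [OpensMeasurableSpace X] {μ : Measure X} [IsProbabilityMeasure μ]
    {f : ι → ι' → X → ℂ} (hf : ∀ i j, BCont (f i j)) {C : ℝ} (h : ∀ x, ∑ i, ∑ j, ‖f i j x‖ ≤ C) :
    ‖∑ i, ∑ j, ∫ x, f i j x ∂μ‖ ≤ C := by
  have := sum_norm_integral_le (μ := μ) (f := fun (p : ι × ι') => f p.1 p.2)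
    (fun p => hf p.1 p.2) (g := fun _ => C) (integrable_const _)
    (fun x => by rw [Fintype.sum_prod_type]; exact h x)
  rw [Fintype.sum_prod_type] at this
  refine ((norm_sum_le _ _).trans (Finset.sum_le_sum fun i _ => norm_sum_le _ _)).trans ?_
  simpa using this

/-- In the covariance formula at `z` and its conjugate, bounding `U` by `β` makes the double sum a
product of two sums `∑ |P(a,x)| |Q(a,x)| ≤ K²`. The factor 4 is the 2 from the two contractions
times the length `π/2 ≤ 2` of the interval. -/
theorem norm_variance_le (hA : ∀ q, (A q).IsSymm) (hU : KernelBound U β) (hβ : 0 ≤ β) (hv : 0 ≤ v)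
    (hV : CovStruct A A (fun x y => v * U x y) 1) (hz : z.im ≠ 0) (hK : 1 / |z.im| ≤ K) (x : S) :
    ‖∫ ζ, resolv (linMat A ζ) z x x * resolv (linMat A ζ) ((starRingEnd ℂ) z) x x ∂(stdGauss κ) -
      (∫ ζ, resolv (linMat A ζ) z x x ∂(stdGauss κ)) *
        ∫ ζ, resolv (linMat A ζ) ((starRingEnd ℂ) z) x x ∂(stdGauss κ)‖ ≤ 4 * v * β * K ^ 4 := by
  have hz' : ((starRingEnd ℂ) z).im ≠ 0 := by simpa using hz
  have hK' : 1 / |((starRingEnd ℂ) z).im| ≤ K := by simpa using hK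
  rw [covariance_resolv hA hV hz hz' x x x x]
  have hK0 : 0 ≤ K := le_trans (by positivity) hK
  refine (intervalIntegral.norm_integral_le_of_norm_le_const (C := 2 * v * β * K ^ 4)
    fun θ _ => ?_).trans ?_
  · refine norm_sum_sum_integral_le (fun b a => ?_) fun ζ => ?_
    · exact (BCont.const _).mul ((((bcont_resL' hA hz _ _).mul (bcont_resL' hA hz _ _)).add
        ((bcont_resL' hA hz _ _).mul (bcont_resL' hA hz _ _))).mul
        ((bcont_resR' hA hz' _ _ _).mul (bcont_resR' hA hz' _ _ _)))
    · set P := resL A z ζ with hP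
      set Q := resR A ((starRingEnd ℂ) z) θ ζ with hQ
      have bP : OpBound P K := resolv_linMat_opBound (mix_isSymm hA _ _) hz hK ζ
      have bQ : OpBound Q K := resolv_linMat_opBound (mix_isSymm hA _ _) hz' hK' ζ
      have sP : ∀ i j, P i j = P j i := resolv_symm_apply (linMat_isSymm (mix_isSymm hA _ _) ζ)
      have sQ : ∀ i j, Q i j = Q j i := resolv_symm_apply (linMat_isSymm (mix_isSymm hA _ _) ζ)
      have hin : ∀ b a, ‖(Real.sin θ : ℂ) * ((v * U a b : ℝ) : ℂ) *
          ((P x a * P b x + P x b * P a x) * (Q x a * Q b x))‖ ≤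
          (2 * v * β) * ((‖P b x‖ * ‖Q b x‖) * (‖P a x‖ * ‖Q a x‖)) := by
        intro b a
        have e : (P x a * P b x + P x b * P a x) * (Q x a * Q b x) =
            2 * ((P b x * Q b x) * (P a x * Q a x)) := by
          rw [sP x a, sP x b, sQ x a]; ring
        rw [e, norm_mul, norm_mul, norm_mul, norm_mul, norm_mul, norm_mul, Complex.norm_real,
          Complex.norm_real, Real.norm_eq_abs, Real.norm_eq_abs,
          abs_of_nonneg (mul_nonneg hv (hU.nonneg a b))]
        have h1 : |Real.sin θ| * (v * U a b) ≤ 1 * (v * β) := by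
          have := hU.le a b
          have := hU.nonneg a b
          have := Real.abs_sin_le_one θ
          gcongr
        have h2 : ‖(2 : ℂ)‖ = 2 := by simp
        rw [h2]
        have h3 : 0 ≤ (‖P b x‖ * ‖Q b x‖) * (‖P a x‖ * ‖Q a x‖) := by positivity
        nlinarith
      refine (Finset.sum_le_sum fun b _ => Finset.sum_le_sum fun a _ => hin b a).trans ?_
      simp only [← Finset.mul_sum]
      rw [← Finset.sum_mul]
      have h1 : ∑ a, ‖P a x‖ * ‖Q a x‖ ≤ K * K := bP.col_mul bQ x x
      have h0 : 0 ≤ ∑ a, ‖P a x‖ * ‖Q a x‖ := Finset.sum_nonneg fun _ _ => by positivity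
      calc _ ≤ 2 * v * β * ((K * K) * (K * K)) := by gcongr
        _ = _ := by ring
  · rw [sub_zero, abs_of_pos (by positivity)]
    have : Real.pi ≤ 4 := Real.pi_le_four
    have h0 : 0 ≤ v * β * K ^ 4 := by positivity
    nlinarith

theorem integral_norm_sub_integral_le (hA : ∀ q, (A q).IsSymm) (hU : KernelBound U β) (hβ : 0 < β)
    (hv : 0 < v) (hV : CovStruct A A (fun x y => v * U x y) 1) (hz : z.im ≠ 0)
    (hK : 1 / |z.im| ≤ K) (x : S) :
    ∫ ζ, ‖resolv (linMat A ζ) z x x - ∫ ξ, resolv (linMat A ξ) z x x ∂(stdGauss κ)‖ ∂(stdGauss κ) ≤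
      2 * √(v * β) * K ^ 2 := by
  have hK0 : 0 < K := lt_of_lt_of_le (by positivity) hK
  set g := ∫ ξ, resolv (linMat A ξ) z x x ∂(stdGauss κ) with hg
  have hb : BCont (fun ζ => resolv (linMat A ζ) z x x - g) :=
    (bcont_resolv hA hz x x).sub (BCont.const _)
  have hconj : ∀ ζ, resolv (linMat A ζ) ((starRingEnd ℂ) z) x x =
      (starRingEnd ℂ) (resolv (linMat A ζ) z x x) := fun ζ =>
    (conj_resolv (linMat_isSymm hA ζ) x x).symm
  have hbc : BCont (fun ζ => (starRingEnd ℂ) (resolv (linMat A ζ) z x x)) := by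
    simp only [← hconj]
    exact bcont_resolv hA (by simpa using hz) x x
  have hi2 : Integrable (fun ζ => ‖resolv (linMat A ζ) z x x - g‖ ^ 2) (stdGauss κ) := by
    simpa [sq] using (hb.mul hb).integrable_norm (stdGauss κ)
  refine integral_le_of_sq_le (hb.integrable_norm _) hi2 (by positivity) ?_
  have h := norm_variance_le hA hU hβ.le hv.le hV hz hK x
  simp only [hconj] at h
  rw [integral_conj, ← hg] at h
  -- The resolvent at the conjugate of `z` is the entrywise conjugate, so the covariance without
  -- conjugation is here a true variance.
  have e : ((∫ ζ, ‖resolv (linMat A ζ) z x x - g‖ ^ 2 ∂(stdGauss κ) : ℝ) : ℂ) =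
      ∫ ζ, resolv (linMat A ζ) z x x * (starRingEnd ℂ) (resolv (linMat A ζ) z x x) ∂(stdGauss κ) -
        g * (starRingEnd ℂ) g := by
    rw [← integral_complex_ofReal]
    have e1 : ∀ ζ, ((‖resolv (linMat A ζ) z x x - g‖ ^ 2 : ℝ) : ℂ) =
        resolv (linMat A ζ) z x x * (starRingEnd ℂ) (resolv (linMat A ζ) z x x) -
        resolv (linMat A ζ) z x x * (starRingEnd ℂ) g -
        (g * (starRingEnd ℂ) (resolv (linMat A ζ) z x x) - g * (starRingEnd ℂ) g) := by
      intro ζ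
      push_cast
      rw [← Complex.mul_conj', map_sub]
      ring
    simp only [e1]
    have i1 := (bcont_resolv hA hz x x).mul hbc
    have i2 := (bcont_resolv hA hz x x).mul (BCont.const ((starRingEnd ℂ) g))
    have i3 := (BCont.const g).mul hbc
    rw [integral_sub ((i1.sub i2).integrable _) ((i3.sub (BCont.const _)).integrable _),
      integral_sub (i1.integrable _) (i2.integrable _),
      integral_sub (i3.integrable _) (integrable_const _), integral_mul_const, integral_const_mul,
      integral_conj, ← hg]
    simp
  rw [← e, Complex.norm_real, Real.norm_eq_abs] at h
  refine (le_abs_self _).trans (h.trans (le_of_eq ?_))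
  rw [mul_pow, mul_pow, Real.sq_sqrt (by positivity)]
  ring

end Loop

/-! ### The self-consistent equation for the diagonal. -/

section Loop2

variable {κ : Type*} [Fintype κ] [DecidableEq κ] {S : Type*} [Fintype S] [DecidableEq S]
variable {U : S → S → ℝ} {β v K : ℝ} {A A' : κ → Matrix S S ℝ} {z w : ℂ}

/-- Mean deviation of a diagonal resolvent entry from `w`. -/
noncomputable def diagDev (A : κ → Matrix S S ℝ) (z w : ℂ) (x : S) : ℝ :=
  ∫ ζ, ‖resolv (linMat A ζ) z x x - w‖ ∂(stdGauss κ)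

theorem bcont_diag_sub (hA : ∀ q, (A q).IsSymm) (hz : z.im ≠ 0) (w : ℂ) (x : S) :
    BCont (fun ζ => resolv (linMat A ζ) z x x - w) :=
  (bcont_resolv hA hz x x).sub (BCont.const _)

theorem diagDev_nonneg (x : S) : 0 ≤ diagDev A z w x := integral_nonneg fun _ => norm_nonneg _

theorem norm_integral_diag_sub_mul_le (hA : ∀ q, (A q).IsSymm) (hz : z.im ≠ 0) {s : S}
    {f : (κ → ℝ) → ℂ} {C : ℝ} (hC : ∀ ζ, ‖f ζ‖ ≤ C) :
    ‖∫ ζ, (resolv (linMat A ζ) z s s - w) * f ζ ∂(stdGauss κ)‖ ≤ C * diagDev A z w s := by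
  rw [diagDev, ← integral_const_mul]
  refine (norm_integral_le_of_norm_le
    (((bcont_diag_sub hA hz w s).integrable_norm _).const_mul C) (ae_of_all _ fun ζ => ?_))
  rw [norm_mul, mul_comm]
  exact mul_le_mul_of_nonneg_right (hC ζ) (norm_nonneg _)

/-- Integration by parts in `z G = H G - 1`, compared with the quadratic equation for `w`. The three
errors are the deviation of neighbouring diagonal entries, the defect of the row sum from 1, and the
second contraction `G(s,x)²`. -/
theorem diag_loop (hA : ∀ q, (A q).IsSymm) (hV : CovStruct A A (fun x y => v * U x y) 1)
    (hz : z.im ≠ 0) (hw : (z + v * w) * w = -1) (x : S) :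
    ∫ ζ, resolv (linMat A ζ) z x x ∂(stdGauss κ) - w =
      w * (∑ s, (v * U x s : ℝ) *
        ∫ ζ, (resolv (linMat A ζ) z s s - w) * resolv (linMat A ζ) z x x ∂(stdGauss κ) +
      v * (w * (∑ s, U x s - 1 : ℝ)) * ∫ ζ, resolv (linMat A ζ) z x x ∂(stdGauss κ) +
      ∫ ζ, ∑ s, ((v * U x s : ℝ) : ℂ) * resolv (linMat A ζ) z s x ^ 2 ∂(stdGauss κ)) := by
  have h := mul_integral_resolv hA hz x x (BCont.const 1)
  simp only [mul_one, if_true, one_mul] at h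
  have hb := fun i j => bcont_resolv hA hz i j
  have hstein : ∀ s, ∫ ζ, (linMat A ζ x s : ℂ) * resolv (linMat A ζ) z s x ∂(stdGauss κ) =
      -((v * U x s : ℝ) * ∫ ζ, (resolv (linMat A ζ) z s s - w) * resolv (linMat A ζ) z x x ∂(stdGauss κ)) -
        (v * U x s : ℝ) * w * ∫ ζ, resolv (linMat A ζ) z x x ∂(stdGauss κ) -
        ∫ ζ, ((v * U x s : ℝ) : ℂ) * resolv (linMat A ζ) z s x ^ 2 ∂(stdGauss κ) := by
    intro s
    have i1 := (BCont.const (v * U x s : ℝ)).mul ((bcont_diag_sub hA hz w s).mul (hb x x))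
    have i2 := (BCont.const ((v * U x s : ℝ) * w)).mul (hb x x)
    have i3 : BCont fun ζ => ((v * U x s : ℝ) : ℂ) * resolv (linMat A ζ) z s x ^ 2 := by
      simp only [sq]
      exact (BCont.const (v * U x s : ℝ)).mul ((hb s x).mul (hb s x))
    rw [integral_entry_mul (hasDirDeriv_resolv hA hV hz x s s x), ← integral_const_mul,
      ← integral_const_mul, ← integral_neg, ← integral_sub (i1.neg.integrable _) (i2.integrable _),
      ← integral_sub ((i1.neg.sub i2).integrable _) (i3.integrable _)]
    congr 1
    ext ζ
    push_cast
    ring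
  simp only [hstein, Finset.sum_sub_distrib, Finset.sum_neg_distrib] at h
  rw [integral_finsetSum]
  swap
  · intro s _
    have : BCont fun ζ => ((v * U x s : ℝ) : ℂ) * resolv (linMat A ζ) z s x ^ 2 := by
      simp only [sq]
      exact (BCont.const (v * U x s : ℝ)).mul ((hb s x).mul (hb s x))
    exact this.integrable _
  rw [← Finset.sum_mul, ← Finset.sum_mul] at h
  have e : ∑ s, ((v * U x s : ℝ) : ℂ) = v * (∑ s, U x s : ℝ) := by
    push_cast
    rw [Finset.mul_sum]
  rw [e] at h
  simp only [integral_const, probReal_univ, one_smul] at h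
  push_cast at h ⊢
  linear_combination -w * h + (∫ ζ, resolv (linMat A ζ) z x x ∂(stdGauss κ)) * hw

/-- The deviation is a fluctuation around the mean, bounded through the variance, plus the bias of
the mean, bounded through the loop equation. -/
theorem diagDev_le (hA : ∀ q, (A q).IsSymm) (hU : KernelBound U β) (hβ : 0 < β) (hv : 0 < v)
    (hV : CovStruct A A (fun x y => v * U x y) 1) (hz : z.im ≠ 0) (hK : 1 / |z.im| ≤ K)
    (hw : (z + v * w) * w = -1) (hwK : ‖w‖ ≤ K) (x : S) :
    diagDev A z w x ≤ 2 * √(v * β) * K ^ 2 + v * K ^ 2 * ∑ s, U x s * diagDev A z w s +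
      v * K ^ 3 * |∑ s, U x s - 1| + v * β * K ^ 3 := by
  have hK0 : 0 < K := lt_of_lt_of_le (by positivity) hK
  have hop := resolv_linMat_opBound hA hz hK
  set g := ∫ ξ, resolv (linMat A ξ) z x x ∂(stdGauss κ) with hg
  have hgK : ‖g‖ ≤ K := norm_integral_le_of_bound fun ζ => (hop ζ).entry x x
  have h1 : diagDev A z w x ≤ 2 * √(v * β) * K ^ 2 + ‖g - w‖ := by
    have hi := ((bcont_diag_sub hA hz g x).integrable_norm (stdGauss κ))
    calc diagDev A z w x ≤ ∫ ζ, (‖resolv (linMat A ζ) z x x - g‖ + ‖g - w‖) ∂(stdGauss κ) := by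
          refine integral_mono ((bcont_diag_sub hA hz w x).integrable_norm _)
            (hi.add (integrable_const _)) fun ζ => ?_
          simpa using norm_add_le (resolv (linMat A ζ) z x x - g) (g - w)
      _ = ∫ ζ, ‖resolv (linMat A ζ) z x x - g‖ ∂(stdGauss κ) + ‖g - w‖ := by
          rw [integral_add hi (integrable_const _)]
          simp
      _ ≤ _ := by
          have := integral_norm_sub_integral_le hA hU hβ hv hV hz hK x
          linarith
  have e1 : ‖∑ s, ((v * U x s : ℝ) : ℂ) * ∫ ζ, (resolv (linMat A ζ) z s s - w) *
      resolv (linMat A ζ) z x x ∂(stdGauss κ)‖ ≤ v * K * ∑ s, U x s * diagDev A z w s := by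
    rw [Finset.mul_sum]
    refine (norm_sum_le _ _).trans (Finset.sum_le_sum fun s _ => ?_)
    rw [norm_mul, Complex.norm_real, Real.norm_eq_abs,
      abs_of_nonneg (mul_nonneg hv.le (hU.nonneg x s))]
    have := norm_integral_diag_sub_mul_le (w := w) hA hz (s := s)
      (fun ζ => (hop ζ).entry x x)
    have hu := hU.nonneg x s
    calc _ ≤ v * U x s * (K * diagDev A z w s) := by gcongr
      _ = _ := by ring
  have e2 : ‖(v : ℂ) * (w * (∑ s, U x s - 1 : ℝ)) * g‖ ≤ v * K ^ 2 * |∑ s, U x s - 1| := by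
    rw [norm_mul, norm_mul, norm_mul, Complex.norm_real, Complex.norm_real, Real.norm_eq_abs,
      Real.norm_eq_abs, abs_of_pos hv]
    calc _ ≤ v * (K * |∑ s, U x s - 1|) * K := by gcongr
      _ = _ := by ring
  have e3 : ‖∫ ζ, ∑ s, ((v * U x s : ℝ) : ℂ) * resolv (linMat A ζ) z s x ^ 2 ∂(stdGauss κ)‖ ≤
      v * β * K ^ 2 := by
    refine norm_integral_le_of_bound fun ζ => ?_
    calc _ ≤ ∑ s, v * β * ‖resolv (linMat A ζ) z s x‖ ^ 2 := by
          refine (norm_sum_le _ _).trans (Finset.sum_le_sum fun s _ => ?_)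
          rw [norm_mul, Complex.norm_real, Real.norm_eq_abs,
            abs_of_nonneg (mul_nonneg hv.le (hU.nonneg x s)), norm_pow]
          have := hU.le x s
          gcongr
      _ = v * β * ∑ s, ‖resolv (linMat A ζ) z s x‖ ^ 2 := by rw [Finset.mul_sum]
      _ ≤ _ := by gcongr; exact (hop ζ).col_sq x
  have h2 : ‖g - w‖ ≤ K * (v * K * ∑ s, U x s * diagDev A z w s + v * K ^ 2 * |∑ s, U x s - 1| +
      v * β * K ^ 2) := by
    rw [hg, diag_loop hA hV hz hw x, norm_mul, ← hg]
    refine mul_le_mul hwK ?_ (norm_nonneg _) hK0.le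
    exact (norm_add_le _ _).trans (add_le_add ((norm_add_le _ _).trans (add_le_add e1 e2)) e3)
  calc _ ≤ _ := h1
    _ ≤ _ := add_le_add_right h2 _
    _ = _ := by ring

/-- Summed over sites, the self-referring term is at most `2 v K² ≤ 1/2` times the left side and is
absorbed. Summation is essential: near the edges the row sums are not close to 1, so no bound
uniform in the site is available. -/
theorem sum_diagDev_le (hA : ∀ q, (A q).IsSymm) (hU : KernelBound U β) (hβ : 0 < β) (hv : 0 < v)
    (hV : CovStruct A A (fun x y => v * U x y) 1) (hz : z.im ≠ 0) (hK : 1 / |z.im| ≤ K)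
    (hvK : v * K ^ 2 ≤ 1 / 4) (hw : (z + v * w) * w = -1) (hwK : ‖w‖ ≤ K) :
    ∑ x, diagDev A z w x ≤ 2 * (Fintype.card S * (2 * √(v * β) * K ^ 2 + v * β * K ^ 3) +
      v * K ^ 3 * ∑ x, |∑ s, U x s - 1|) := by
  have h := Finset.sum_le_sum fun x (_ : x ∈ Finset.univ) =>
    diagDev_le hA hU hβ hv hV hz hK hw hwK x
  simp only [Finset.sum_add_distrib, ← Finset.mul_sum, Finset.sum_const, Finset.card_univ,
    nsmul_eq_mul] at h
  have h2 := hU.sum_sum_mul_le (α := diagDev A z w) fun x => diagDev_nonneg x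
  have h0 : 0 ≤ ∑ x, diagDev A z w x := Finset.sum_nonneg fun x _ => diagDev_nonneg x
  have h3 : v * K ^ 2 * ∑ x, ∑ s, U x s * diagDev A z w s ≤
      1 / 4 * (2 * ∑ x, diagDev A z w x) := by
    refine mul_le_mul hvK h2 ?_ (by norm_num)
    exact Finset.sum_nonneg fun x _ => Finset.sum_nonneg fun s _ =>
      mul_nonneg (hU.nonneg x s) (diagDev_nonneg s)
  linarith

end Loop2

/-! ### The closed equation for the two-point function. -/

section TwoPoint

variable {κ : Type*} [Fintype κ] [DecidableEq κ] {S : Type*} [Fintype S] [DecidableEq S]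
variable {U : S → S → ℝ} {β v K c : ℝ} {A A' : κ → Matrix S S ℝ} {z₁ z₂ w₁ w₂ : ℂ}

/-- `E G₁(x,y) G₂(x,y)`. -/
noncomputable def twoPoint (A A' : κ → Matrix S S ℝ) (z₁ z₂ : ℂ) : Matrix S S ℂ :=
  Matrix.of fun x y => ∫ ζ, resolv (linMat A ζ) z₁ x y * resolv (linMat A' ζ) z₂ x y ∂(stdGauss κ)

/-- The error of the closed equation for `twoPoint`, before averaging. -/
noncomputable def twoPointErr (U : S → S → ℝ) (v c : ℝ) (w₁ w₂ : ℂ) (G₁ G₂ : Matrix S S ℂ)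
    (x y : S) : ℂ :=
  v * (w₁ - ∑ s, U x s * G₁ s s) * (G₁ x y * G₂ x y) -
    ∑ s, ((v * U x s : ℝ) : ℂ) * G₁ s x * (G₁ s y * G₂ x y) -
    ∑ s, ((c * (v * U x s) : ℝ) : ℂ) * G₂ x s * (G₁ s y * G₂ x y) +
    c * v * (w₂ - G₂ x x) * ∑ s, U x s * (G₁ s y * G₂ s y) -
    (if x = y then 1 else 0) * (G₂ x y - w₂)

/-- Integrating `H(x,s) G₁(s,y) G₂(x,y)` by parts gives four contractions. `G₁(s,s) G₁(x,y) G₂(x,y)`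
is absorbed in `w₁`, and `G₂(x,x) G₁(s,y) G₂(s,y)` becomes the `U F` term after replacing `G₂(x,x)`
by `w₂`; the other two, and the replacement errors, form `twoPointErr`. -/
theorem twoPoint_equation (hA : ∀ q, (A q).IsSymm) (hA' : ∀ q, (A' q).IsSymm)
    (hV : CovStruct A A (fun x y => v * U x y) 1) (hV' : CovStruct A A' (fun x y => v * U x y) c)
    (hz₁ : z₁.im ≠ 0) (hz₂ : z₂.im ≠ 0) (hw₁ : (z₁ + v * w₁) * w₁ = -1) (x y : S) :
    twoPoint A A' z₁ z₂ x y - w₁ * w₂ * (if x = y then 1 else 0) -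
      c * v * (w₁ * w₂) * ∑ s, U x s * twoPoint A A' z₁ z₂ s y =
    -w₁ * ∫ ζ, twoPointErr U v c w₁ w₂ (resolv (linMat A ζ) z₁) (resolv (linMat A' ζ) z₂) x y
      ∂(stdGauss κ) := by
  have h := mul_integral_resolv hA hz₁ x y (bcont_resolv hA' hz₂ x y)
  have b1 := fun i j => bcont_resolv hA hz₁ i j
  have b2 := fun i j => bcont_resolv hA' hz₂ i j
  have hst := fun s => integral_entry_mul ((hasDirDeriv_resolv hA hV hz₁ x s s y).mul
    (hasDirDeriv_resolv hA' hV' hz₂ x s x y))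
  simp only [hst] at h
  have bT : ∀ s, BCont fun ζ => -(((1 : ℝ) : ℂ) * ((v * U x s : ℝ) : ℂ) *
      (resolv (linMat A ζ) z₁ s x * resolv (linMat A ζ) z₁ s y +
        resolv (linMat A ζ) z₁ s s * resolv (linMat A ζ) z₁ x y)) * resolv (linMat A' ζ) z₂ x y +
      resolv (linMat A ζ) z₁ s y * -((c : ℂ) * ((v * U x s : ℝ) : ℂ) *
      (resolv (linMat A' ζ) z₂ x x * resolv (linMat A' ζ) z₂ s y +
        resolv (linMat A' ζ) z₂ x s * resolv (linMat A' ζ) z₂ x y)) := fun s =>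
    ((((BCont.const _).mul (((b1 s x).mul (b1 s y)).add ((b1 s s).mul (b1 x y)))).neg).mul
      (b2 x y)).add ((b1 s y).mul ((BCont.const _).mul
        (((b2 x x).mul (b2 s y)).add ((b2 x s).mul (b2 x y)))).neg)
  rw [← integral_finsetSum _ fun s _ => (bT s).integrable _] at h
  have bS := BCont.sum Finset.univ fun s (_ : s ∈ Finset.univ) => bT s
  have bF : ∀ s, BCont fun ζ => resolv (linMat A ζ) z₁ s y * resolv (linMat A' ζ) z₂ s y :=
    fun s => (b1 s y).mul (b2 s y)
  have bU : BCont fun ζ => ∑ s, (U x s : ℂ) *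
      (resolv (linMat A ζ) z₁ s y * resolv (linMat A' ζ) z₂ s y) :=
    BCont.sum _ fun s _ => (BCont.const _).mul (bF s)
  have hU : ∑ s, (U x s : ℂ) * twoPoint A A' z₁ z₂ s y = ∫ ζ, ∑ s, (U x s : ℂ) *
      (resolv (linMat A ζ) z₁ s y * resolv (linMat A' ζ) z₂ s y) ∂(stdGauss κ) := by
    rw [integral_finsetSum _ fun s _ => ((BCont.const _).mul (bF s)).integrable _]
    refine Finset.sum_congr rfl fun s _ => ?_
    rw [integral_const_mul, twoPoint, Matrix.of_apply]
  have hE : ∀ ζ, twoPointErr U v c w₁ w₂ (resolv (linMat A ζ) z₁) (resolv (linMat A' ζ) z₂) x y =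
      (∑ s, (-(((1 : ℝ) : ℂ) * ((v * U x s : ℝ) : ℂ) *
      (resolv (linMat A ζ) z₁ s x * resolv (linMat A ζ) z₁ s y +
        resolv (linMat A ζ) z₁ s s * resolv (linMat A ζ) z₁ x y)) * resolv (linMat A' ζ) z₂ x y +
      resolv (linMat A ζ) z₁ s y * -((c : ℂ) * ((v * U x s : ℝ) : ℂ) *
      (resolv (linMat A' ζ) z₂ x x * resolv (linMat A' ζ) z₂ s y +
        resolv (linMat A' ζ) z₂ x s * resolv (linMat A' ζ) z₂ x y)))) -
      (if x = y then 1 else 0) * resolv (linMat A' ζ) z₂ x y +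
      (v * w₁) * (resolv (linMat A ζ) z₁ x y * resolv (linMat A' ζ) z₂ x y) +
      (c * v * w₂) * (∑ s, (U x s : ℂ) *
        (resolv (linMat A ζ) z₁ s y * resolv (linMat A' ζ) z₂ s y)) +
      (if x = y then 1 else 0) * w₂ := by
    intro ζ
    generalize resolv (linMat A ζ) z₁ = G₁
    generalize resolv (linMat A' ζ) z₂ = G₂
    have e : (∑ s, (-(((1 : ℝ) : ℂ) * ((v * U x s : ℝ) : ℂ) * (G₁ s x * G₁ s y + G₁ s s * G₁ x y)) *
        G₂ x y + G₁ s y * -((c : ℂ) * ((v * U x s : ℝ) : ℂ) *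
        (G₂ x x * G₂ s y + G₂ x s * G₂ x y)))) =
        -∑ s, ((v * U x s : ℝ) : ℂ) * G₁ s x * (G₁ s y * G₂ x y) -
        (v * ∑ s, U x s * G₁ s s) * (G₁ x y * G₂ x y) -
        ∑ s, ((c * (v * U x s) : ℝ) : ℂ) * G₂ x s * (G₁ s y * G₂ x y) -
        c * v * G₂ x x * ∑ s, U x s * (G₁ s y * G₂ s y) := by
      simp only [Finset.mul_sum, Finset.sum_mul, ← Finset.sum_neg_distrib, ← Finset.sum_sub_distrib]
      refine Finset.sum_congr rfl fun s _ => ?_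
      push_cast
      ring
    rw [e, twoPointErr]
    ring
  simp only [hE]
  have j1 := bS.sub ((BCont.const (if x = y then 1 else 0)).mul (b2 x y))
  have j2 := j1.add ((BCont.const (v * w₁)).mul (bF x))
  have j3 := j2.add ((BCont.const (c * v * w₂)).mul bU)
  rw [integral_add (j3.integrable _) (integrable_const _),
    integral_add (j2.integrable _) (((BCont.const (c * v * w₂)).mul bU).integrable _),
    integral_add (j1.integrable _) (((BCont.const (v * w₁)).mul (bF x)).integrable _),
    integral_sub (bS.integrable _) (((BCont.const (if x = y then 1 else 0)).mul (b2 x y)).integrable _),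
    integral_const_mul, integral_const_mul, integral_const_mul, ← hU]
  simp only [integral_const, probReal_univ, one_smul]
  have e3 : twoPoint A A' z₁ z₂ x y = ∫ ζ, resolv (linMat A ζ) z₁ x y *
      resolv (linMat A' ζ) z₂ x y ∂(stdGauss κ) := rfl
  rw [e3]
  linear_combination -w₁ * h + (∫ ζ, resolv (linMat A ζ) z₁ x y *
      resolv (linMat A' ζ) z₂ x y ∂(stdGauss κ)) * hw₁

/-- Outside the Kronecker term, the sum over `y` always meets one entry of `G₁` and one of `G₂`, so
Cauchy–Schwarz costs only `K²`. What remains is small either by `√(2β)`, from an extra off-diagonal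
entry weighted by `U`, or through the diagonal deviations and the row defect. -/
theorem sum_norm_twoPointErr_le (hU : KernelBound U β) (hβ : 0 ≤ β) (hv : 0 ≤ v) (hc : |c| ≤ 1)
    {G₁ G₂ : Matrix S S ℂ} (h₁ : OpBound G₁ K) (h₂ : OpBound G₂ K)
    (s₁ : ∀ x y, G₁ x y = G₁ y x) (s₂ : ∀ x y, G₂ x y = G₂ y x) (hw₁ : ‖w₁‖ ≤ K) (x : S) :
    ∑ y, ‖twoPointErr U v c w₁ w₂ G₁ G₂ x y‖ ≤
      2 * v * √(2 * β) * K ^ 3 + v * K ^ 2 * (∑ s, U x s * ‖G₁ s s - w₁‖ + K * |∑ s, U x s - 1|) +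
      (2 * v * K ^ 2 + 1) * ‖G₂ x x - w₂‖ := by
  have hK := h₁.1
  have row₁₂ : ∀ i j, ∑ y, ‖G₁ i y‖ * ‖G₂ j y‖ ≤ K ^ 2 := by
    intro i j
    simp only [s₁ i, s₂ j, sq]
    exact h₁.col_mul h₂ i j
  have U1 : ∑ s, U x s * ‖G₁ s x‖ ≤ √(2 * β) * K :=
    hU.sum_mul_le hβ hK (h₁.col_sq x) x
  have U2 : ∑ s, U x s * ‖G₂ x s‖ ≤ √(2 * β) * K := by
    simp only [s₂ x]
    exact hU.sum_mul_le hβ hK (h₂.col_sq x) x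
  have t1 : ‖w₁ - ∑ s, U x s * G₁ s s‖ ≤ ∑ s, U x s * ‖G₁ s s - w₁‖ + K * |∑ s, U x s - 1| := by
    have e : w₁ - ∑ s, (U x s : ℂ) * G₁ s s =
        -∑ s, (U x s : ℂ) * (G₁ s s - w₁) - w₁ * ((∑ s, U x s - 1 : ℝ) : ℂ) := by
      simp only [mul_sub, Finset.sum_sub_distrib, ← Finset.sum_mul]
      push_cast
      ring
    rw [e]
    refine (norm_sub_le _ _).trans (add_le_add ?_ ?_)
    · rw [norm_neg]
      refine (norm_sum_le _ _).trans (Finset.sum_le_sum fun s _ => ?_)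
      rw [norm_mul, Complex.norm_real, Real.norm_eq_abs, abs_of_nonneg (hU.nonneg x s)]
    · rw [norm_mul, Complex.norm_real, Real.norm_eq_abs]
      gcongr
  have hterm : ∀ y, ‖twoPointErr U v c w₁ w₂ G₁ G₂ x y‖ ≤
      v * ‖w₁ - ∑ s, U x s * G₁ s s‖ * (‖G₁ x y‖ * ‖G₂ x y‖) +
      ∑ s, v * U x s * ‖G₁ s x‖ * (‖G₁ s y‖ * ‖G₂ x y‖) +
      ∑ s, v * U x s * ‖G₂ x s‖ * (‖G₁ s y‖ * ‖G₂ x y‖) +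
      v * ‖G₂ x x - w₂‖ * ∑ s, U x s * (‖G₁ s y‖ * ‖G₂ s y‖) +
      (if x = y then ‖G₂ x y - w₂‖ else 0) := by
    intro y
    have hcv : ‖(c : ℂ) * v‖ ≤ v := by
      rw [norm_mul, Complex.norm_real, Complex.norm_real, Real.norm_eq_abs, Real.norm_eq_abs,
        abs_of_nonneg hv]
      exact mul_le_of_le_one_left hv hc
    unfold twoPointErr
    refine (norm_sub_le _ _).trans (add_le_add ((norm_add_le _ _).trans (add_le_add
      ((norm_sub_le _ _).trans (add_le_add ((norm_sub_le _ _).trans (add_le_add ?_ ?_)) ?_)) ?_)) ?_)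
    · rw [norm_mul, norm_mul, norm_mul, Complex.norm_real, Real.norm_eq_abs, abs_of_nonneg hv]
    · refine (norm_sum_le _ _).trans (Finset.sum_le_sum fun s _ => ?_)
      rw [norm_mul, norm_mul, norm_mul, Complex.norm_real, Real.norm_eq_abs,
        abs_of_nonneg (mul_nonneg hv (hU.nonneg x s))]
    · refine (norm_sum_le _ _).trans (Finset.sum_le_sum fun s _ => ?_)
      have := mul_nonneg hv (hU.nonneg x s)
      rw [norm_mul, norm_mul, norm_mul, Complex.norm_real, Real.norm_eq_abs, abs_mul,
        abs_of_nonneg this]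
      have : |c| * (v * U x s) ≤ v * U x s := mul_le_of_le_one_left this hc
      gcongr
    · rw [norm_mul, norm_mul, ← norm_neg (w₂ - G₂ x x), neg_sub]
      refine mul_le_mul (mul_le_mul_of_nonneg_right hcv (norm_nonneg _)) ?_ (norm_nonneg _)
        (mul_nonneg hv (norm_nonneg _))
      refine (norm_sum_le _ _).trans (Finset.sum_le_sum fun s _ => ?_)
      rw [norm_mul, norm_mul, Complex.norm_real, Real.norm_eq_abs, abs_of_nonneg (hU.nonneg x s)]
    · split_ifs <;> simp
  refine (Finset.sum_le_sum fun y _ => hterm y).trans ?_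
  simp only [Finset.sum_add_distrib, Finset.sum_ite_eq, Finset.mem_univ, if_true]
  have a1 : ∑ y, v * ‖w₁ - ∑ s, U x s * G₁ s s‖ * (‖G₁ x y‖ * ‖G₂ x y‖) ≤
      v * K ^ 2 * (∑ s, U x s * ‖G₁ s s - w₁‖ + K * |∑ s, U x s - 1|) := by
    rw [← Finset.mul_sum]
    calc _ ≤ v * (∑ s, U x s * ‖G₁ s s - w₁‖ + K * |∑ s, U x s - 1|) * K ^ 2 := by
          have h0 := (norm_nonneg _).trans t1
          have := row₁₂ x x
          gcongr
      _ = _ := by ring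
  have a2 : ∀ f : S → ℝ, (∀ s, 0 ≤ f s) → ∑ s, U x s * f s ≤ √(2 * β) * K →
      ∑ y, ∑ s, v * U x s * f s * (‖G₁ s y‖ * ‖G₂ x y‖) ≤ v * √(2 * β) * K ^ 3 := by
    intro f hf0 hf
    rw [Finset.sum_comm]
    simp only [← Finset.mul_sum]
    calc _ ≤ ∑ s, v * U x s * f s * K ^ 2 := by
          refine Finset.sum_le_sum fun s _ => ?_
          have := hU.nonneg x s
          have := hf0 s
          have := row₁₂ s x
          gcongr
      _ = v * K ^ 2 * ∑ s, U x s * f s := by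
          rw [Finset.mul_sum]
          exact Finset.sum_congr rfl fun s _ => by ring
      _ ≤ v * K ^ 2 * (√(2 * β) * K) := by gcongr
      _ = _ := by ring
  have a4 : ∑ y, v * ‖G₂ x x - w₂‖ * ∑ s, U x s * (‖G₁ s y‖ * ‖G₂ s y‖) ≤
      2 * v * K ^ 2 * ‖G₂ x x - w₂‖ := by
    rw [← Finset.mul_sum, Finset.sum_comm]
    simp only [← Finset.mul_sum]
    calc _ ≤ v * ‖G₂ x x - w₂‖ * ∑ s, U x s * K ^ 2 := by
          gcongr with s _
          · exact hU.nonneg x s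
          · exact row₁₂ s s
      _ ≤ v * ‖G₂ x x - w₂‖ * (2 * K ^ 2) := by
          rw [← Finset.sum_mul]
          have := hU.row_le x
          gcongr
      _ = _ := by ring
  have b2 := a2 (fun s => ‖G₁ s x‖) (fun _ => norm_nonneg _) U1
  have b3 := a2 (fun s => ‖G₂ x s‖) (fun _ => norm_nonneg _) U2
  linarith

theorem bcont_twoPointErr (hA : ∀ q, (A q).IsSymm) (hA' : ∀ q, (A' q).IsSymm)
    (hz₁ : z₁.im ≠ 0) (hz₂ : z₂.im ≠ 0) (x y : S) :
    BCont fun ζ => twoPointErr U v c w₁ w₂ (resolv (linMat A ζ) z₁) (resolv (linMat A' ζ) z₂) x y := by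
  have b1 := fun i j => bcont_resolv hA hz₁ i j
  have b2 := fun i j => bcont_resolv hA' hz₂ i j
  unfold twoPointErr
  refine BCont.sub (BCont.add (BCont.sub (BCont.sub ?_ ?_) ?_) ?_) ?_
  · exact ((BCont.const _).mul ((BCont.const _).sub (BCont.sum _ fun s _ =>
      (BCont.const _).mul (b1 s s)))).mul ((b1 x y).mul (b2 x y))
  · exact BCont.sum _ fun s _ => ((BCont.const _).mul (b1 s x)).mul ((b1 s y).mul (b2 x y))
  · exact BCont.sum _ fun s _ => ((BCont.const _).mul (b2 x s)).mul ((b1 s y).mul (b2 x y))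
  · exact ((BCont.const _).mul ((BCont.const _).sub (b2 x x))).mul (BCont.sum _ fun s _ =>
      (BCont.const _).mul ((b1 s y).mul (b2 s y)))
  · exact (BCont.const _).mul ((b2 x y).sub (BCont.const _))

theorem sum_sum_norm_twoPoint_sub_le (hA : ∀ q, (A q).IsSymm) (hA' : ∀ q, (A' q).IsSymm)
    (hU : KernelBound U β) (hβ : 0 ≤ β) (hv : 0 ≤ v) (hc : |c| ≤ 1)
    (hV : CovStruct A A (fun x y => v * U x y) 1) (hV' : CovStruct A A' (fun x y => v * U x y) c)
    (hz₁ : z₁.im ≠ 0) (hz₂ : z₂.im ≠ 0) (hK₁ : 1 / |z₁.im| ≤ K) (hK₂ : 1 / |z₂.im| ≤ K)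
    (hw₁ : (z₁ + v * w₁) * w₁ = -1) (hwK : ‖w₁‖ ≤ K) :
    ∑ x, ∑ y, ‖twoPoint A A' z₁ z₂ x y - w₁ * w₂ * (if x = y then 1 else 0) -
      c * v * (w₁ * w₂) * ∑ s, U x s * twoPoint A A' z₁ z₂ s y‖ ≤
    K * (Fintype.card S * (2 * v * √(2 * β) * K ^ 3) +
      v * K ^ 2 * (2 * ∑ x, diagDev A z₁ w₁ x + K * ∑ x, |∑ s, U x s - 1|) +
      (2 * v * K ^ 2 + 1) * ∑ x, diagDev A' z₂ w₂ x) := by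
  have hK0 : 0 ≤ K := le_trans (by positivity) hK₁
  have hx : ∀ x, ∑ y, ‖∫ ζ, twoPointErr U v c w₁ w₂ (resolv (linMat A ζ) z₁)
      (resolv (linMat A' ζ) z₂) x y ∂(stdGauss κ)‖ ≤
      2 * v * √(2 * β) * K ^ 3 + v * K ^ 2 * (∑ s, U x s * diagDev A z₁ w₁ s +
        K * |∑ s, U x s - 1|) + (2 * v * K ^ 2 + 1) * diagDev A' z₂ w₂ x := by
    intro x
    have i1 := fun s => ((bcont_diag_sub hA hz₁ w₁ s).integrable_norm (stdGauss κ)).const_mul (U x s)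
    have i1' := integrable_finsetSum Finset.univ fun s (_ : s ∈ Finset.univ) => i1 s
    have i2 := (bcont_diag_sub hA' hz₂ w₂ x).integrable_norm (stdGauss κ)
    have i3 := (i1'.add (integrable_const (K * |∑ s, U x s - 1|))).const_mul (v * K ^ 2)
    have i4 := (integrable_const (μ := stdGauss κ) (2 * v * √(2 * β) * K ^ 3)).add i3
    refine (sum_norm_integral_le (fun y => bcont_twoPointErr hA hA' hz₁ hz₂ x y)
      (i4.add (i2.const_mul (2 * v * K ^ 2 + 1))) fun ζ => sum_norm_twoPointErr_le hU hβ hv hc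
      (resolv_linMat_opBound hA hz₁ hK₁ ζ) (resolv_linMat_opBound hA' hz₂ hK₂ ζ)
      (resolv_symm_apply (linMat_isSymm hA ζ)) (resolv_symm_apply (linMat_isSymm hA' ζ))
      hwK x).trans (le_of_eq ?_)
    have e := integral_add' i4 (i2.const_mul (2 * v * K ^ 2 + 1))
    rw [e, integral_add' (integrable_const _) i3, integral_const_mul, integral_const_mul,
      integral_add' i1' (integrable_const _), integral_finsetSum _ fun s _ => i1 s]
    simp only [integral_const_mul, integral_const, probReal_univ, one_smul, diagDev]
  calc _ = ∑ x, ∑ y, norm w₁ * norm (∫ ζ, twoPointErr U v c w₁ w₂ (resolv (linMat A ζ) z₁)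
      (resolv (linMat A' ζ) z₂) x y ∂(stdGauss κ)) := by
        refine Finset.sum_congr rfl fun x _ => Finset.sum_congr rfl fun y _ => ?_
        rw [twoPoint_equation hA hA' hV hV' hz₁ hz₂ hw₁ x y, norm_mul, norm_neg]
    _ ≤ ∑ x, K * (2 * v * √(2 * β) * K ^ 3 + v * K ^ 2 * (∑ s, U x s * diagDev A z₁ w₁ s +
        K * |∑ s, U x s - 1|) + (2 * v * K ^ 2 + 1) * diagDev A' z₂ w₂ x) := by
        refine Finset.sum_le_sum fun x _ => ?_
        rw [← Finset.mul_sum]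
        have := hx x
        gcongr
    _ ≤ _ := by
        rw [← Finset.mul_sum]
        refine mul_le_mul_of_nonneg_left ?_ hK0
        simp only [Finset.sum_add_distrib, ← Finset.mul_sum, Finset.sum_const, Finset.card_univ,
          nsmul_eq_mul]
        have h := mul_le_mul_of_nonneg_left (hU.sum_sum_mul_le (α := diagDev A z₁ w₁) fun x =>
          diagDev_nonneg x) (show 0 ≤ v * K ^ 2 by positivity)
        linarith

end TwoPoint

/-! ### Inverting `1 - k U` on `ℓ¹`, and traces of the inverse. -/

section KernelResolvent

variable {S : Type*} [Fintype S] [DecidableEq S] {U : S → S → ℝ} {β : ℝ} {k : ℂ}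

/-- The kernel `U` as a complex matrix. -/
noncomputable def kerMat (U : S → S → ℝ) : Matrix S S ℂ := Matrix.of fun x y => (U x y : ℂ)

/-- `(1 - k U)⁻¹`. -/
noncomputable def kerRes (U : S → S → ℝ) (k : ℂ) : Matrix S S ℂ := (1 - k • kerMat U)⁻¹

theorem kerMat_mulVec_l1 (hU : KernelBound U β) (f : S → ℂ) :
    ∑ x, ‖(kerMat U).mulVec f x‖ ≤ 2 * ∑ x, ‖f x‖ := by
  refine le_trans ?_ (hU.sum_sum_mul_le fun x => norm_nonneg (f x))
  refine Finset.sum_le_sum fun x _ => ?_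
  simp only [Matrix.mulVec, dotProduct, kerMat, Matrix.of_apply]
  refine (norm_sum_le _ _).trans (Finset.sum_le_sum fun s _ => ?_)
  rw [norm_mul, Complex.norm_real, Real.norm_eq_abs, abs_of_nonneg (hU.nonneg x s)]

/-- The operator `k U` contracts `ℓ¹` by `2 · 1/4 = 1/2`. -/
theorem l1_le_of_kernel (hU : KernelBound U β) (hk : ‖k‖ ≤ 1 / 4) (f : S → ℂ) :
    ∑ x, ‖f x‖ ≤ 2 * ∑ x, ‖(1 - k • kerMat U).mulVec f x‖ := by
  have h1 : ∀ x, ‖f x‖ ≤ ‖(1 - k • kerMat U).mulVec f x‖ +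
      1 / 4 * ‖(kerMat U).mulVec f x‖ := by
    intro x
    have e : f x = (1 - k • kerMat U).mulVec f x + k * (kerMat U).mulVec f x := by
      simp [Matrix.sub_mulVec, Matrix.smul_mulVec]
    have h2 : ‖f x‖ ≤ ‖(1 - k • kerMat U).mulVec f x‖ + ‖k * (kerMat U).mulVec f x‖ := by
      conv_lhs => rw [e]
      exact norm_add_le _ _
    rw [norm_mul] at h2
    have := mul_le_mul_of_nonneg_right hk (norm_nonneg ((kerMat U).mulVec f x))
    linarith
  have h2 := Finset.sum_le_sum fun x (_ : x ∈ Finset.univ) => h1 x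
  rw [Finset.sum_add_distrib, ← Finset.mul_sum] at h2
  have := kerMat_mulVec_l1 hU f
  linarith

theorem isUnit_det_kernel (hU : KernelBound U β) (hk : ‖k‖ ≤ 1 / 4) :
    IsUnit (1 - k • kerMat U).det := by
  rw [← Matrix.isUnit_iff_isUnit_det, ← Matrix.mulVec_injective_iff_isUnit]
  intro f g hfg
  have h := l1_le_of_kernel hU hk (f - g)
  rw [Matrix.mulVec_sub, hfg, sub_self] at h
  simp only [Pi.zero_apply, norm_zero, Finset.sum_const_zero, mul_zero] at h
  have h0 := le_antisymm h (Finset.sum_nonneg fun x _ => norm_nonneg ((f - g) x))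
  rw [Finset.sum_eq_zero_iff_of_nonneg (fun _ _ => norm_nonneg _)] at h0
  ext x
  simpa [sub_eq_zero] using h0 x (Finset.mem_univ x)

theorem kernel_mul_kerRes (hU : KernelBound U β) (hk : ‖k‖ ≤ 1 / 4) :
    (1 - k • kerMat U) * kerRes U k = 1 := Matrix.mul_nonsing_inv _ (isUnit_det_kernel hU hk)

theorem kerRes_mul_kernel (hU : KernelBound U β) (hk : ‖k‖ ≤ 1 / 4) :
    kerRes U k * (1 - k • kerMat U) = 1 := Matrix.nonsing_inv_mul _ (isUnit_det_kernel hU hk)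

theorem kerRes_l1 (hU : KernelBound U β) (hk : ‖k‖ ≤ 1 / 4) (r : S → ℂ) :
    ∑ x, ‖(kerRes U k).mulVec r x‖ ≤ 2 * ∑ x, ‖r x‖ := by
  have h := l1_le_of_kernel hU hk ((kerRes U k).mulVec r)
  rwa [Matrix.mulVec_mulVec, kernel_mul_kerRes hU hk, Matrix.one_mulVec] at h

/-- The matrix satisfies `M = U + k M U`. At an entry of maximal modulus in row `x` this reads `max
≤ β + max / 2`. -/
theorem norm_kerMat_mul_kerRes_le (hU : KernelBound U β) (hk : ‖k‖ ≤ 1 / 4) (x y : S) :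
    ‖(kerMat U * kerRes U k) x y‖ ≤ 2 * β := by
  set M := kerMat U * kerRes U k with hM
  have e : M = kerMat U + k • (M * kerMat U) := by
    have : M * (1 - k • kerMat U) = kerMat U := by
      rw [hM, mul_assoc, kerRes_mul_kernel hU hk, mul_one]
    rw [mul_sub, mul_one, Matrix.mul_smul] at this
    exact sub_eq_iff_eq_add.1 this
  obtain ⟨y₀, -, hy₀⟩ := Finset.exists_max_image Finset.univ (fun y => ‖M x y‖) ⟨y, Finset.mem_univ y⟩
  have h1 : ‖M x y₀‖ ≤ β + 1 / 4 * (2 * ‖M x y₀‖) := by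
    have e' : M x y₀ = kerMat U x y₀ + k * (M * kerMat U) x y₀ := by
      conv_lhs => rw [e]
      rfl
    have h2 : ‖(M * kerMat U) x y₀‖ ≤ 2 * ‖M x y₀‖ := by
      rw [Matrix.mul_apply]
      calc _ ≤ ∑ s, ‖M x y₀‖ * U y₀ s := by
            refine (norm_sum_le _ _).trans (Finset.sum_le_sum fun s _ => ?_)
            rw [norm_mul, kerMat, Matrix.of_apply, Complex.norm_real, Real.norm_eq_abs,
              abs_of_nonneg (hU.nonneg _ _), hU.symm s y₀]
            exact mul_le_mul_of_nonneg_right (hy₀ s (Finset.mem_univ s)) (hU.nonneg _ _)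
        _ ≤ ‖M x y₀‖ * 2 := by
            rw [← Finset.mul_sum]
            exact mul_le_mul_of_nonneg_left (hU.row_le y₀) (norm_nonneg _)
        _ = _ := by ring
    have h3 : ‖kerMat U x y₀‖ ≤ β := by
      rw [kerMat, Matrix.of_apply, Complex.norm_real, Real.norm_eq_abs,
        abs_of_nonneg (hU.nonneg _ _)]
      exact hU.le _ _
    calc ‖M x y₀‖ ≤ ‖kerMat U x y₀‖ + ‖k * (M * kerMat U) x y₀‖ := by
          conv_lhs => rw [e']
          exact norm_add_le _ _
      _ ≤ _ := by
          rw [norm_mul]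
          gcongr
  have h4 : ‖M x y‖ ≤ ‖M x y₀‖ := hy₀ y (Finset.mem_univ y)
  linarith

/-- If `E` is the defect of `F` in the equation, then `U F = α U (1 - kU)⁻¹ + U (1 - kU)⁻¹ E`.
Pairing the entrywise bound `2β` with the `ℓ¹` norm of `E` is what lets an `o(N)` defect suffice at
scale `N / b`. -/
theorem norm_trace_sub_le (hU : KernelBound U β) (hk : ‖k‖ ≤ 1 / 4) (F : Matrix S S ℂ) (α : ℂ) :
    ‖(kerMat U * F).trace - α * (kerMat U * kerRes U k).trace‖ ≤
      2 * β * ∑ x, ∑ y, ‖F x y - α * (if x = y then 1 else 0) - k * ∑ s, U x s * F s y‖ := by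
  set E : Matrix S S ℂ := (1 - k • kerMat U) * F - α • 1 with hE
  have hEx : ∀ x y, E x y = F x y - α * (if x = y then 1 else 0) - k * ∑ s, U x s * F s y := by
    intro x y
    simp only [hE, sub_mul, one_mul, Matrix.sub_apply, Matrix.smul_mul, Matrix.smul_apply,
      Matrix.mul_apply, kerMat, Matrix.of_apply, Matrix.one_apply, smul_eq_mul]
    ring
  have e : kerMat U * F = α • (kerMat U * kerRes U k) + kerMat U * kerRes U k * E := by
    have : F = kerRes U k * ((1 - k • kerMat U) * F) := by
      rw [← mul_assoc, kerRes_mul_kernel hU hk, one_mul]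
    conv_lhs => rw [this]
    rw [hE, mul_sub, mul_assoc]
    simp
  rw [e, Matrix.trace_add, Matrix.trace_smul, smul_eq_mul, add_sub_cancel_left, Matrix.trace]
  simp only [Matrix.diag_apply, Matrix.mul_apply (M := kerMat U * kerRes U k), ← hEx]
  rw [Finset.sum_comm]
  refine (norm_sum_le _ _).trans ?_
  rw [Finset.mul_sum]
  refine Finset.sum_le_sum fun x _ => (norm_sum_le _ _).trans ?_
  rw [Finset.mul_sum]
  refine Finset.sum_le_sum fun y _ => ?_
  rw [norm_mul]
  exact mul_le_mul_of_nonneg_right (norm_kerMat_mul_kerRes_le hU hk y x) (norm_nonneg _)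

/-- The first Neumann term is split off because its symbol `û` need not be integrable, while its
trace is explicit; the rest is quadratic in `U` and can be dominated in frequency. -/
theorem trace_kerMat_mul_kerRes (hU : KernelBound U β) (hk : ‖k‖ ≤ 1 / 4) :
    (kerMat U * kerRes U k).trace = ∑ x, (U x x : ℂ) +
      k * (kerMat U * kerRes U k * kerMat U).trace := by
  have e : kerRes U k = 1 + k • (kerRes U k * kerMat U) := by
    have := kerRes_mul_kernel hU hk
    rw [mul_sub, mul_one, Matrix.mul_smul] at this
    exact sub_eq_iff_eq_add.1 this
  conv_lhs => rw [e]
  rw [mul_add, mul_one, Matrix.trace_add, Matrix.mul_smul, Matrix.trace_smul, mul_assoc]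
  rfl

/-- The quadratic form of `U (1 - k U)⁻¹ U`. -/
noncomputable def kerForm (U : S → S → ℝ) (k : ℂ) (e : S → ℂ) : ℂ :=
  ∑ x, (starRingEnd ℂ) (e x) * (kerMat U * kerRes U k * kerMat U).mulVec e x

/-- If `U e = s e + r`, then `(1 - k s)(1 - k U)⁻¹ e = e + k (1 - k U)⁻¹ r`, and the form acts on
`e` as multiplication by `s² / (1 - k s)` up to terms in `r`. As `|e| = 1` pointwise, an `ℓ¹` bound
on `r` is enough. The constant is `4/3 + 4/3 · 4 = 20/3 ≤ 7`. -/
theorem norm_kerForm_sub_le (hU : KernelBound U β) (hk : ‖k‖ ≤ 1 / 4) {e : S → ℂ}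
    (he : ∀ x, ‖e x‖ = 1) {s : ℂ} (hs : ‖s‖ ≤ 1) {δ : ℝ}
    (hδ : ∑ x, ‖(kerMat U).mulVec e x - s * e x‖ ≤ δ) :
    ‖kerForm U k e - Fintype.card S * (s ^ 2 / (1 - k * s))‖ ≤ 7 * δ := by
  set r : S → ℂ := fun x => (kerMat U).mulVec e x - s * e x with hr
  have hUe : (kerMat U).mulVec e = s • e + r := by
    ext x; simp [hr]
  set B := kerRes U k with hB
  have hks : ‖k * s‖ ≤ 1 / 4 := by
    rw [norm_mul]
    calc ‖k‖ * ‖s‖ ≤ 1 / 4 * 1 := by gcongr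
      _ = 1 / 4 := by ring
  have hden : 3 / 4 ≤ ‖1 - k * s‖ := by
    have := norm_sub_norm_le (1 : ℂ) (k * s)
    rw [norm_one] at this
    linarith
  have hne : 1 - k * s ≠ 0 := by
    intro h
    rw [h, norm_zero] at hden
    linarith
  have hBe : (1 - k * s) • B.mulVec e = e + k • B.mulVec r := by
    have h1 : B.mulVec ((1 - k • kerMat U).mulVec e) = e := by
      rw [Matrix.mulVec_mulVec, kerRes_mul_kernel hU hk, Matrix.one_mulVec]
    rw [Matrix.sub_mulVec, Matrix.one_mulVec, Matrix.smul_mulVec, hUe, Matrix.mulVec_sub,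
      Matrix.mulVec_smul, Matrix.mulVec_add, Matrix.mulVec_smul] at h1
    ext x
    have := congrFun h1 x
    simp at this ⊢
    linear_combination this
  set g : S → ℂ := (kerMat U).mulVec (B.mulVec r) with hg
  have hgs : ∑ x, ‖g x‖ ≤ 4 * δ := by
    have h1 := kerMat_mulVec_l1 hU (B.mulVec r)
    have h2 := kerRes_l1 hU hk r
    linarith
  have hmain : ∀ x, (kerMat U * B * kerMat U).mulVec e x =
      s ^ 2 / (1 - k * s) * e x + (s / (1 - k * s) * (r x + k * g x) + g x) := by
    intro x
    have hBe' : B.mulVec e = (1 - k * s)⁻¹ • (e + k • B.mulVec r) := by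
      rw [← hBe, smul_smul, inv_mul_cancel₀ hne, one_smul]
    rw [← Matrix.mulVec_mulVec, hUe, ← Matrix.mulVec_mulVec, Matrix.mulVec_add, Matrix.mulVec_smul,
      hBe', Matrix.mulVec_add, Matrix.mulVec_smul, Matrix.mulVec_smul, Matrix.mulVec_add,
      Matrix.mulVec_smul, hUe, ← hg]
    simp
    field_simp
    ring
  have e1 : kerForm U k e - Fintype.card S * (s ^ 2 / (1 - k * s)) =
      ∑ x, (starRingEnd ℂ) (e x) * (s / (1 - k * s) * (r x + k * g x) + g x) := by
    have h1 : ∀ x, (starRingEnd ℂ) (e x) * e x = 1 := by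
      intro x
      rw [Complex.conj_mul', he]; simp
    have h2 : (Fintype.card S : ℂ) * (s ^ 2 / (1 - k * s)) = ∑ x : S, (s ^ 2 / (1 - k * s)) := by
      simp
    rw [kerForm, h2, ← Finset.sum_sub_distrib]
    refine Finset.sum_congr rfl fun x _ => ?_
    rw [hmain x]
    linear_combination (s ^ 2 / (1 - k * s)) * h1 x
  rw [e1]
  have hq : ‖s / (1 - k * s)‖ ≤ 4 / 3 := by
    rw [norm_div, div_le_iff₀ (by linarith)]
    linarith
  calc _ ≤ ∑ x, (4 / 3 * (‖r x‖ + 1 / 4 * ‖g x‖) + ‖g x‖) := by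
        refine (norm_sum_le _ _).trans (Finset.sum_le_sum fun x _ => ?_)
        rw [norm_mul, RCLike.norm_conj, he, one_mul]
        refine (norm_add_le _ _).trans (add_le_add ?_ le_rfl)
        rw [norm_mul]
        refine mul_le_mul hq ((norm_add_le _ _).trans (add_le_add le_rfl ?_)) (norm_nonneg _)
          (by norm_num)
        rw [norm_mul]
        gcongr
    _ = 4 / 3 * ∑ x, ‖r x‖ + 4 / 3 * ∑ x, ‖g x‖ := by
        rw [Finset.mul_sum, Finset.mul_sum, ← Finset.sum_add_distrib]
        exact Finset.sum_congr rfl fun x _ => by ring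
    _ ≤ 7 * δ := by
        have h0 : 0 ≤ δ := le_trans (Finset.sum_nonneg fun _ _ => norm_nonneg _) hδ
        linarith

/-- By symmetry one factor `U` moves to the left vector, so the bound is quadratic in `sup |U e|`.
The square turns decay `1/|p|` into an integrable majorant. -/
theorem norm_kerForm_le (hU : KernelBound U β) (hk : ‖k‖ ≤ 1 / 4) {e : S → ℂ}
    {M : ℝ} (hM : ∀ x, ‖(kerMat U).mulVec e x‖ ≤ M) :
    ‖kerForm U k e‖ ≤ 2 * Fintype.card S * M ^ 2 := by
  have hsymm : (kerMat U).transpose = kerMat U := by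
    ext x y; simp [kerMat, hU.symm y x]
  have hconj : ∀ x, (kerMat U).mulVec (fun y => (starRingEnd ℂ) (e y)) x =
      (starRingEnd ℂ) ((kerMat U).mulVec e x) := by
    intro x
    simp [Matrix.mulVec, dotProduct, kerMat]
  have e1 : kerForm U k e = ∑ x, (starRingEnd ℂ) ((kerMat U).mulVec e x) *
      (kerRes U k).mulVec ((kerMat U).mulVec e) x := by
    have h := Matrix.dotProduct_mulVec (fun y => (starRingEnd ℂ) (e y)) (kerMat U)
      ((kerRes U k).mulVec ((kerMat U).mulVec e))
    rw [← Matrix.mulVec_transpose, hsymm] at h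
    rw [Matrix.mulVec_mulVec, Matrix.mulVec_mulVec] at h
    simp only [← hconj]
    exact h
  rw [e1]
  rcases isEmpty_or_nonempty S with h | ⟨⟨x₀⟩⟩
  · simp
  have hM0 : 0 ≤ M := (norm_nonneg _).trans (hM x₀)
  calc _ ≤ ∑ x, M * ‖(kerRes U k).mulVec ((kerMat U).mulVec e) x‖ := by
        refine (norm_sum_le _ _).trans (Finset.sum_le_sum fun x _ => ?_)
        rw [norm_mul, RCLike.norm_conj]
        exact mul_le_mul_of_nonneg_right (hM x) (norm_nonneg _)
    _ ≤ M * (2 * ∑ x, ‖(kerMat U).mulVec e x‖) := by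
        rw [← Finset.mul_sum]
        exact mul_le_mul_of_nonneg_left (kerRes_l1 hU hk _) hM0
    _ ≤ M * (2 * ∑ x : S, M) := by gcongr with x _; exact hM x
    _ = _ := by simp; ring

end KernelResolvent

/-! ### Profiles: regularity, Fourier transform, Riemann sums. -/

section Profile

variable {u : ℝ → ℝ}

namespace IsProfile

theorem abs_eq (hu : IsProfile u) (t : ℝ) : u |t| = u t := by
  rcases abs_choice t with h | h <;> rw [h]
  exact hu.even t

theorem le_of_abs_le (hu : IsProfile u) {s t : ℝ} (h : |s| ≤ |t|) : u t ≤ u s := by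
  rw [← hu.abs_eq s, ← hu.abs_eq t]
  exact hu.antitoneOn (Set.mem_Ici.2 (abs_nonneg s)) (Set.mem_Ici.2 (abs_nonneg t)) h

theorem le_zero (hu : IsProfile u) (t : ℝ) : u t ≤ u 0 := hu.le_of_abs_le (by simp)

theorem antitone_max (hu : IsProfile u) : Antitone fun s => u (max s 0) := fun _ _ h =>
  hu.antitoneOn (Set.mem_Ici.2 (le_max_right _ _)) (Set.mem_Ici.2 (le_max_right _ _))
    (max_le_max_right 0 h)

theorem eq_comp_abs (hu : IsProfile u) : u = (fun s => u (max s 0)) ∘ fun t => |t| := by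
  ext t
  simp [hu.abs_eq]

theorem measurable (hu : IsProfile u) : Measurable u := by
  rw [hu.eq_comp_abs]
  exact hu.antitone_max.measurable.comp measurable_norm

theorem integrable (hu : IsProfile u) : Integrable u :=
  integrable_of_integral_eq_one hu.integral_eq_one

/-- A monotone function has countably many discontinuities; this is the regularity that makes the
Riemann sums converge. -/
theorem ae_continuousAt (hu : IsProfile u) : ∀ᵐ t, ContinuousAt u t := by
  have hc := hu.antitone_max.countable_not_continuousAt
  set D := {s | ¬ContinuousAt (fun s => u (max s 0)) s} with hD
  have hc2 : (D ∪ (fun t => -t) '' D).Countable := hc.union (hc.image _)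
  refine (hc2.ae_notMem volume).mono fun t ht => ?_
  simp only [Set.mem_union, not_or] at ht
  rw [hu.eq_comp_abs]
  refine ContinuousAt.comp ?_ continuous_abs.continuousAt
  by_contra h
  rcases abs_choice t with h' | h'
  · rw [h'] at h; exact ht.1 h
  · rw [h'] at h; exact ht.2 ⟨-t, h, by simp⟩

theorem zero_pos (hu : IsProfile u) : 0 < u 0 := by
  refine (hu.nonneg 0).lt_of_ne fun h => ?_
  have h0 : u = 0 := by
    ext t
    have := hu.le_zero t
    rw [← h] at this
    exact le_antisymm this (hu.nonneg t)
  have := hu.integral_eq_one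
  rw [h0] at this
  simp at this

end IsProfile

/-- An integrable majorant of the step functions `t ↦ u (⌊b t⌋ / b)`, `b ≥ 1`. -/
noncomputable def stepBound (u : ℝ → ℝ) (t : ℝ) : ℝ :=
  u (t - 1) + u (t + 1) + (Set.Icc (-1 : ℝ) 1).indicator (fun _ => u 0) t

theorem integrable_stepBound (hu : IsProfile u) : Integrable (stepBound u) := by
  refine ((hu.integrable.comp_sub_right 1).add (hu.integrable.comp_add_right 1)).add ?_
  exact (integrable_indicator_iff measurableSet_Icc).2 (integrableOn_const (by simp))

theorem floor_div_mem {b : ℝ} (hb : 0 < b) (t : ℝ) :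
    t - 1 / b ≤ (⌊b * t⌋ : ℝ) / b ∧ (⌊b * t⌋ : ℝ) / b ≤ t := by
  constructor
  · rw [le_div_iff₀ hb, sub_mul, one_div, inv_mul_cancel₀ hb.ne']
    linarith [Int.lt_floor_add_one (b * t)]
  · rw [div_le_iff₀ hb, mul_comm]
    exact Int.floor_le _

/-- Rounding moves `t` to the left by at most `1/b ≤ 1`; outside `[-1, 1]` this cannot cross the
origin beyond a unit shift of `u`. -/
theorem step_le_stepBound (hu : IsProfile u) {b : ℝ} (hb : 1 ≤ b) (t : ℝ) :
    u ((⌊b * t⌋ : ℝ) / b) ≤ stepBound u t := by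
  obtain ⟨h1, h2⟩ := floor_div_mem (by linarith) t
  have hb1 : 1 / b ≤ 1 := by rw [div_le_one (by linarith)]; exact hb
  unfold stepBound
  have n1 := hu.nonneg (t - 1)
  have n2 := hu.nonneg (t + 1)
  by_cases ht : t ∈ Set.Icc (-1 : ℝ) 1
  · rw [Set.indicator_of_mem ht]
    linarith [hu.le_zero ((⌊b * t⌋ : ℝ) / b)]
  · rw [Set.indicator_of_notMem ht, add_zero]
    rw [Set.mem_Icc, not_and_or, not_le, not_le] at ht
    rcases ht with ht | ht
    · have : u ((⌊b * t⌋ : ℝ) / b) ≤ u (t + 1) := by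
        refine hu.le_of_abs_le ?_
        rw [abs_of_nonpos (by linarith), abs_of_nonpos (by linarith)]
        linarith
      linarith
    · have : u ((⌊b * t⌋ : ℝ) / b) ≤ u (t - 1) := by
        refine hu.le_of_abs_le ?_
        rw [abs_of_nonneg (by linarith), abs_of_nonneg (by linarith)]
        linarith
      linarith

/-- `u(t) e^{ipt}`. -/
noncomputable def wave (u : ℝ → ℝ) (p t : ℝ) : ℂ := (u t : ℂ) * Complex.exp (Complex.I * p * t)

theorem norm_exp_I_mul_mul (p t : ℝ) : ‖Complex.exp (Complex.I * p * t)‖ = 1 := by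
  have := Complex.norm_exp_ofReal_mul_I (p * t)
  rw [← this]
  congr 2
  push_cast
  ring

theorem norm_wave (hu : IsProfile u) (p t : ℝ) : ‖wave u p t‖ = u t := by
  rw [wave, norm_mul, norm_exp_I_mul_mul, mul_one, Complex.norm_real, Real.norm_eq_abs,
    abs_of_nonneg (hu.nonneg t)]

theorem measurable_wave (hu : IsProfile u) (p : ℝ) : Measurable (wave u p) := by
  unfold wave
  exact (Complex.measurable_ofReal.comp hu.measurable).mul (by fun_prop)

theorem integrable_wave (hu : IsProfile u) (p : ℝ) : Integrable (wave u p) := by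
  refine (integrable_norm_iff (measurable_wave hu p).aestronglyMeasurable).1 ?_
  simp only [norm_wave hu]
  exact hu.integrable

theorem norm_fourierTransform_le (hu : IsProfile u) (p : ℝ) : ‖fourierTransform u p‖ ≤ 1 := by
  rw [← hu.integral_eq_one]
  refine (norm_integral_le_integral_norm _).trans (le_of_eq ?_)
  congr 1
  ext t
  exact norm_wave hu p t

theorem measurable_step (b : ℝ) : Measurable fun t : ℝ => (⌊b * t⌋ : ℝ) / b :=
  ((measurable_from_top (f := fun k : ℤ => (k : ℝ))).comp
    (Int.measurable_floor.comp (measurable_const_mul b))).div_const b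

theorem tendsto_step (t : ℝ) : Tendsto (fun b : ℝ => (⌊b * t⌋ : ℝ) / b) atTop (𝓝 t) := by
  have h0 : Tendsto (fun b : ℝ => t - 1 / b) atTop (𝓝 t) := by
    simpa using tendsto_const_nhds.sub (tendsto_inv_atTop_zero (𝕜 := ℝ))
  refine tendsto_of_tendsto_of_tendsto_of_le_of_le' h0 tendsto_const_nhds ?_ ?_
  · filter_upwards [eventually_gt_atTop 0] with b hb using (floor_div_mem hb t).1
  · filter_upwards [eventually_gt_atTop 0] with b hb using (floor_div_mem hb t).2

theorem norm_wave_step_sub_le (hu : IsProfile u) (p : ℝ) {b : ℝ} (hb : 1 ≤ b) (t : ℝ) :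
    ‖wave u p ((⌊b * t⌋ : ℝ) / b) - wave u p t‖ ≤ stepBound u t + u t :=
  (norm_sub_le _ _).trans (by
    rw [norm_wave hu, norm_wave hu]
    exact add_le_add (step_le_stepBound hu hb t) le_rfl)

theorem integrable_wave_step (hu : IsProfile u) (p : ℝ) {b : ℝ} (hb : 1 ≤ b) :
    Integrable fun t => wave u p ((⌊b * t⌋ : ℝ) / b) := by
  refine (integrable_stepBound hu).mono'
    ((measurable_wave hu p).comp (measurable_step b)).aestronglyMeasurable (ae_of_all _ fun t => ?_)
  rw [norm_wave hu]
  exact step_le_stepBound hu hb t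

theorem tendsto_integral_wave_step (hu : IsProfile u) (p : ℝ) :
    Tendsto (fun b : ℝ => ∫ t, ‖wave u p ((⌊b * t⌋ : ℝ) / b) - wave u p t‖) atTop (𝓝 0) := by
  have h := tendsto_integral_filter_of_dominated_convergence (μ := (volume : Measure ℝ))
    (l := atTop) (F := fun (b : ℝ) t => ‖wave u p ((⌊b * t⌋ : ℝ) / b) - wave u p t‖)
    (f := fun _ => (0 : ℝ)) (fun t => stepBound u t + u t) ?_ ?_
    ((integrable_stepBound hu).add hu.integrable) ?_
  · simpa using h
  · exact Eventually.of_forall fun b => (((measurable_wave hu p).comp (measurable_step b)).sub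
      (measurable_wave hu p)).norm.aestronglyMeasurable
  · filter_upwards [eventually_ge_atTop 1] with b hb
    refine ae_of_all _ fun t => ?_
    rw [norm_norm]
    exact norm_wave_step_sub_le hu p hb t
  · filter_upwards [hu.ae_continuousAt] with t ht
    have hc : ContinuousAt (wave u p) t := by
      unfold wave
      exact (Complex.continuous_ofReal.continuousAt.comp ht).mul (by fun_prop)
    have := ((hc.tendsto.comp (tendsto_step t)).sub_const (wave u p t)).norm
    simpa using this

/-- A sum over lattice points as the integral of a step function. -/
theorem sum_eq_integral_step {b : ℝ} (hb : 0 < b) (J : Finset ℤ) (f : ℤ → ℂ) :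
    ∑ j ∈ J, ((1 / b : ℝ) : ℂ) * f j = ∫ t : ℝ, if ⌊b * t⌋ ∈ J then f ⌊b * t⌋ else 0 := by
  have e : ∀ t : ℝ, (if ⌊b * t⌋ ∈ J then f ⌊b * t⌋ else 0) =
      ∑ j ∈ J, (Set.Ico ((j : ℝ) / b) ((j + 1 : ℝ) / b)).indicator (fun _ => f j) t := by
    intro t
    have hm : ∀ j : ℤ, t ∈ Set.Ico ((j : ℝ) / b) ((j + 1 : ℝ) / b) ↔ ⌊b * t⌋ = j := by
      intro j
      rw [Int.floor_eq_iff, Set.mem_Ico, div_le_iff₀ hb, lt_div_iff₀ hb, mul_comm t]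
    simp only [Set.indicator_apply, hm]
    rw [Finset.sum_ite_eq]
  simp only [e]
  rw [integral_finsetSum]
  · refine Finset.sum_congr rfl fun j _ => ?_
    rw [integral_indicator_const _ measurableSet_Ico, Measure.real, Real.volume_Ico,
      ENNReal.toReal_ofReal (by rw [← sub_div]; simp; positivity), Complex.real_smul]
    congr 2
    field_simp
    ring
  · intro j _
    exact (integrable_indicator_iff measurableSet_Ico).2 (integrableOn_const (by simp))

theorem card_filter_shift_le (n : ℕ) (j : ℤ) :
    ((Finset.Icc (-(n : ℤ)) n).filter fun x => x + j ∉ Finset.Icc (-(n : ℤ)) n).card ≤ |j| := by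
  rcases le_total 0 j with h | h
  · rw [abs_of_nonneg h]
    have hs : ((Finset.Icc (-(n : ℤ)) n).filter fun x => x + j ∉ Finset.Icc (-(n : ℤ)) n) ⊆
        Finset.Icc (n - j + 1) n := by
      intro x hx
      simp only [Finset.mem_filter, Finset.mem_Icc, not_and_or] at hx ⊢
      omega
    have := Finset.card_le_card hs
    rw [Int.card_Icc] at this
    omega
  · rw [abs_of_nonpos h]
    have hs : ((Finset.Icc (-(n : ℤ)) n).filter fun x => x + j ∉ Finset.Icc (-(n : ℤ)) n) ⊆
        Finset.Icc (-n) (-n - j - 1) := by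
      intro x hx
      simp only [Finset.mem_filter, Finset.mem_Icc, not_and_or] at hx ⊢
      omega
    have := Finset.card_le_card hs
    rw [Int.card_Icc] at this
    omega

end Profile

/-! ### Rows of the band kernel tested against plane waves. -/

section Rows

variable {u : ℝ → ℝ}

/-- The row of the band kernel at `x`, tested against the plane wave of frequency `p / b`. -/
noncomputable def rowWave (u : ℝ → ℝ) (n : ℕ) (b p : ℝ) (x : ℤ) : ℂ :=
  ∑ j ∈ Finset.Icc (-(n : ℤ) - x) (n - x), ((1 / b : ℝ) : ℂ) * wave u p ((j : ℝ) / b)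

theorem bandKernel_eq (hu : IsProfile u) (b : ℝ) (x y : ℤ) :
    bandKernel u b x y = 1 / b * u (((y - x : ℤ) : ℝ) / b) := by
  rw [bandKernel, ← hu.even]
  congr 2
  push_cast
  ring

theorem sum_site_eq_rowWave (hu : IsProfile u) (n : ℕ) (b p : ℝ) (x : ℤ) :
    ∑ y : Site n, (bandKernel u b x y : ℂ) * Complex.exp (Complex.I * p * (((y - x : ℤ) : ℝ) / b : ℝ)) =
      rowWave u n b p x := by
  rw [Finset.sum_coe_sort (Finset.Icc (-(n : ℤ)) n) fun y : ℤ => (bandKernel u b x y : ℂ) *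
    Complex.exp (Complex.I * p * (((y - x : ℤ) : ℝ) / b : ℝ)), rowWave]
  refine Finset.sum_equiv (Equiv.subRight x) (fun y => ?_) fun y _ => ?_
  · simp only [Finset.mem_Icc, Equiv.subRight_apply]
    omega
  · rw [bandKernel_eq hu, wave, Equiv.subRight_apply]
    push_cast
    ring

/-- Two errors: the Riemann sum, which does not see `x`, and the part of the line cut off by the
finite window, which does. -/
theorem norm_rowWave_sub_le (hu : IsProfile u) (n : ℕ) {b : ℝ} (hb : 1 ≤ b) (p : ℝ) (x : ℤ) :
    ‖rowWave u n b p x - fourierTransform u p‖ ≤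
      (∫ t, ‖wave u p ((⌊b * t⌋ : ℝ) / b) - wave u p t‖) +
      ∫ t, u t * (if ⌊b * t⌋ ∈ Finset.Icc (-(n : ℤ) - x) (n - x) then 0 else 1) := by
  set J := Finset.Icc (-(n : ℤ) - x) (n - x) with hJ
  have hmJ : MeasurableSet {t : ℝ | ⌊b * t⌋ ∈ J} :=
    (Int.measurable_floor.comp (measurable_const_mul b)) (MeasurableSet.of_discrete (s := (J : Set ℤ)))
  have e1 : rowWave u n b p x = ∫ t : ℝ, if ⌊b * t⌋ ∈ J then wave u p ((⌊b * t⌋ : ℝ) / b) else 0 :=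
    sum_eq_integral_step (by linarith) J fun j => wave u p ((j : ℝ) / b)
  have i0 := integrable_wave_step hu p hb
  have i1 : Integrable fun t : ℝ => if ⌊b * t⌋ ∈ J then wave u p ((⌊b * t⌋ : ℝ) / b) else 0 := by
    have := i0.indicator hmJ
    refine this.congr (ae_of_all _ fun t => ?_)
    simp [Set.indicator_apply]
  have i2 := integrable_wave hu p
  have i3 : Integrable fun t : ℝ => u t * (if ⌊b * t⌋ ∈ J then (0 : ℝ) else 1) := by
    have := hu.integrable.indicator hmJ.compl
    refine this.congr (ae_of_all _ fun t => ?_)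
    simp [Set.indicator_apply]
  have e2 : fourierTransform u p = ∫ t, wave u p t := rfl
  have i5 : Integrable fun t => ‖wave u p ((⌊b * t⌋ : ℝ) / b) - wave u p t‖ := (i0.sub i2).norm
  rw [e1, e2, ← integral_sub i1 i2, ← integral_add i5 i3]
  refine norm_integral_le_of_norm_le (i5.add i3) (ae_of_all _ fun t => ?_)
  by_cases h : ⌊b * t⌋ ∈ J
  · simp [h]
  · simp only [h, if_false, zero_sub, norm_neg, norm_wave hu, mul_one]
    linarith [norm_nonneg (wave u p ((⌊b * t⌋ : ℝ) / b) - wave u p t)]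

/-- The total error made by replacing `rowWave` by the Fourier transform. -/
noncomputable def rowErr (u : ℝ → ℝ) (n : ℕ) (b p : ℝ) : ℝ :=
  (∫ t, ‖wave u p ((⌊b * t⌋ : ℝ) / b) - wave u p t‖) +
    ∫ t, u t * min 1 ((b * |t| + 1) / (2 * (n : ℝ) + 1))

/-- Exchanging sum and integral, the cut-off term counts the sites that leave the window under the
shift `⌊b t⌋`: at most `N`, and at most `b |t| + 1`. -/
theorem sum_norm_rowWave_sub_le (hu : IsProfile u) (n : ℕ) {b : ℝ} (hb : 1 ≤ b) (p : ℝ) :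
    ∑ x : Site n, ‖rowWave u n b p x - fourierTransform u p‖ ≤ (2 * n + 1) * rowErr u n b p := by
  rw [Finset.sum_coe_sort (Finset.Icc (-(n : ℤ)) n) fun x : ℤ =>
    ‖rowWave u n b p x - fourierTransform u p‖]
  have hcard : (Finset.Icc (-(n : ℤ)) n).card = 2 * n + 1 := by
    rw [Int.card_Icc]; omega
  have hN : (0 : ℝ) < 2 * n + 1 := by positivity
  have hm : ∀ x : ℤ, MeasurableSet {t : ℝ | ⌊b * t⌋ ∈ Finset.Icc (-(n : ℤ) - x) (n - x)} := fun x =>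
    (Int.measurable_floor.comp (measurable_const_mul b)) (MeasurableSet.of_discrete
      (s := (Finset.Icc (-(n : ℤ) - x) (n - x) : Set ℤ)))
  have i3 : ∀ x : ℤ, Integrable fun t : ℝ =>
      u t * (if ⌊b * t⌋ ∈ Finset.Icc (-(n : ℤ) - x) (n - x) then (0 : ℝ) else 1) := by
    intro x
    have := hu.integrable.indicator (hm x).compl
    refine this.congr (ae_of_all _ fun t => ?_)
    simp only [Set.indicator_apply, Set.mem_compl_iff, Set.mem_ofPred_eq]
    split_ifs <;> simp_all
  refine (Finset.sum_le_sum fun x _ => norm_rowWave_sub_le hu n hb p x).trans ?_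
  rw [Finset.sum_add_distrib, Finset.sum_const, hcard, ← integral_finsetSum _ fun x _ => i3 x,
    nsmul_eq_mul, rowErr, mul_add]
  push_cast
  refine add_le_add le_rfl ?_
  have i4 : Integrable fun t => u t * min 1 ((b * |t| + 1) / (2 * (n : ℝ) + 1)) := by
    refine hu.integrable.mul_bdd (c := 1) (by fun_prop) (ae_of_all _ fun t => ?_)
    rw [Real.norm_eq_abs, abs_of_nonneg (le_min zero_le_one (by positivity))]
    exact min_le_left _ _
  rw [← integral_const_mul]
  refine integral_mono (integrable_finsetSum _ fun x _ => i3 x) (i4.const_mul _) fun t => ?_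
  simp only
  rw [← Finset.mul_sum, mul_left_comm]
  refine mul_le_mul_of_nonneg_left ?_ (hu.nonneg t)
  have e : ∑ x ∈ Finset.Icc (-(n : ℤ)) n,
      (if ⌊b * t⌋ ∈ Finset.Icc (-(n : ℤ) - x) (n - x) then (0 : ℝ) else 1) =
      ((Finset.Icc (-(n : ℤ)) n).filter fun x => x + ⌊b * t⌋ ∉ Finset.Icc (-(n : ℤ)) n).card := by
    rw [Finset.card_filter]
    push_cast
    refine Finset.sum_congr rfl fun x _ => ?_
    have : ⌊b * t⌋ ∈ Finset.Icc (-(n : ℤ) - x) (n - x) ↔ x + ⌊b * t⌋ ∈ Finset.Icc (-(n : ℤ)) n := by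
      simp only [Finset.mem_Icc]; omega
    simp only [this]
    split_ifs <;> simp_all
  rw [e, mul_min_of_nonneg _ _ hN.le, mul_one, mul_div_cancel₀ _ hN.ne']
  refine le_min ?_ ?_
  · have h1 := Finset.card_filter_le (Finset.Icc (-(n : ℤ)) n)
      fun x => x + ⌊b * t⌋ ∉ Finset.Icc (-(n : ℤ)) n
    rw [hcard] at h1
    exact_mod_cast h1
  · have h1 : (((Finset.Icc (-(n : ℤ)) n).filter fun x =>
        x + ⌊b * t⌋ ∉ Finset.Icc (-(n : ℤ)) n).card : ℝ) ≤ |(⌊b * t⌋ : ℝ)| := by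
      have := card_filter_shift_le n ⌊b * t⌋
      exact_mod_cast this
    refine h1.trans ?_
    have h2 : |(⌊b * t⌋ : ℝ)| ≤ |b * t| + 1 := by
      have a1 := Int.floor_le (b * t)
      have a2 := Int.lt_floor_add_one (b * t)
      have a3 := neg_abs_le (b * t)
      have a4 := le_abs_self (b * t)
      rw [abs_le]
      constructor <;> linarith
    rwa [abs_mul, abs_of_nonneg (by linarith : (0 : ℝ) ≤ b)] at h2

/-- Because of the minimum with 1, `u` itself dominates the edge term, so no moment of `u` is
needed; pointwise convergence is where `b / N → 0` enters. -/
theorem tendsto_rowErr (hu : IsProfile u) {b : ℕ → ℝ} (hb : Tendsto b atTop atTop)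
    (hbN : Tendsto (fun n : ℕ => b n / (2 * (n : ℝ) + 1)) atTop (𝓝 0)) (p : ℝ) :
    Tendsto (fun n => rowErr u n (b n) p) atTop (𝓝 0) := by
  have h1 := (tendsto_integral_wave_step hu p).comp hb
  have h2 : Tendsto (fun n : ℕ => ∫ t, u t * min 1 ((b n * |t| + 1) / (2 * (n : ℝ) + 1))) atTop
      (𝓝 (∫ _ : ℝ, (0 : ℝ))) := by
    refine tendsto_integral_filter_of_dominated_convergence u ?_ ?_ hu.integrable ?_
    · exact Eventually.of_forall fun n =>
        (hu.measurable.mul (by fun_prop)).aestronglyMeasurable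
    · filter_upwards [hb.eventually_ge_atTop 0] with n hn
      refine ae_of_all _ fun t => ?_
      have h0 : 0 ≤ min 1 ((b n * |t| + 1) / (2 * (n : ℝ) + 1)) := le_min zero_le_one (by positivity)
      rw [Real.norm_eq_abs, abs_of_nonneg (mul_nonneg (hu.nonneg t) h0)]
      exact mul_le_of_le_one_right (hu.nonneg t) (min_le_left _ _)
    · refine ae_of_all _ fun t => ?_
      have hN : Tendsto (fun n : ℕ => (2 * (n : ℝ) + 1)⁻¹) atTop (𝓝 0) := by
        refine tendsto_inv_atTop_zero.comp ?_
        exact tendsto_atTop_add_const_right _ _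
          (tendsto_natCast_atTop_atTop.const_mul_atTop (by norm_num))
      have h3 : Tendsto (fun n : ℕ => (b n * |t| + 1) / (2 * (n : ℝ) + 1)) atTop (𝓝 0) := by
        have := (hbN.mul_const |t|).add hN
        simp only [zero_mul, add_zero] at this
        refine this.congr fun n => ?_
        field_simp
      have h4 := (tendsto_const_nhds (x := (1 : ℝ))).min h3
      have h5 := h4.const_mul (u t)
      simpa using h5
  simpa [rowErr] using h1.add h2

theorem rowWave_zero (hu : IsProfile u) (n : ℕ) (b : ℝ) (x : ℤ) :
    rowWave u n b 0 x = ((∑ y : Site n, bandKernel u b x y : ℝ) : ℂ) := by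
  rw [← sum_site_eq_rowWave hu]
  simp

theorem fourierTransform_zero (hu : IsProfile u) : fourierTransform u 0 = 1 := by
  simp [fourierTransform, integral_complex_ofReal, hu.integral_eq_one]

theorem sum_abs_row_sub_one_le (hu : IsProfile u) (n : ℕ) {b : ℝ} (hb : 1 ≤ b) :
    ∑ x : Site n, |∑ y : Site n, bandKernel u b x y - 1| ≤ (2 * n + 1) * rowErr u n b 0 := by
  refine le_trans (le_of_eq ?_) (sum_norm_rowWave_sub_le hu n hb 0)
  refine Finset.sum_congr rfl fun x _ => ?_
  rw [rowWave_zero hu, fourierTransform_zero hu, ← Complex.ofReal_one, ← Complex.ofReal_sub,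
    Complex.norm_real, Real.norm_eq_abs]

theorem row_le (hu : IsProfile u) (n : ℕ) {b : ℝ} (hb : 1 ≤ b) (x : ℤ) :
    ∑ y : Site n, bandKernel u b x y ≤
      1 + ∫ t, ‖wave u 0 ((⌊b * t⌋ : ℝ) / b) - wave u 0 t‖ := by
  set J := Finset.Icc (-(n : ℤ) - x) (n - x) with hJ
  have e1 : rowWave u n b 0 x = ∫ t : ℝ, if ⌊b * t⌋ ∈ J then wave u 0 ((⌊b * t⌋ : ℝ) / b) else 0 :=
    sum_eq_integral_step (by linarith) J fun j => wave u 0 ((j : ℝ) / b)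
  have i0 := integrable_wave_step hu 0 hb
  have i2 := integrable_wave hu 0
  have i5 : Integrable fun t => ‖wave u 0 ((⌊b * t⌋ : ℝ) / b) - wave u 0 t‖ := (i0.sub i2).norm
  have h : ‖rowWave u n b 0 x‖ ≤ 1 + ∫ t, ‖wave u 0 ((⌊b * t⌋ : ℝ) / b) - wave u 0 t‖ := by
    rw [e1, ← hu.integral_eq_one, ← integral_add hu.integrable i5]
    refine norm_integral_le_of_norm_le (hu.integrable.add i5) (ae_of_all _ fun t => ?_)
    have h0 : ‖wave u 0 ((⌊b * t⌋ : ℝ) / b)‖ ≤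
        u t + ‖wave u 0 ((⌊b * t⌋ : ℝ) / b) - wave u 0 t‖ := by
      have := norm_add_le (wave u 0 t) (wave u 0 ((⌊b * t⌋ : ℝ) / b) - wave u 0 t)
      rwa [add_sub_cancel, norm_wave hu 0 t] at this
    split_ifs
    · exact h0
    · rw [norm_zero]; exact (norm_nonneg _).trans h0
  rw [rowWave_zero hu, Complex.norm_real] at h
  exact (le_abs_self _).trans h

/-- The band kernel restricted to the sites. -/
noncomputable def siteKernel (u : ℝ → ℝ) (n : ℕ) (b : ℝ) (x y : Site n) : ℝ := bandKernel u b x y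

/-- Row sums are truncated Riemann sums of `∫ u = 1`, so the bound 2 holds once `b` is large,
uniformly in `n`. -/
theorem eventually_kernelBound (hu : IsProfile u) :
    ∀ᶠ b : ℝ in atTop, ∀ n : ℕ, KernelBound (siteKernel u n b) (u 0 / b) := by
  have h := (tendsto_integral_wave_step hu 0).eventually (eventually_lt_nhds zero_lt_one)
  filter_upwards [h, eventually_ge_atTop 1] with b hb hb1 n
  have hb0 : 0 < b := by linarith
  refine ⟨fun x y => ?_, fun x y => ?_, fun x y => ?_, fun x => ?_⟩
  · exact mul_nonneg (by positivity) (hu.nonneg _)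
  · rw [siteKernel, siteKernel, bandKernel_eq hu, bandKernel]
    push_cast
    rfl
  · rw [siteKernel, bandKernel, one_div, inv_mul_eq_div]
    exact div_le_div_of_nonneg_right (hu.le_zero _) hb0.le
  · have := row_le hu n hb1 x
    simp only [siteKernel]
    linarith

theorem siteKernel_self (n : ℕ) (b : ℝ) (x : Site n) : siteKernel u n b x x = u 0 / b := by
  simp [siteKernel, bandKernel, div_eq_inv_mul]

end Rows

/-! ### Decay in frequency and the plane-wave expansion of the trace. -/

section PlaneWaves

variable {u : ℝ → ℝ}

/-- Abel summation in inductive form: each step adds an increment `f m - f (m+1)` of modulus one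
direction, and these telescope. -/
theorem norm_one_sub_mul_sum_le {f : ℕ → ℝ} (hf : Antitone f) {ζ : ℂ}
    (hζ : ‖ζ‖ = 1) (m : ℕ) :
    ‖(1 - ζ) * ∑ i ∈ Finset.range m, (f i : ℂ) * ζ ^ i + f m * ζ ^ m - f 0‖ ≤ f 0 - f m := by
  induction m with
  | zero => simp
  | succ m ih =>
    have e : (1 - ζ) * ∑ i ∈ Finset.range (m + 1), (f i : ℂ) * ζ ^ i + f (m + 1) * ζ ^ (m + 1) - f 0 =
        ((1 - ζ) * ∑ i ∈ Finset.range m, (f i : ℂ) * ζ ^ i + f m * ζ ^ m - f 0) -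
          ((f m - f (m + 1) : ℝ) : ℂ) * ζ ^ (m + 1) := by
      rw [Finset.sum_range_succ]
      push_cast
      ring
    rw [e]
    have h1 : ‖((f m - f (m + 1) : ℝ) : ℂ) * ζ ^ (m + 1)‖ = f m - f (m + 1) := by
      rw [norm_mul, norm_pow, hζ, one_pow, mul_one, Complex.norm_real, Real.norm_eq_abs,
        abs_of_nonneg (sub_nonneg.2 (hf (Nat.le_succ m)))]
    refine (norm_sub_le _ _).trans ?_
    rw [h1]
    linarith

theorem norm_one_sub_mul_sum_le' {f : ℕ → ℝ} (hf : Antitone f) (h0 : ∀ i, 0 ≤ f i) {ζ : ℂ}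
    (hζ : ‖ζ‖ = 1) (m : ℕ) :
    ‖1 - ζ‖ * ‖∑ i ∈ Finset.range m, (f i : ℂ) * ζ ^ i‖ ≤ 2 * f 0 := by
  rw [← norm_mul]
  have h := norm_one_sub_mul_sum_le hf hζ m
  set T := (1 - ζ) * ∑ i ∈ Finset.range m, (f i : ℂ) * ζ ^ i with hT
  have e : T = (T + f m * ζ ^ m - f 0) + f 0 - f m * ζ ^ m := by ring
  have h1 : ‖(f m : ℂ) * ζ ^ m‖ = f m := by
    rw [norm_mul, norm_pow, hζ, one_pow, mul_one, Complex.norm_real, Real.norm_eq_abs,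
      abs_of_nonneg (h0 m)]
  have h2 : ‖(f 0 : ℂ)‖ = f 0 := by
    rw [Complex.norm_real, Real.norm_eq_abs, abs_of_nonneg (h0 0)]
  rw [e]
  refine (norm_sub_le _ _).trans ?_
  rw [h1]
  have := norm_add_le (T + f m * ζ ^ m - f 0) (f 0 : ℂ)
  rw [h2] at this
  linarith

theorem le_norm_one_sub_exp {φ : ℝ} (hφ : |φ| ≤ Real.pi) :
    2 / Real.pi * |φ| ≤ ‖1 - Complex.exp (Complex.I * φ)‖ := by
  rw [norm_sub_rev, Complex.norm_exp_I_mul_ofReal_sub_one, Real.norm_eq_abs, abs_mul]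
  have h := Real.mul_abs_le_abs_sin (x := φ / 2) (by
    rw [abs_div, abs_of_pos (by norm_num : (0 : ℝ) < 2)]
    linarith)
  rw [abs_div, abs_of_pos (by norm_num : (0 : ℝ) < 2)] at h
  rw [abs_of_pos (by norm_num : (0 : ℝ) < 2)]
  calc 2 / Real.pi * |φ| = 2 * (2 / Real.pi * (|φ| / 2)) := by ring
    _ ≤ _ := by gcongr

theorem antitone_profile (hu : IsProfile u) {b : ℝ} (hb : 0 < b) (k : ℕ) :
    Antitone fun i : ℕ => 1 / b * u (((i + k : ℕ) : ℝ) / b) := by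
  intro i j hij
  refine mul_le_mul_of_nonneg_left (hu.le_of_abs_le ?_) (by positivity)
  rw [abs_of_nonneg (by positivity), abs_of_nonneg (by positivity)]
  gcongr

/-- Monotonicity replaces smoothness: on each side of the diagonal the weights decrease, so Abel
summation bounds the two halves together by `4 u(0) / b` divided by `|1 - ζ| ≥ (2/π) |p| / b`. The
powers of `b` cancel, and the bound is uniform in the site. -/
theorem norm_rowWave_le (hu : IsProfile u) {n : ℕ} {b : ℝ} (hb : 0 < b) {p : ℝ} (hp : p ≠ 0)
    (hpb : |p| ≤ Real.pi * b) (x : Site n) : ‖rowWave u n b p x‖ ≤ 2 * Real.pi * u 0 / |p| := by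
  obtain ⟨x, hx⟩ := x
  rw [Finset.mem_Icc] at hx
  simp only
  obtain ⟨m₁, hm₁⟩ := Int.eq_ofNat_of_zero_le (show 0 ≤ (n : ℤ) - x by omega)
  obtain ⟨m₂, hm₂⟩ := Int.eq_ofNat_of_zero_le (show 0 ≤ (n : ℤ) + x by omega)
  set ζ : ℂ := Complex.exp (Complex.I * (p / b : ℝ)) with hζ
  have hζ1 : ‖ζ‖ = 1 := by rw [hζ, mul_comm]; exact Complex.norm_exp_ofReal_mul_I _
  have hζ0 : ζ ≠ 0 := Complex.exp_ne_zero _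
  have hζ1' : ‖ζ⁻¹‖ = 1 := by rw [norm_inv, hζ1, inv_one]
  have hpow : ∀ j : ℤ, Complex.exp (Complex.I * p * ((j : ℝ) / b : ℝ)) = ζ ^ j := by
    intro j
    rw [hζ, ← Complex.exp_int_mul]
    congr 1
    push_cast
    ring
  -- Negative lags are reindexed by `j = -1 - i`; hence the shift by one in the weights and the
  -- extra factor `ζ⁻¹`.
  have hsplit : rowWave u n b p x =
      ∑ i ∈ Finset.range (m₁ + 1), ((1 / b * u (((i + 0 : ℕ) : ℝ) / b) : ℝ) : ℂ) * ζ ^ i +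
      ζ⁻¹ * ∑ i ∈ Finset.range m₂, ((1 / b * u (((i + 1 : ℕ) : ℝ) / b) : ℝ) : ℂ) * ζ⁻¹ ^ i := by
    rw [rowWave, ← Finset.sum_filter_add_sum_filter_not _ (fun j : ℤ => 0 ≤ j), Finset.mul_sum]
    congr 1
    · refine Finset.sum_nbij' (fun j => j.toNat) (fun i => (i : ℤ)) ?_ ?_ ?_ ?_ ?_
      · intro j hj
        simp only [Finset.mem_filter, Finset.mem_Icc, Finset.mem_range] at hj ⊢
        omega
      · intro i hi
        simp only [Finset.mem_filter, Finset.mem_Icc, Finset.mem_range] at hi ⊢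
        omega
      · intro j hj
        simp only [Finset.mem_filter] at hj
        omega
      · intro i _
        simp
      · intro j hj
        simp only [Finset.mem_filter] at hj
        obtain ⟨i, rfl⟩ := Int.eq_ofNat_of_zero_le hj.2
        simp only [wave, hpow]
        simp
        ring
    · refine Finset.sum_nbij' (fun j => (-j - 1).toNat) (fun i => -(i : ℤ) - 1) ?_ ?_ ?_ ?_ ?_
      · intro j hj
        simp only [Finset.mem_filter, Finset.mem_Icc, Finset.mem_range] at hj ⊢
        omega
      · intro i hi
        simp only [Finset.mem_filter, Finset.mem_Icc, Finset.mem_range] at hi ⊢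
        omega
      · intro j hj
        simp only [Finset.mem_filter] at hj
        omega
      · intro i _
        simp
      · intro j hj
        simp only [Finset.mem_filter] at hj
        obtain ⟨i, hi⟩ := Int.eq_ofNat_of_zero_le (show 0 ≤ -j - 1 by omega)
        have hj' : j = -((i : ℤ) + 1) := by omega
        subst hj'
        have e1 : (-(-((i : ℤ) + 1)) - 1).toNat = i := by omega
        have e2 : u (((-((i : ℤ) + 1) : ℤ) : ℝ) / b) = u (((i + 1 : ℕ) : ℝ) / b) := by
          rw [← hu.even]
          congr 1
          push_cast
          ring
        have e3 : ζ ^ (-((i : ℤ) + 1)) = ζ⁻¹ * ζ⁻¹ ^ i := by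
          rw [zpow_neg, zpow_add₀ hζ0, mul_inv, zpow_natCast, zpow_one, inv_pow]
          ring
        simp only [wave, hpow, e1, e2, e3]
        push_cast
        ring
  have hφ : |p / b| ≤ Real.pi := by
    rw [abs_div, abs_of_pos hb, div_le_iff₀ hb]; exact hpb
  have hlow := le_norm_one_sub_exp hφ
  rw [← hζ, abs_div, abs_of_pos hb] at hlow
  have hinv : ‖1 - ζ⁻¹‖ = ‖1 - ζ‖ := by
    have : 1 - ζ⁻¹ = -(ζ⁻¹ * (1 - ζ)) := by field_simp; ring
    rw [this, norm_neg, norm_mul, hζ1', one_mul]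
  have hnn : ∀ k i : ℕ, 0 ≤ 1 / b * u (((i + k : ℕ) : ℝ) / b) := fun k i =>
    mul_nonneg (by positivity) (hu.nonneg _)
  have b1 := norm_one_sub_mul_sum_le' (antitone_profile hu hb 0) (hnn 0) hζ1 (m₁ + 1)
  have b2 := norm_one_sub_mul_sum_le' (antitone_profile hu hb 1) (hnn 1) hζ1' m₂
  rw [hinv] at b2
  have hp' : 0 < |p| := abs_pos.2 hp
  have hpi := Real.pi_pos
  have h0 : ∀ k : ℕ, 1 / b * u (((0 + k : ℕ) : ℝ) / b) ≤ u 0 / b := fun k => by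
    rw [one_div, inv_mul_eq_div]
    exact div_le_div_of_nonneg_right (hu.le_zero _) hb.le
  have key : ‖1 - ζ‖ * ‖rowWave u n b p x‖ ≤ 4 * (u 0 / b) := by
    rw [hsplit]
    refine (mul_le_mul_of_nonneg_left (norm_add_le _ _) (norm_nonneg _)).trans ?_
    rw [norm_mul ζ⁻¹, hζ1', one_mul, mul_add]
    have := h0 0
    have := h0 1
    linarith
  have h3 : 2 / Real.pi * (|p| / b) * ‖rowWave u n b p x‖ ≤ 4 * (u 0 / b) :=
    (mul_le_mul_of_nonneg_right hlow (norm_nonneg _)).trans key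
  rw [le_div_iff₀ hp']
  have h4 : 2 / Real.pi * (|p| / b) * ‖rowWave u n b p x‖ * (Real.pi * b / 2) ≤
      4 * (u 0 / b) * (Real.pi * b / 2) := mul_le_mul_of_nonneg_right h3 (by positivity)
  have e1 : 2 / Real.pi * (|p| / b) * ‖rowWave u n b p x‖ * (Real.pi * b / 2) =
      ‖rowWave u n b p x‖ * |p| := by field_simp
  have e2 : 4 * (u 0 / b) * (Real.pi * b / 2) = 2 * Real.pi * u 0 := by field_simp; ring
  rw [e1, e2] at h4
  exact h4

/-- The plane wave of frequency `p / b`. -/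
noncomputable def planeWave (n : ℕ) (b p : ℝ) (x : Site n) : ℂ :=
  Complex.exp (Complex.I * p * (((x : ℤ) : ℝ) / b : ℝ))

theorem norm_planeWave (n : ℕ) (b p : ℝ) (x : Site n) : ‖planeWave n b p x‖ = 1 :=
  norm_exp_I_mul_mul _ _

theorem kerMat_mulVec_planeWave (hu : IsProfile u) (n : ℕ) (b p : ℝ) (x : Site n) :
    (kerMat (siteKernel u n b)).mulVec (planeWave n b p) x =
      planeWave n b p x * rowWave u n b p x := by
  rw [← sum_site_eq_rowWave hu, Finset.mul_sum]
  simp only [Matrix.mulVec, dotProduct, kerMat, Matrix.of_apply, siteKernel]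
  refine Finset.sum_congr rfl fun y _ => ?_
  rw [mul_left_comm, planeWave, planeWave, ← Complex.exp_add]
  congr 2
  push_cast
  ring

theorem integral_exp_lattice {b : ℝ} (hb : 0 < b) (m : ℤ) :
    ∫ p in (-(Real.pi * b))..(Real.pi * b), Complex.exp (Complex.I * p * ((m : ℝ) / b : ℝ)) =
      if m = 0 then ((2 * Real.pi * b : ℝ) : ℂ) else 0 := by
  split_ifs with h
  · subst h
    simp
    ring
  · have hc : Complex.I * ((m : ℝ) / b : ℝ) ≠ 0 := by
      refine mul_ne_zero Complex.I_ne_zero ?_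
      rw [Complex.ofReal_ne_zero]
      exact div_ne_zero (Int.cast_ne_zero.2 h) hb.ne'
    have e : ∀ p : ℝ, Complex.exp (Complex.I * p * ((m : ℝ) / b : ℝ)) =
        Complex.exp (Complex.I * ((m : ℝ) / b : ℝ) * p) := fun p => by ring_nf
    simp only [e]
    rw [integral_exp_mul_complex hc]
    have e2 : Complex.exp (Complex.I * ((m : ℝ) / b : ℝ) * ((Real.pi * b : ℝ) : ℂ)) =
        Complex.exp (Complex.I * ((m : ℝ) / b : ℝ) * ((-(Real.pi * b) : ℝ) : ℂ)) := by
      have hb' : (b : ℂ) ≠ 0 := Complex.ofReal_ne_zero.2 hb.ne'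
      rw [Complex.exp_eq_exp_iff_exists_int]
      refine ⟨m, ?_⟩
      push_cast
      field_simp
      ring
    rw [e2, sub_self, zero_div]

/-- Over one full period of frequencies the characters of distinct lattice points are orthogonal, so
only the diagonal survives. No periodicity of `U` is needed. -/
theorem trace_eq_integral_kerForm {n : ℕ} {b : ℝ} (hb : 0 < b) (U : Site n → Site n → ℝ) (k : ℂ) :
    ∫ p in (-(Real.pi * b))..(Real.pi * b), kerForm U k (planeWave n b p) =
      (2 * Real.pi * b : ℝ) * (kerMat U * kerRes U k * kerMat U).trace := by
  set T := kerMat U * kerRes U k * kerMat U with hT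
  have e : ∀ p : ℝ, kerForm U k (planeWave n b p) =
      ∑ x, ∑ y, T x y * Complex.exp (Complex.I * p * (((y - x : ℤ) : ℝ) / b : ℝ)) := by
    intro p
    simp only [kerForm, Matrix.mulVec, dotProduct, ← hT, Finset.mul_sum]
    refine Finset.sum_congr rfl fun x _ => Finset.sum_congr rfl fun y _ => ?_
    rw [mul_left_comm, planeWave, planeWave, ← Complex.exp_conj, ← Complex.exp_add]
    congr 2
    simp
    ring
  simp only [e]
  have hc : ∀ x y : Site n, Continuous fun p : ℝ =>
      T x y * Complex.exp (Complex.I * p * (((y - x : ℤ) : ℝ) / b : ℝ)) := fun x y => by fun_prop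
  rw [intervalIntegral.integral_finsetSum fun x _ =>
    (continuous_finsetSum _ fun y _ => hc x y).intervalIntegrable _ _, Matrix.trace, Finset.mul_sum]
  refine Finset.sum_congr rfl fun x _ => ?_
  rw [intervalIntegral.integral_finsetSum fun y _ => (hc x y).intervalIntegrable _ _,
    Finset.sum_eq_single x]
  · rw [intervalIntegral.integral_const_mul, integral_exp_lattice hb]
    simp
    ring
  · intro y _ hy
    rw [intervalIntegral.integral_const_mul, integral_exp_lattice hb, if_neg, mul_zero]
    intro h
    exact hy (Subtype.ext (sub_eq_zero.1 h))
  · simp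

end PlaneWaves

/-! ### Limit of the trace of the kernel resolvent. -/

section TraceLimit

variable {u : ℝ → ℝ} {b : ℕ → ℝ}

theorem continuous_fourierTransform (hu : IsProfile u) : Continuous (fourierTransform u) := by
  refine continuous_of_dominated (F := fun p t => wave u p t) (bound := u) (fun p =>
    (measurable_wave hu p).aestronglyMeasurable) (fun p => ae_of_all _ fun t =>
      (norm_wave hu p t).le) hu.integrable (ae_of_all _ fun t => ?_)
  unfold wave
  fun_prop

/-- The decay is inherited from the lattice rows: average their bound over the sites and pass to the
limit. -/
theorem norm_fourierTransform_le_div (hu : IsProfile u) (hb : Tendsto b atTop atTop)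
    (hbN : Tendsto (fun n : ℕ => b n / (2 * (n : ℝ) + 1)) atTop (𝓝 0)) {p : ℝ} (hp : p ≠ 0) :
    ‖fourierTransform u p‖ ≤ 2 * Real.pi * u 0 / |p| := by
  have h := (tendsto_rowErr hu hb hbN p).add_const (2 * Real.pi * u 0 / |p|)
  rw [zero_add] at h
  refine ge_of_tendsto h ?_
  filter_upwards [hb.eventually_ge_atTop 1, hb.eventually_ge_atTop (|p| / Real.pi)] with n h1 h2
  rw [div_le_iff₀ Real.pi_pos, mul_comm] at h2
  have h3 := sum_norm_rowWave_sub_le hu n h1 p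
  have h4 : ∀ x : Site n, ‖fourierTransform u p‖ ≤
      ‖rowWave u n (b n) p x - fourierTransform u p‖ + 2 * Real.pi * u 0 / |p| := by
    intro x
    have := norm_rowWave_le hu (by linarith) hp h2 x
    have h5 := norm_sub_le (rowWave u n (b n) p x) (rowWave u n (b n) p x - fourierTransform u p)
    rw [sub_sub_cancel] at h5
    linarith
  have h5 := Finset.sum_le_sum fun x (_ : x ∈ (Finset.univ : Finset (Site n))) => h4 x
  have hcard : Fintype.card (Site n) = 2 * n + 1 := by
    rw [Fintype.card_coe, Int.card_Icc]; omega
  rw [Finset.sum_add_distrib, Finset.sum_const, Finset.sum_const, Finset.card_univ, hcard,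
    nsmul_eq_mul, nsmul_eq_mul] at h5
  push_cast at h5
  have hN : (0 : ℝ) < 2 * n + 1 := by positivity
  refine le_of_mul_le_mul_left ?_ hN
  rw [mul_add]
  linarith

theorem sq_le_of_le_two {M c p : ℝ} (h0 : 0 ≤ M) (h2 : M ≤ 2) (hp : p ≠ 0 → M ≤ c / |p|) : M ^ 2 ≤ (8 + 2 * c ^ 2) / (1 + p ^ 2) := by
  rw [le_div_iff₀ (by positivity)]
  by_cases h : |p| ≤ 1
  · have h1 : p ^ 2 ≤ 1 := by rw [← sq_abs]; exact pow_le_one₀ (abs_nonneg p) h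
    have h3 : M ^ 2 ≤ 4 := by nlinarith
    nlinarith [sq_nonneg c, sq_nonneg p]
  · push Not at h
    have hp0 : 0 < |p| := by linarith
    have h1 := hp (abs_pos.1 hp0)
    rw [le_div_iff₀ hp0] at h1
    have h3 : M ^ 2 * p ^ 2 ≤ c ^ 2 := by
      rw [← sq_abs p, ← mul_pow]
      exact pow_le_pow_left₀ (by positivity) h1 2
    have h4 : M ^ 2 ≤ 4 := by nlinarith
    nlinarith [sq_nonneg c]

/-- The constant in the quadratic decay bounds of the Fourier transform. -/
noncomputable def decayConst (u : ℝ → ℝ) : ℝ := 8 + 2 * (2 * Real.pi * u 0) ^ 2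

theorem norm_fourierTransform_sq_le (hu : IsProfile u) (hb : Tendsto b atTop atTop)
    (hbN : Tendsto (fun n : ℕ => b n / (2 * (n : ℝ) + 1)) atTop (𝓝 0)) (p : ℝ) :
    ‖fourierTransform u p‖ ^ 2 ≤ decayConst u / (1 + p ^ 2) := by
  have := hu.zero_pos
  exact sq_le_of_le_two (norm_nonneg _) ((norm_fourierTransform_le hu p).trans (by norm_num))
    (fun hp => norm_fourierTransform_le_div hu hb hbN hp)

theorem integrable_decay (C : ℝ) : Integrable fun p : ℝ => C / (1 + p ^ 2) := by
  simpa [div_eq_mul_inv] using integrable_inv_one_add_sq.const_mul C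

theorem card_site (n : ℕ) : Fintype.card (Site n) = 2 * n + 1 := by
  rw [Fintype.card_coe, Int.card_Icc]; omega

theorem norm_one_sub_ge {k s : ℂ} (hk : ‖k‖ ≤ 1 / 4) (hs : ‖s‖ ≤ 1) : 3 / 4 ≤ ‖1 - k * s‖ := by
  have h1 : ‖k * s‖ ≤ 1 / 4 := by
    rw [norm_mul]
    calc ‖k‖ * ‖s‖ ≤ 1 / 4 * 1 := by gcongr
      _ = 1 / 4 := by ring
  have := norm_sub_norm_le (1 : ℂ) (k * s)
  rw [norm_one] at this
  linarith

/-- Dominated convergence in `p`: plane waves are approximate eigenvectors for the pointwise limit,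
and the quadratic bound on the form with the `1/|p|` decay of rows gives the majorant. -/
theorem tendsto_trace (hu : IsProfile u) (hb : Tendsto b atTop atTop)
    (hbN : Tendsto (fun n : ℕ => b n / (2 * (n : ℝ) + 1)) atTop (𝓝 0)) {k : ℂ} (hk : ‖k‖ ≤ 1 / 4) :
    Tendsto (fun n : ℕ => ((b n / (2 * (n : ℝ) + 1) : ℝ) : ℂ) *
      (kerMat (siteKernel u n (b n)) * kerRes (siteKernel u n (b n)) k *
        kerMat (siteKernel u n (b n))).trace) atTop
      (𝓝 (1 / (2 * Real.pi) * ∫ p, fourierTransform u p ^ 2 / (1 - k * fourierTransform u p))) := by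
  have hu0 := hu.zero_pos
  have hpi := Real.pi_pos
  have hkb := hb.eventually (eventually_kernelBound hu)
  set f : ℕ → ℝ → ℂ := fun n => (Set.Ioc (-(Real.pi * b n)) (Real.pi * b n)).indicator fun p =>
    ((1 / (2 * (n : ℝ) + 1) : ℝ) : ℂ) * kerForm (siteKernel u n (b n)) k (planeWave n (b n) p) with hf
  have hlim : Tendsto (fun n => ∫ p, f n p) atTop
      (𝓝 (∫ p, fourierTransform u p ^ 2 / (1 - k * fourierTransform u p))) := by
    refine tendsto_integral_filter_of_dominated_convergence
      (fun p => 2 * decayConst u / (1 + p ^ 2)) ?_ ?_ (integrable_decay _) ?_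
    · refine Eventually.of_forall fun n => ?_
      refine (Continuous.measurable ?_).indicator measurableSet_Ioc |>.aestronglyMeasurable
      unfold kerForm planeWave
      simp only [Matrix.mulVec, dotProduct]
      refine continuous_const.mul (continuous_finsetSum _ fun x _ => Continuous.mul
        (Complex.continuous_conj.comp (by fun_prop)) (continuous_finsetSum _ fun y _ => by fun_prop))
    · filter_upwards [hkb, hb.eventually_ge_atTop 1] with n hn h1
      refine ae_of_all _ fun p => ?_
      have hN : (0 : ℝ) < 2 * n + 1 := by positivity
      have hD : 0 ≤ 2 * decayConst u / (1 + p ^ 2) := by unfold decayConst; positivity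
      by_cases hp : p ∈ Set.Ioc (-(Real.pi * b n)) (Real.pi * b n)
      · simp only [hf, Set.indicator_of_mem hp]
        have hpb : |p| ≤ Real.pi * b n := abs_le.2 ⟨hp.1.le, hp.2⟩
        -- The case `p = 0` is separate because division by zero would make the minimum vanish.
        set M := if p = 0 then 2 else min 2 (2 * Real.pi * u 0 / |p|) with hM
        have hM0 : 0 ≤ M := by rw [hM]; split_ifs <;> positivity
        have hr2 : ∀ x : Site n, ‖rowWave u n (b n) p x‖ ≤ 2 := by
          intro x
          rw [← sum_site_eq_rowWave hu]
          refine (norm_sum_le _ _).trans (le_trans (le_of_eq ?_) ((hn n).row_le x))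
          refine Finset.sum_congr rfl fun y _ => ?_
          rw [norm_mul, norm_exp_I_mul_mul, mul_one, Complex.norm_real, Real.norm_eq_abs]
          exact abs_of_nonneg ((hn n).nonneg x y)
        have hMr : ∀ x, ‖(kerMat (siteKernel u n (b n))).mulVec (planeWave n (b n) p) x‖ ≤ M := by
          intro x
          rw [kerMat_mulVec_planeWave hu, norm_mul, norm_planeWave, one_mul, hM]
          split_ifs with h0
          · exact hr2 x
          · exact le_min (hr2 x) (norm_rowWave_le hu (by linarith) h0 hpb x)
        have hq := norm_kerForm_le (hn n) hk hMr
        rw [card_site] at hq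
        push_cast at hq
        have hMsq : M ^ 2 ≤ decayConst u / (1 + p ^ 2) := by
          refine sq_le_of_le_two hM0 ?_ (fun h0 => ?_)
          · rw [hM]; split_ifs
            · exact le_rfl
            · exact min_le_left _ _
          · rw [hM, if_neg h0]; exact min_le_right _ _
        rw [norm_mul, Complex.norm_real, Real.norm_eq_abs, abs_of_pos (by positivity), one_div,
          inv_mul_le_iff₀ hN]
        refine hq.trans ?_
        rw [mul_div_assoc]
        calc 2 * (2 * (n : ℝ) + 1) * M ^ 2 ≤ 2 * (2 * (n : ℝ) + 1) * (decayConst u / (1 + p ^ 2)) := by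
              gcongr
          _ = _ := by ring
      · simp only [hf, Set.indicator_of_notMem hp, norm_zero]
        exact hD
    · refine ae_of_all _ fun p => ?_
      have hE := (tendsto_rowErr hu hb hbN p).const_mul 7
      rw [mul_zero] at hE
      rw [tendsto_iff_norm_sub_tendsto_zero]
      refine squeeze_zero' (Eventually.of_forall fun _ => norm_nonneg _) ?_ hE
      filter_upwards [hkb, hb.eventually_ge_atTop 1,
        hb.eventually_gt_atTop (|p| / Real.pi)] with n hn h1 h2
      rw [div_lt_iff₀ hpi, mul_comm] at h2
      have hp : p ∈ Set.Ioc (-(Real.pi * b n)) (Real.pi * b n) :=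
        ⟨(abs_lt.1 h2).1, (abs_lt.1 h2).2.le⟩
      have hN : (0 : ℝ) < 2 * n + 1 := by positivity
      simp only [hf, Set.indicator_of_mem hp]
      have hδ : ∑ x, ‖(kerMat (siteKernel u n (b n))).mulVec (planeWave n (b n) p) x -
          fourierTransform u p * planeWave n (b n) p x‖ ≤ (2 * n + 1) * rowErr u n (b n) p := by
        refine le_trans (le_of_eq ?_) (sum_norm_rowWave_sub_le hu n h1 p)
        refine Finset.sum_congr rfl fun x _ => ?_
        rw [kerMat_mulVec_planeWave hu, mul_comm (fourierTransform u p), ← mul_sub, norm_mul,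
          norm_planeWave, one_mul]
      have hq := norm_kerForm_sub_le (hn n) hk (norm_planeWave n (b n) p)
        (norm_fourierTransform_le hu p) hδ
      rw [card_site] at hq
      have hN' : ((2 * (n : ℝ) + 1 : ℝ) : ℂ) ≠ 0 := Complex.ofReal_ne_zero.2 hN.ne'
      have e : ((1 / (2 * (n : ℝ) + 1) : ℝ) : ℂ) *
          kerForm (siteKernel u n (b n)) k (planeWave n (b n) p) -
          fourierTransform u p ^ 2 / (1 - k * fourierTransform u p) =
          ((1 / (2 * (n : ℝ) + 1) : ℝ) : ℂ) *
          (kerForm (siteKernel u n (b n)) k (planeWave n (b n) p) - ((2 * n + 1 : ℕ) : ℂ) *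
          (fourierTransform u p ^ 2 / (1 - k * fourierTransform u p))) := by
        rw [mul_sub, ← mul_assoc]
        congr 1
        have : ((1 / (2 * (n : ℝ) + 1) : ℝ) : ℂ) * ((2 * n + 1 : ℕ) : ℂ) = 1 := by
          push_cast at hN' ⊢
          field_simp
        rw [this, one_mul]
      rw [e, norm_mul, Complex.norm_real, Real.norm_eq_abs, abs_of_pos (by positivity), one_div,
        inv_mul_le_iff₀ hN]
      linarith
  refine (hlim.const_mul (1 / (2 * (Real.pi : ℂ)))).congr' ?_
  filter_upwards [hb.eventually_ge_atTop 1] with n h1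
  have hb0 : 0 < b n := by linarith
  have h := trace_eq_integral_kerForm hb0 (siteKernel u n (b n)) k
  simp only [hf]
  rw [integral_indicator measurableSet_Ioc, ← intervalIntegral.integral_of_le (by
    have := mul_pos hpi hb0; linarith), intervalIntegral.integral_const_mul, h]
  have hpi' : (Real.pi : ℂ) ≠ 0 := Complex.ofReal_ne_zero.2 hpi.ne'
  push_cast
  field_simp

/-- `b N⁻¹ Tr U (1 - k U)⁻¹` converges. -/
theorem tendsto_trace_kerRes (hu : IsProfile u) (hb : Tendsto b atTop atTop)
    (hbN : Tendsto (fun n : ℕ => b n / (2 * (n : ℝ) + 1)) atTop (𝓝 0)) {k : ℂ} (hk : ‖k‖ ≤ 1 / 4) :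
    Tendsto (fun n : ℕ => ((b n / (2 * (n : ℝ) + 1) : ℝ) : ℂ) *
      (kerMat (siteKernel u n (b n)) * kerRes (siteKernel u n (b n)) k).trace) atTop
      (𝓝 (u 0 + k * (1 / (2 * Real.pi) *
        ∫ p, fourierTransform u p ^ 2 / (1 - k * fourierTransform u p)))) := by
  have h := ((tendsto_trace hu hb hbN hk).const_mul k).const_add (u 0 : ℂ)
  refine h.congr' ?_
  filter_upwards [hb.eventually (eventually_kernelBound hu), hb.eventually_ge_atTop 1] with n hn h1
  rw [trace_kerMat_mul_kerRes (hn n) hk, mul_add]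
  simp only [siteKernel_self, Finset.sum_const, Finset.card_univ, card_site, nsmul_eq_mul]
  have hb0 : (b n : ℂ) ≠ 0 := Complex.ofReal_ne_zero.2 (by linarith : b n ≠ 0)
  have hN : ((2 * (n : ℝ) + 1 : ℝ) : ℂ) ≠ 0 := Complex.ofReal_ne_zero.2 (by positivity)
  congr 1
  · push_cast at hN ⊢
    field_simp
  · ring

end TraceLimit

/-! ### The band matrix as a linear Gaussian matrix. -/

section Band

/-- Ordered pairs of sites, indexing the independent entries. -/
abbrev PairIdx (n : ℕ) : Type := {p : Site n × Site n // p.1 ≤ p.2}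

/-- The position of the entry `(x, y)` among the independent entries. -/
def pairIdx {n : ℕ} (x y : Site n) : PairIdx n := ⟨(min x y, max x y), min_le_max⟩

theorem pairIdx_eq_iff {n : ℕ} (x y i j : Site n) :
    pairIdx x y = pairIdx i j ↔ (x = i ∧ y = j) ∨ (x = j ∧ y = i) := by
  simp only [pairIdx, Subtype.mk.injEq, Prod.mk.injEq]
  constructor
  · rintro ⟨h1, h2⟩
    rcases le_total x y with h | h <;> rcases le_total i j with h' | h' <;>
      simp only [min_eq_left h, min_eq_right h, max_eq_left h, max_eq_right h, min_eq_left h',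
        min_eq_right h', max_eq_left h', max_eq_right h'] at h1 h2 <;> tauto
  · rintro (⟨rfl, rfl⟩ | ⟨rfl, rfl⟩)
    · exact ⟨rfl, rfl⟩
    · exact ⟨min_comm _ _, max_comm _ _⟩

/-- The standard deviation of the matrix entry `(x, y)`. -/
noncomputable def entryDev (u : ℝ → ℝ) (v : ℝ) (n : ℕ) (b : ℝ) (x y : Site n) : ℝ :=
  √(v * (1 + if x = y then 1 else 0)) * √(siteKernel u n b x y)

/-- The coefficient matrices of the band matrix. -/
noncomputable def bandCoef (u : ℝ → ℝ) (v : ℝ) (n : ℕ) (b : ℝ) (p : PairIdx n) :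
    Matrix (Site n) (Site n) ℝ :=
  Matrix.of fun x y => if pairIdx x y = p then entryDev u v n b x y else 0

variable {u : ℝ → ℝ} {v : ℝ} {n : ℕ} {b : ℝ}

theorem linMat_bandCoef (ξ : PairIdx n → ℝ) (x y : Site n) :
    linMat (bandCoef u v n b) ξ x y = ξ (pairIdx x y) * entryDev u v n b x y := by
  rw [linMat_apply]
  simp [bandCoef]

theorem pairIdx_comm (x y : Site n) : pairIdx x y = pairIdx y x := by
  rw [pairIdx_eq_iff]; tauto

theorem entryDev_comm (hU : ∀ x y, siteKernel u n b x y = siteKernel u n b y x) (x y : Site n) :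
    entryDev u v n b x y = entryDev u v n b y x := by
  simp only [entryDev, hU x y, eq_comm (a := x)]

theorem bandCoef_isSymm (hU : ∀ x y, siteKernel u n b x y = siteKernel u n b y x) (p : PairIdx n) :
    (bandCoef u v n b p).IsSymm := by
  ext x y
  simp only [Matrix.transpose_apply, bandCoef, Matrix.of_apply, pairIdx_comm y x,
    entryDev_comm hU y x]

/-- The doubled variance on the diagonal is exactly what the covariance structure asks for: when `x
= y` the two matchings coincide and both count. -/
theorem covStruct_bandCoef {β : ℝ} (hv : 0 ≤ v) (hU : KernelBound (siteKernel u n b) β) :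
    CovStruct (bandCoef u v n b) (bandCoef u v n b) (fun x y => v * siteKernel u n b x y) 1 := by
  intro x y i j
  have e : ∑ p, bandCoef u v n b p x y * bandCoef u v n b p i j =
      if pairIdx x y = pairIdx i j then entryDev u v n b x y * entryDev u v n b i j else 0 := by
    simp [bandCoef, eq_comm]
  have hsq : entryDev u v n b x y * entryDev u v n b x y =
      v * (1 + if x = y then 1 else 0) * siteKernel u n b x y := by
    have h1 : 0 ≤ v * (1 + if x = y then (1 : ℝ) else 0) := by split_ifs <;> positivity
    rw [entryDev, mul_mul_mul_comm, Real.mul_self_sqrt h1, Real.mul_self_sqrt (hU.nonneg x y)]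
  rw [e, one_mul]
  by_cases h1 : x = i ∧ y = j
  · obtain ⟨rfl, rfl⟩ := h1
    rw [if_pos rfl, hsq]
    by_cases h : x = y
    · subst h; simp; ring
    · simp [h]
  · by_cases h2 : x = j ∧ y = i
    · obtain ⟨rfl, rfl⟩ := h2
      have h : x ≠ y := fun h => h1 ⟨h, h.symm⟩
      rw [if_pos (pairIdx_comm x y), entryDev_comm hU.symm y x, hsq]
      simp [h]
    · rw [if_neg (by rw [pairIdx_eq_iff]; tauto)]
      simp [h1, h2]

end Band

/-! ### Bounds on the semicircle transform. -/

section Semicircle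

variable {v : ℝ} {z : ℂ}

theorem semicircle_eq (hv : 0 < v) (hz : z.im ≠ 0) :
    (z + v * semicircleTransform v z) * semicircleTransform v z = -1 := by
  obtain ⟨h, -⟩ := semicircleTransform_spec hv hz
  set w := semicircleTransform v z
  have hd : -z - v * w ≠ 0 := by
    intro h0
    rw [h0, div_zero] at h
    rw [h] at h0
    apply hz
    have : z = 0 := by simpa using h0
    simp [this]
  rw [eq_div_iff hd] at h
  linear_combination -h

/-- The sign condition makes `v Im w` add to `Im z`, so `|z + v w| ≥ |Im z|`, while `|z + v w| |w| =
1`. -/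
theorem norm_semicircle_le (hv : 0 < v) (hz : z.im ≠ 0) :
    ‖semicircleTransform v z‖ ≤ 1 / |z.im| := by
  have he := semicircle_eq hv hz
  obtain ⟨-, hs⟩ := semicircleTransform_spec hv hz
  set w := semicircleTransform v z
  have h1 : |z.im| ≤ ‖z + v * w‖ := by
    refine le_trans ?_ (Complex.abs_im_le_norm _)
    rw [Complex.add_im, Complex.im_ofReal_mul]
    rcases lt_or_gt_of_ne hz with h | h
    · have h3 : w.im ≤ 0 := by nlinarith
      have h4 : v * w.im ≤ 0 := by nlinarith
      rw [abs_of_neg h, abs_of_nonpos (by linarith)]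
      linarith
    · have h3 : 0 ≤ w.im := by nlinarith
      have h4 : 0 ≤ v * w.im := by positivity
      rw [abs_of_pos h, abs_of_nonneg (by linarith)]
      linarith
  have h2 : ‖z + v * w‖ * ‖w‖ = 1 := by rw [← norm_mul, he]; simp
  have hz' : 0 < |z.im| := abs_pos.2 hz
  rw [le_div_iff₀ hz', mul_comm, ← h2]
  gcongr

end Semicircle

/-! ### Limit of the overlap of two resolvents. -/

section OverlapLimit

variable {u : ℝ → ℝ} {v K : ℝ} {z z₁ z₂ : ℂ}

theorem covStruct_mix_bandCoef {n : ℕ} {b β : ℝ} (hv : 0 ≤ v)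
    (hU : KernelBound (siteKernel u n b) β) {a c a' c' e : ℝ} (he : a * a' + c * c' = e) :
    CovStruct (mix a c (bandCoef u v n b)) (mix a' c' (bandCoef u v n b))
      (fun x y => v * siteKernel u n b x y) e :=
  he ▸ (covStruct_bandCoef hv hU).mix a c _ _

/-- The rate at which the averaged diagonal of the resolvent approaches its limit. -/
noncomputable def diagRate (v K β τ : ℝ) : ℝ :=
  2 * (2 * √(v * β) * K ^ 2 + v * β * K ^ 3 + v * K ^ 3 * τ)

/-- The condition `a² + c² = 1` gives the mixture the covariance of a single copy, so the one-matrix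
estimate applies to every rotated matrix. -/
theorem sum_diagDev_mix_le (hu : IsProfile u) (hv : 0 < v) (hvK : v * K ^ 2 ≤ 1 / 4)
    (hz : z.im ≠ 0) (hK : 1 / |z.im| ≤ K) {n : ℕ} {b : ℝ} (hb : 1 ≤ b)
    (hU : KernelBound (siteKernel u n b) (u 0 / b)) {a c : ℝ} (hac : a * a + c * c = 1) :
    ∑ x, diagDev (mix a c (bandCoef u v n b)) z (semicircleTransform v z) x ≤
      (2 * n + 1) * diagRate v K (u 0 / b) (rowErr u n b 0) := by
  have hK0 : 0 ≤ K := le_trans (by positivity) hK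
  have h := sum_diagDev_le (mix_isSymm (bandCoef_isSymm hU.symm) a c) hU
    (div_pos hu.zero_pos (by linarith)) hv (covStruct_mix_bandCoef hv.le hU hac) hz hK hvK
    (semicircle_eq hv hz) ((norm_semicircle_le hv hz).trans hK)
  refine h.trans ?_
  rw [card_site]
  have h2 := mul_le_mul_of_nonneg_left (sum_abs_row_sub_one_le hu n hb)
    (by positivity : 0 ≤ v * K ^ 3)
  simp only [siteKernel, diagRate] at h2 ⊢
  push_cast
  linarith

/-- The rate at which the averaged two-point equation closes. -/
noncomputable def twoPointRate (v K β τ : ℝ) : ℝ :=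
  K * (2 * v * √(2 * β) * K ^ 3 + v * K ^ 2 * (2 * diagRate v K β τ + K * τ) +
    (2 * v * K ^ 2 + 1) * diagRate v K β τ)

theorem tendsto_twoPointRate {β τ : ℕ → ℝ} (hβ : Tendsto β atTop (𝓝 0))
    (hτ : Tendsto τ atTop (𝓝 0)) :
    Tendsto (fun n => twoPointRate v K (β n) (τ n)) atTop (𝓝 0) := by
  have hc : Continuous fun p : ℝ × ℝ => twoPointRate v K p.1 p.2 := by
    unfold twoPointRate diagRate
    fun_prop
  have h := (hc.tendsto (0, 0)).comp (hβ.prodMk_nhds hτ)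
  simpa [twoPointRate, diagRate, Function.comp_def] using h

/-- `b N⁻¹ ∑ U(x,y) E G₁(x,y) G₂(x,y)` for two resolvents of rotated matrices. -/
noncomputable def overlap (u : ℝ → ℝ) (v : ℝ) (n : ℕ) (b θ : ℝ) (z₁ z₂ : ℂ) : ℂ :=
  ((b / (2 * (n : ℝ) + 1) : ℝ) : ℂ) * ∑ x, ∑ y, (siteKernel u n b x y : ℂ) *
    twoPoint (mix 1 0 (bandCoef u v n b)) (mix (Real.cos θ) (Real.sin θ) (bandCoef u v n b))
      z₁ z₂ x y

/-- The prefactor `b / N`, the entry bound `2 u(0) / b` and the `ℓ¹` defect `N · rate` multiply to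
`2 u(0) · rate`. -/
theorem norm_overlap_sub_le (hu : IsProfile u) (hv : 0 < v) (hvK : v * K ^ 2 ≤ 1 / 4)
    (hz₁ : z₁.im ≠ 0) (hz₂ : z₂.im ≠ 0) (hK₁ : 1 / |z₁.im| ≤ K) (hK₂ : 1 / |z₂.im| ≤ K)
    {n : ℕ} {b : ℝ} (hb : 1 ≤ b) (hU : KernelBound (siteKernel u n b) (u 0 / b)) (θ : ℝ)
    {α k : ℂ} (hα : α = semicircleTransform v z₁ * semicircleTransform v z₂)
    (hk : k = Real.cos θ * v * α) (hk' : ‖k‖ ≤ 1 / 4) :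
    ‖overlap u v n b θ z₁ z₂ - α * (((b / (2 * (n : ℝ) + 1) : ℝ) : ℂ) *
      (kerMat (siteKernel u n b) * kerRes (siteKernel u n b) k).trace)‖ ≤
      2 * u 0 * twoPointRate v K (u 0 / b) (rowErr u n b 0) := by
  have hK0 : 0 ≤ K := le_trans (by positivity) hK₁
  have hb0 : 0 < b := by linarith
  have hN : (0 : ℝ) < 2 * n + 1 := by positivity
  set A := mix 1 0 (bandCoef u v n b)
  set A' := mix (Real.cos θ) (Real.sin θ) (bandCoef u v n b)
  set F := twoPoint A A' z₁ z₂
  have h1 : ∑ x, diagDev A z₁ (semicircleTransform v z₁) x ≤ _ :=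
    sum_diagDev_mix_le hu hv hvK hz₁ hK₁ hb hU (a := 1) (c := 0) (by norm_num)
  have h2 : ∑ x, diagDev A' z₂ (semicircleTransform v z₂) x ≤ _ :=
    sum_diagDev_mix_le hu hv hvK hz₂ hK₂ hb hU (a := Real.cos θ) (c := Real.sin θ)
      (by nlinarith [Real.sin_sq_add_cos_sq θ])
  have hF := sum_sum_norm_twoPoint_sub_le (w₂ := semicircleTransform v z₂)
    (mix_isSymm (bandCoef_isSymm hU.symm) 1 0)
    (mix_isSymm (bandCoef_isSymm hU.symm) (Real.cos θ) (Real.sin θ)) hU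
    (div_nonneg hu.zero_pos.le hb0.le) hv.le (Real.abs_cos_le_one θ)
    (covStruct_mix_bandCoef hv.le hU (by norm_num))
    (covStruct_mix_bandCoef hv.le hU (a := 1) (c := 0) (by ring)) hz₁ hz₂ hK₁ hK₂
    (semicircle_eq hv hz₁) ((norm_semicircle_le hv hz₁).trans hK₁)
  have h3 := sum_abs_row_sub_one_le hu n hb
  rw [card_site, ← hα, ← hk] at hF
  have h4 : K * (((2 * n + 1 : ℕ) : ℝ) * (2 * v * √(2 * (u 0 / b)) * K ^ 3) +
      v * K ^ 2 * (2 * ∑ x, diagDev A z₁ (semicircleTransform v z₁) x +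
        K * ∑ x, |∑ s, siteKernel u n b x s - 1|) +
      (2 * v * K ^ 2 + 1) * ∑ x, diagDev A' z₂ (semicircleTransform v z₂) x) ≤
      (2 * n + 1) * twoPointRate v K (u 0 / b) (rowErr u n b 0) := by
    have : K * (((2 * n + 1 : ℕ) : ℝ) * (2 * v * √(2 * (u 0 / b)) * K ^ 3) +
      v * K ^ 2 * (2 * ((2 * n + 1) * diagRate v K (u 0 / b) (rowErr u n b 0)) +
        K * ((2 * n + 1) * rowErr u n b 0)) +
      (2 * v * K ^ 2 + 1) * ((2 * n + 1) * diagRate v K (u 0 / b) (rowErr u n b 0))) =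
      (2 * n + 1) * twoPointRate v K (u 0 / b) (rowErr u n b 0) := by
      simp only [twoPointRate]
      push_cast
      ring
    rw [← this]
    simp only [siteKernel]
    gcongr
  have htr : (kerMat (siteKernel u n b) * F).trace =
      ∑ x, ∑ y, (siteKernel u n b x y : ℂ) * F x y := by
    simp only [Matrix.trace, Matrix.diag, Matrix.mul_apply, kerMat, Matrix.of_apply]
    rw [Finset.sum_comm]
    simp only [hU.symm]
  have h5 := norm_trace_sub_le hU hk' F α
  have e : overlap u v n b θ z₁ z₂ - α * (((b / (2 * (n : ℝ) + 1) : ℝ) : ℂ) *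
      (kerMat (siteKernel u n b) * kerRes (siteKernel u n b) k).trace) =
      ((b / (2 * (n : ℝ) + 1) : ℝ) : ℂ) * ((kerMat (siteKernel u n b) * F).trace -
        α * (kerMat (siteKernel u n b) * kerRes (siteKernel u n b) k).trace) := by
    rw [htr, overlap]
    ring
  rw [e, norm_mul, Complex.norm_real, Real.norm_eq_abs, abs_of_nonneg (by positivity)]
  have h0 : 0 ≤ 2 * (u 0 / b) := by have := hu.zero_pos; positivity
  calc _ ≤ b / (2 * n + 1) * (2 * (u 0 / b) *
        ((2 * n + 1) * twoPointRate v K (u 0 / b) (rowErr u n b 0))) := by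
        refine mul_le_mul_of_nonneg_left (h5.trans ?_) (by positivity)
        exact mul_le_mul_of_nonneg_left (hF.trans h4) h0
    _ = _ := by field_simp

/-- The limit of `overlap` as a function of `c = cos θ` and `α = w₁ w₂`. -/
noncomputable def overlapLimit (u : ℝ → ℝ) (v c : ℝ) (α : ℂ) : ℂ :=
  α * (u 0 + c * v * α * (1 / (2 * Real.pi) *
    ∫ p, fourierTransform u p ^ 2 / (1 - c * v * α * fourierTransform u p)))

theorem norm_mul_le_quarter (hv : 0 ≤ v) (hvK : v * K ^ 2 ≤ 1 / 4) (θ : ℝ) {w₁ w₂ : ℂ}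
    (h₁ : ‖w₁‖ ≤ K) (h₂ : ‖w₂‖ ≤ K) : ‖(Real.cos θ : ℂ) * v * (w₁ * w₂)‖ ≤ 1 / 4 := by
  have hK : 0 ≤ K := (norm_nonneg _).trans h₁
  rw [norm_mul, norm_mul, norm_mul, Complex.norm_real, Complex.norm_real, Real.norm_eq_abs,
    Real.norm_eq_abs, abs_of_nonneg hv]
  calc |Real.cos θ| * v * (‖w₁‖ * ‖w₂‖) ≤ 1 * v * (K * K) := by
        gcongr
        exact Real.abs_cos_le_one θ
    _ ≤ _ := by linarith

theorem tendsto_overlap (hu : IsProfile u) (hv : 0 < v) (hvK : v * K ^ 2 ≤ 1 / 4)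
    (hz₁ : z₁.im ≠ 0) (hz₂ : z₂.im ≠ 0) (hK₁ : 1 / |z₁.im| ≤ K) (hK₂ : 1 / |z₂.im| ≤ K)
    {b : ℕ → ℝ} (hb : Tendsto b atTop atTop)
    (hbN : Tendsto (fun n : ℕ => b n / (2 * (n : ℝ) + 1)) atTop (𝓝 0)) (θ : ℝ) :
    Tendsto (fun n => overlap u v n (b n) θ z₁ z₂) atTop
      (𝓝 (overlapLimit u v (Real.cos θ) (semicircleTransform v z₁ * semicircleTransform v z₂))) := by
  have hk' := norm_mul_le_quarter hv.le hvK θ ((norm_semicircle_le hv hz₁).trans hK₁)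
    ((norm_semicircle_le hv hz₂).trans hK₂)
  have h1 := (tendsto_trace_kerRes hu hb hbN hk').const_mul
    (semicircleTransform v z₁ * semicircleTransform v z₂)
  have h2 : Tendsto (fun n => 2 * u 0 * twoPointRate v K (u 0 / b n) (rowErr u n (b n) 0)) atTop
      (𝓝 0) := by
    have := (tendsto_twoPointRate (v := v) (K := K) (hb.const_div_atTop (u 0))
      (tendsto_rowErr hu hb hbN 0)).const_mul (2 * u 0)
    simpa using this
  have h3 := squeeze_zero_norm' (f := fun n => overlap u v n (b n) θ z₁ z₂ -
    semicircleTransform v z₁ * semicircleTransform v z₂ *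
      (((b n / (2 * (n : ℝ) + 1) : ℝ) : ℂ) * (kerMat (siteKernel u n (b n)) *
        kerRes (siteKernel u n (b n)) (Real.cos θ * v *
          (semicircleTransform v z₁ * semicircleTransform v z₂))).trace)) (by
    filter_upwards [hb.eventually (eventually_kernelBound hu), hb.eventually_ge_atTop 1] with n hn h1
    exact norm_overlap_sub_le hu hv hvK hz₁ hz₂ hK₁ hK₂ h1 (hn n) θ rfl rfl hk') h2
  have h4 := h3.add h1
  simp only [sub_add_cancel, zero_add] at h4
  exact h4

end OverlapLimit

/-! ### Differentiating limits, and the derivative of the semicircle transform. -/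

/-- Pointwise limits of functions with uniformly bounded second order remainder can be
differentiated. -/
theorem tendsto_of_second_order {F : ℕ → ℝ → ℂ} {f : ℝ → ℂ} {d : ℕ → ℂ} {C : ℝ} {f' : ℂ}
    (hF : ∀ ε, Tendsto (fun n => F n ε) atTop (𝓝 (f ε)))
    (hd : ∀ᶠ n in atTop, ∀ ε : ℝ, ‖F n ε - F n 0 - ε * d n‖ ≤ C * ε ^ 2)
    (hf : HasDerivAt f f' 0) : Tendsto d atTop (𝓝 f') := by
  rw [Metric.tendsto_atTop']
  intro e he
  have h1 := (hasDerivAt_iff_isLittleO.1 hf).def (by positivity : 0 < e / 4)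
  have h2 : ∀ᶠ ε : ℝ in 𝓝 0, |C| * ‖ε‖ < e / 4 := by
    have : Tendsto (fun ε : ℝ => |C| * ‖ε‖) (𝓝 0) (𝓝 (|C| * ‖(0 : ℝ)‖)) :=
      (continuous_const.mul continuous_norm).tendsto 0
    rw [norm_zero, mul_zero] at this
    exact this.eventually_lt_const (by positivity)
  -- The step `ε` is fixed before `n`: one difference quotient is close to `f'`, and to `d n`
  -- uniformly in large `n`. Three errors of size `e/4` leave a margin.
  obtain ⟨ε, ⟨hε1, hε2⟩, hε0⟩ := (((h1.and h2).filter_mono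
    (nhdsWithin_le_nhds (s := Set.Ioi 0))).and self_mem_nhdsWithin).exists
  replace hε0 : 0 < ε := hε0
  simp only [sub_zero] at hε1
  rw [Real.norm_eq_abs, abs_of_pos hε0] at hε1 hε2
  have h3 := Metric.tendsto_atTop.1 ((hF ε).sub (hF 0)) (e / 4 * ε) (by positivity)
  obtain ⟨N, hN⟩ := h3
  obtain ⟨N', hN'⟩ := eventually_atTop.1 hd
  refine ⟨max N N', fun n hn => ?_⟩
  have h4 := hN n ((le_max_left _ _).trans hn.le)
  have h5 := hN' n ((le_max_right _ _).trans hn.le) ε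
  rw [dist_eq_norm] at h4 ⊢
  have h6 : C * ε ^ 2 ≤ e / 4 * ε := by
    calc C * ε ^ 2 ≤ |C| * ε ^ 2 := by gcongr; exact le_abs_self C
      _ = |C| * ε * ε := by ring
      _ ≤ _ := by gcongr
  have h7 : (ε : ℂ) * (d n - f') = -(F n ε - F n 0 - ε * d n) +
      ((F n ε - F n 0) - (f ε - f 0)) + (f ε - f 0 - ε • f') := by
    rw [Complex.real_smul]; ring
  have h8 : ε * ‖d n - f'‖ ≤ e / 4 * ε + e / 4 * ε + e / 4 * ε := by
    have : ε * ‖d n - f'‖ = ‖(ε : ℂ) * (d n - f')‖ := by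
      rw [norm_mul, Complex.norm_real, Real.norm_eq_abs, abs_of_pos hε0]
    rw [this, h7]
    refine (norm_add_le _ _).trans (add_le_add ((norm_add_le _ _).trans (add_le_add ?_ h4.le)) hε1)
    rw [norm_neg]
    exact h5.trans h6
  have h9 : ‖d n - f'‖ ≤ 3 / 4 * e := by
    by_contra hcon
    push Not at hcon
    nlinarith
  linarith

section SemicircleDeriv

variable {v K : ℝ} {z : ℂ}

theorem norm_mul_semicircle_le (hv : 0 ≤ v) (hvK : v * K ^ 2 ≤ 1 / 4) {w₁ w₂ : ℂ}
    (h₁ : ‖w₁‖ ≤ K) (h₂ : ‖w₂‖ ≤ K) : ‖(v : ℂ) * (w₁ * w₂)‖ ≤ 1 / 4 := by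
  simpa using norm_mul_le_quarter hv hvK 0 h₁ h₂

/-- The derivative of the semicircle transform in the real direction. -/
theorem hasDerivAt_semicircle (hv : 0 < v) (hvK : v * K ^ 2 ≤ 1 / 4) (hz : z.im ≠ 0)
    (hK : 1 / |z.im| ≤ K) :
    HasDerivAt (fun ε : ℝ => semicircleTransform v (z + ε))
      (semicircleTransform v z ^ 2 / (1 - v * semicircleTransform v z ^ 2)) 0 := by
  have hzε : ∀ ε : ℝ, (z + ε).im ≠ 0 := fun ε => by simpa using hz
  have hKε : ∀ ε : ℝ, ‖semicircleTransform v (z + ε)‖ ≤ K := fun ε =>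
    (norm_semicircle_le hv (hzε ε)).trans (by simpa using hK)
  set w : ℝ → ℂ := fun ε => semicircleTransform v (z + ε) with hw
  have h0 : semicircleTransform v z = w 0 := by simp [hw]
  have hne : ∀ ε, 3 / 4 ≤ ‖1 - (v : ℂ) * (w 0 * w ε)‖ := fun ε => by
    have h := norm_one_sub_ge (norm_mul_semicircle_le hv.le hvK (hKε 0) (hKε ε))
      (s := 1) (by simp)
    rwa [mul_one] at h
  -- Eliminating between the two quadratic equations factors the increment exactly. Since the second
  -- factor stays away from zero, continuity and then the derivative follow.
  have hid : ∀ ε : ℝ, (w ε - w 0) * (1 - v * (w 0 * w ε)) = ε * (w 0 * w ε) := fun ε => by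
    have e1 := semicircle_eq hv (hzε ε)
    have e0 := semicircle_eq hv (hzε 0)
    change (z + ε + v * w ε) * w ε = -1 at e1
    change (z + (0 : ℝ) + v * w 0) * w 0 = -1 at e0
    rw [Complex.ofReal_zero, add_zero] at e0
    linear_combination w ε * e0 - w 0 * e1
  have hne' : ∀ ε, 1 - (v : ℂ) * (w 0 * w ε) ≠ 0 := fun ε h => by
    have := hne ε
    rw [h, norm_zero] at this
    norm_num at this
  have hid' : ∀ ε : ℝ, w ε - w 0 = ε * (w 0 * w ε / (1 - v * (w 0 * w ε))) := fun ε => by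
    rw [mul_div_assoc', eq_div_iff (hne' ε), hid]
  have hcont : Tendsto w (𝓝 0) (𝓝 (w 0)) := by
    rw [tendsto_iff_norm_sub_tendsto_zero]
    have hb : Tendsto (fun ε : ℝ => |ε| * (K * K / (3 / 4))) (𝓝 0) (𝓝 0) := by
      have : Tendsto (fun ε : ℝ => |ε| * (K * K / (3 / 4))) (𝓝 0)
        (𝓝 (|0| * (K * K / (3 / 4)))) := (continuous_abs.mul continuous_const).tendsto 0
      simpa using this
    refine squeeze_zero (fun _ => norm_nonneg _) (fun ε => ?_) hb
    rw [hid' ε, norm_mul, norm_div, norm_mul, Complex.norm_real, Real.norm_eq_abs]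
    have hK0 : 0 ≤ K := (norm_nonneg _).trans (hKε 0)
    exact mul_le_mul_of_nonneg_left (div_le_div₀ (by positivity)
      (mul_le_mul (hKε 0) (hKε ε) (norm_nonneg _) hK0) (by norm_num) (hne ε)) (abs_nonneg _)
  rw [hasDerivAt_iff_tendsto_slope_zero, h0]
  have hlim : Tendsto (fun ε => w 0 * w ε / (1 - v * (w 0 * w ε))) (𝓝[≠] 0)
      (𝓝 (w 0 * w 0 / (1 - v * (w 0 * w 0)))) :=
    ((hcont.const_mul (w 0)).div (((hcont.const_mul (w 0)).const_mul (v : ℂ)).const_sub 1)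
      (hne' 0)).mono_left nhdsWithin_le_nhds
  rw [sq]
  refine hlim.congr' ?_
  filter_upwards [self_mem_nhdsWithin] with ε hε
  have hε' : (ε : ℂ) ≠ 0 := Complex.ofReal_ne_zero.2 hε
  rw [zero_add, hid' ε, Complex.real_smul, Complex.ofReal_inv, inv_mul_cancel_left₀ hε']

end SemicircleDeriv

/-! ### Integrals of powers of the Fourier transform as functions of `k`. -/

section SpectralMoment

variable {u : ℝ → ℝ}

/-- The claim concerns `u` alone, so any admissible bandwidth will do; `√n` is one. -/
theorem norm_fourierTransform_sq_le_decay (hu : IsProfile u) (p : ℝ) :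
    ‖fourierTransform u p‖ ^ 2 ≤ decayConst u / (1 + p ^ 2) := by
  have h1 : Tendsto (fun n : ℕ => √(n : ℝ)) atTop atTop :=
    Real.tendsto_sqrt_atTop.comp tendsto_natCast_atTop_atTop
  refine norm_fourierTransform_sq_le hu h1 ?_ p
  refine squeeze_zero' (Eventually.of_forall fun n => by positivity) ?_ h1.inv_tendsto_atTop
  filter_upwards [eventually_ge_atTop 1] with n hn
  have hn' : (0 : ℝ) < n := by exact_mod_cast hn
  have h2 : 0 < √(n : ℝ) := Real.sqrt_pos.2 hn'
  rw [Pi.inv_apply, div_le_iff₀ (by positivity), inv_mul_eq_div, le_div_iff₀ h2,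
    Real.mul_self_sqrt hn'.le]
  linarith

/-- `∫ û^{m+1} / (1 - k û)^m`. -/
noncomputable def spectralMoment (u : ℝ → ℝ) (m : ℕ) (k : ℂ) : ℂ :=
  ∫ p, fourierTransform u p ^ (m + 1) / (1 - k * fourierTransform u p) ^ m

theorem norm_one_sub_ge' {k s : ℂ} (hk : ‖k‖ ≤ 1 / 3) (hs : ‖s‖ ≤ 1) :
    2 / 3 ≤ ‖1 - k * s‖ := by
  have h1 : ‖k * s‖ ≤ 1 / 3 := by
    rw [norm_mul]
    nlinarith [norm_nonneg k, norm_nonneg s]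
  have h2 := norm_sub_norm_le (1 : ℂ) (k * s)
  rw [norm_one] at h2
  linarith

/-- The condition `1 ≤ m` leaves at least two powers of `û`, which is what decay `1/|p|` needs for
integrability. -/
theorem norm_spectral_le (hu : IsProfile u) {m : ℕ} (hm : 1 ≤ m) (l : ℕ) {k : ℂ}
    (hk : ‖k‖ ≤ 1 / 3) (p : ℝ) :
    ‖fourierTransform u p ^ (m + 1) / (1 - k * fourierTransform u p) ^ l‖ ≤
      (3 / 2) ^ l * decayConst u / (1 + p ^ 2) := by
  have hs := norm_fourierTransform_le hu p
  have hd := norm_fourierTransform_sq_le_decay hu p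
  have h1 := norm_one_sub_ge' hk hs
  have h2 : ‖fourierTransform u p‖ ^ (m + 1) ≤ decayConst u / (1 + p ^ 2) :=
    (pow_le_pow_of_le_one (norm_nonneg _) hs (by omega)).trans hd
  rw [norm_div, norm_pow, norm_pow, div_le_iff₀ (by positivity)]
  have h3 : 1 ≤ (3 / 2) ^ l * ‖1 - k * fourierTransform u p‖ ^ l := by
    rw [← mul_pow]
    exact one_le_pow₀ (by linarith)
  calc _ ≤ decayConst u / (1 + p ^ 2) := h2
    _ ≤ decayConst u / (1 + p ^ 2) * ((3 / 2) ^ l * ‖1 - k * fourierTransform u p‖ ^ l) :=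
        le_mul_of_one_le_right (le_trans (by positivity) h2) h3
    _ = _ := by ring

theorem continuous_spectral (hu : IsProfile u) (m l : ℕ) {k : ℂ} (hk : ‖k‖ ≤ 1 / 3) :
    Continuous fun p => fourierTransform u p ^ m / (1 - k * fourierTransform u p) ^ l := by
  have hc := continuous_fourierTransform hu
  refine (hc.pow m).div ((continuous_const.sub (continuous_const.mul hc)).pow l) fun p => ?_
  refine pow_ne_zero _ fun h => ?_
  have := norm_one_sub_ge' hk (norm_fourierTransform_le hu p)
  rw [h, norm_zero] at this
  norm_num at this

theorem integrable_spectral (hu : IsProfile u) {m : ℕ} (hm : 1 ≤ m) (l : ℕ) {k : ℂ}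
    (hk : ‖k‖ ≤ 1 / 3) :
    Integrable fun p => fourierTransform u p ^ (m + 1) / (1 - k * fourierTransform u p) ^ l :=
  (integrable_decay _).mono' (continuous_spectral hu _ l hk).aestronglyMeasurable
    (ae_of_all _ fun p => norm_spectral_le hu hm l hk p)

/-- Differentiating `s^(m+1) / (1 - k s)^m` in `k` raises `m` by one and brings down a factor `m`,
so the family is closed under differentiation. -/
theorem hasDerivAt_spectralMoment (hu : IsProfile u) {m : ℕ} (hm : 1 ≤ m) {k : ℂ}
    (hk : ‖k‖ ≤ 1 / 4) :
    HasDerivAt (spectralMoment u m) (m * spectralMoment u (m + 1) k) k := by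
  -- The radius is `1/3 - 1/4`, the room between the disc of interest and the disc of uniform
  -- bounds.
  have hball : ∀ k' ∈ Metric.ball k (1 / 12), ‖k'‖ ≤ 1 / 3 := fun k' hk' => by
    rw [mem_ball_iff_norm] at hk'
    have := norm_le_norm_add_norm_sub' k' k
    linarith
  have hk3 : ‖k‖ ≤ 1 / 3 := by linarith
  have h := (hasDerivAt_integral_of_dominated_loc_of_deriv_le (μ := volume) (𝕜 := ℂ)
    (F := fun k' p => fourierTransform u p ^ (m + 1) / (1 - k' * fourierTransform u p) ^ m)
    (F' := fun k' p => m * (fourierTransform u p ^ (m + 1 + 1) /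
      (1 - k' * fourierTransform u p) ^ (m + 1)))
    (bound := fun p => m * ((3 / 2) ^ (m + 1) * decayConst u / (1 + p ^ 2)))
    (Metric.ball_mem_nhds k (by norm_num : (0 : ℝ) < 1 / 12)) ?_ ?_ ?_ ?_ ?_ ?_).2
  · rwa [integral_const_mul] at h
  · filter_upwards [Metric.ball_mem_nhds k (by norm_num : (0 : ℝ) < 1 / 12)] with k' hk'
    exact (continuous_spectral hu _ m (hball k' hk')).aestronglyMeasurable
  · exact integrable_spectral hu hm m hk3
  · exact ((continuous_spectral hu _ (m + 1) hk3).const_mul _).aestronglyMeasurable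
  · refine ae_of_all _ fun p k' hk' => ?_
    rw [norm_mul, Complex.norm_natCast]
    exact mul_le_mul_of_nonneg_left (norm_spectral_le hu (by omega) _ (hball k' hk') p)
      (Nat.cast_nonneg _)
  · exact (integrable_decay _).const_mul _
  · refine ae_of_all _ fun p k' hk' => ?_
    set s := fourierTransform u p
    have hne : 1 - k' * s ≠ 0 := fun h => by
      have := norm_one_sub_ge' (hball k' hk') (norm_fourierTransform_le hu p)
      rw [h, norm_zero] at this
      norm_num at this
    have h1 : HasDerivAt (fun k' : ℂ => 1 - k' * s) (-s) k' := by
      simpa using ((hasDerivAt_id k').mul_const s).const_sub 1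
    have h2 := (hasDerivAt_const k' (s ^ (m + 1))).div (h1.pow m) (pow_ne_zero m hne)
    refine h2.congr_deriv ?_
    obtain ⟨l, rfl⟩ : ∃ l, m = l + 1 := ⟨m - 1, by omega⟩
    simp only [Pi.pow_apply, Nat.add_sub_cancel]
    push_cast
    field_simp
    ring

end SpectralMoment

/-! ### Weighted pairings of random matrices and their second-order expansion. -/

section Pairing

variable {κ : Type*} [Fintype κ] [DecidableEq κ] {S : Type*} [Fintype S] [DecidableEq S]
variable {U : S → S → ℝ} {β s : ℝ} {P Q R : (κ → ℝ) → Matrix S S ℂ}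

/-- `s ∑ U(x,y) E P(x,y) Q(x,y)`. -/
noncomputable def pairing (U : S → S → ℝ) (s : ℝ) (P Q : (κ → ℝ) → Matrix S S ℂ) : ℂ :=
  (s : ℂ) * ∑ x, ∑ y, (U x y : ℂ) * ∫ ζ, P ζ x y * Q ζ x y ∂(stdGauss κ)

/-- Random matrices with bounded entries depending continuously on the randomness. -/
def MatBCont (P : (κ → ℝ) → Matrix S S ℂ) : Prop := ∀ x y, BCont fun ζ => P ζ x y

theorem MatBCont.mul (hP : MatBCont P) (hQ : MatBCont Q) : MatBCont fun ζ => P ζ * Q ζ :=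
  fun x y => by
    simp only [Matrix.mul_apply]
    exact BCont.sum _ fun t _ => (hP x t).mul (hQ t y)

theorem pairing_comm (U : S → S → ℝ) (s : ℝ) (P Q : (κ → ℝ) → Matrix S S ℂ) :
    pairing U s P Q = pairing U s Q P := by
  simp only [pairing, mul_comm]

/-- Bound `U` by `β` and use Cauchy–Schwarz column by column: the double sum costs only one factor
of the dimension. -/
theorem norm_pairing_le (hU : KernelBound U β) (hP : MatBCont P) (hQ : MatBCont Q) {K K' : ℝ}
    (hPK : ∀ ζ, OpBound (P ζ) K) (hQK : ∀ ζ, OpBound (Q ζ) K') :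
    ‖pairing U s P Q‖ ≤ |s| * (Fintype.card S * (β * (K * K'))) := by
  rw [pairing, norm_mul, Complex.norm_real, Real.norm_eq_abs]
  refine mul_le_mul_of_nonneg_left ?_ (abs_nonneg s)
  simp only [← integral_const_mul]
  refine norm_sum_sum_integral_le (fun x y => (BCont.const _).mul ((hP x y).mul (hQ x y)))
    fun ζ => ?_
  have h1 : ∀ x y, ‖(U x y : ℂ) * (P ζ x y * Q ζ x y)‖ ≤ β * (‖P ζ x y‖ * ‖Q ζ x y‖) := by
    intro x y
    rw [norm_mul, norm_mul, Complex.norm_real, Real.norm_eq_abs, abs_of_nonneg (hU.nonneg x y)]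
    gcongr
    exact hU.le x y
  refine (Finset.sum_le_sum fun x _ => Finset.sum_le_sum fun y _ => h1 x y).trans ?_
  rw [Finset.sum_comm]
  calc _ ≤ ∑ _y : S, β * (K * K') := by
        refine Finset.sum_le_sum fun y _ => ?_
        rw [← Finset.mul_sum]
        exact mul_le_mul_of_nonneg_left ((hPK ζ).col_mul (hQK ζ) y y)
          ((hU.nonneg y y).trans (hU.le y y))
    _ = _ := by simp

theorem pairing_sub_sub (hP : MatBCont P) (hQ : MatBCont Q) {Q' : (κ → ℝ) → Matrix S S ℂ}
    (hQ' : MatBCont Q') (hR : MatBCont R) (ε : ℂ) :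
    pairing U s P Q' - pairing U s P Q - ε * pairing U s P R =
      pairing U s P fun ζ => Q' ζ - Q ζ - ε • R ζ := by
  have h : ∀ x y, ∫ ζ, P ζ x y * (Q' ζ - Q ζ - ε • R ζ) x y ∂(stdGauss κ) =
      ∫ ζ, P ζ x y * Q' ζ x y ∂(stdGauss κ) - ∫ ζ, P ζ x y * Q ζ x y ∂(stdGauss κ) -
        ε * ∫ ζ, P ζ x y * R ζ x y ∂(stdGauss κ) := by
    intro x y
    rw [← integral_const_mul, ← integral_sub (((hP x y).mul (hQ' x y)).integrable _)
      (((hP x y).mul (hQ x y)).integrable _), ← integral_sub]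
    · refine integral_congr_ae (ae_of_all _ fun ζ => ?_)
      simp only [Matrix.sub_apply, Matrix.smul_apply, smul_eq_mul]
      ring
    · exact (((hP x y).mul (hQ' x y)).sub ((hP x y).mul (hQ x y))).integrable _
    · exact ((BCont.const ε).mul ((hP x y).mul (hR x y))).integrable _
  simp only [pairing, h, mul_sub, Finset.sum_sub_distrib]
  congr 1
  simp only [Finset.mul_sum]
  refine Finset.sum_congr rfl fun x _ => Finset.sum_congr rfl fun y _ => ?_
  ring

/-- Applying the resolvent identity twice gives an exact Taylor remainder. Real shifts leave `Im z`
unchanged, so operator bounds are uniform in `ε`. -/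
theorem resolv_second_order {H : Matrix S S ℝ} (hH : H.IsSymm) {z : ℂ} (hz : z.im ≠ 0) (ε : ℝ) :
    resolv H (z + ε) - resolv H z - (ε : ℂ) • (resolv H z * resolv H z) =
      ((ε : ℂ) ^ 2) • (resolv H (z + ε) * resolv H z * resolv H z) := by
  have h := resolv_sub_resolv' hH hz (z' := z + ε) (by simpa using hz)
  rw [add_sub_cancel_left] at h
  rw [h, ← smul_sub, ← sub_mul, h, Matrix.smul_mul, smul_smul, sq]

theorem OpBound.smul {M : Matrix S S ℂ} {K : ℝ} (h : OpBound M K) (c : ℂ) :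
    OpBound (c • M) (‖c‖ * K) := by
  refine ⟨mul_nonneg (norm_nonneg c) h.1, fun f => ?_⟩
  have : sqNorm ((c • M).mulVec f) = ‖c‖ ^ 2 * sqNorm (M.mulVec f) := by
    simp only [sqNorm, Matrix.smul_mulVec, Pi.smul_apply, smul_eq_mul, norm_mul, mul_pow,
      Finset.mul_sum]
  rw [this, mul_pow, mul_assoc]
  exact mul_le_mul_of_nonneg_left (h.2 f) (sq_nonneg _)

theorem norm_pairing_second_order_le {A : κ → Matrix S S ℝ} (hA : ∀ q, (A q).IsSymm) {z : ℂ}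
    (hz : z.im ≠ 0) (hU : KernelBound U β) (hP : MatBCont P) {K K' : ℝ}
    (hPK : ∀ ζ, OpBound (P ζ) K') (hK : 1 / |z.im| ≤ K) (ε : ℝ) :
    ‖pairing U s P (fun ζ => resolv (linMat A ζ) (z + ε)) -
      pairing U s P (fun ζ => resolv (linMat A ζ) z) -
      ε * pairing U s P (fun ζ => resolv (linMat A ζ) z * resolv (linMat A ζ) z)‖ ≤
      |s| * (Fintype.card S * (β * (K' * K ^ 3))) * ε ^ 2 := by
  have hzε : (z + ε).im ≠ 0 := by simpa using hz
  have h0 : MatBCont fun ζ => resolv (linMat A ζ) z := bcont_resolv hA hz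
  have h1 : MatBCont fun ζ => resolv (linMat A ζ) (z + ε) := bcont_resolv hA hzε
  have hO := resolv_linMat_opBound hA hz hK
  have hOε := resolv_linMat_opBound hA hzε (K := K) (by simpa using hK)
  rw [pairing_sub_sub hP h0 h1 (h0.mul h0)]
  have hb : MatBCont fun ζ => ((ε : ℂ) ^ 2) •
      (resolv (linMat A ζ) (z + ε) * resolv (linMat A ζ) z * resolv (linMat A ζ) z) :=
    fun x y => (BCont.const _).mul (((h1.mul h0).mul h0) x y)
  simp only [fun ζ => resolv_second_order (linMat_isSymm hA ζ) hz ε]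
  refine (norm_pairing_le hU hP hb hPK
    fun ζ => (((hOε ζ).mul (hO ζ)).mul (hO ζ)).smul _).trans (le_of_eq ?_)
  rw [norm_pow, Complex.norm_real, Real.norm_eq_abs, sq_abs]
  ring

end Pairing

/-! ### Mixed derivative of the overlap and its limit. -/

section OverlapDerivative

variable {u : ℝ → ℝ} {v K : ℝ} {z₁ z₂ : ℂ}

/-- The `z₂`-derivative of `overlap`. -/
noncomputable def overlapR (u : ℝ → ℝ) (v : ℝ) (n : ℕ) (b θ : ℝ) (z₁ z₂ : ℂ) : ℂ :=
  pairing (siteKernel u n b) (b / (2 * n + 1)) (resL (bandCoef u v n b) z₁)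
    fun ζ => resR (bandCoef u v n b) z₂ θ ζ * resR (bandCoef u v n b) z₂ θ ζ

/-- The mixed derivative of `overlap`: `b N⁻¹ ∑ U(x,y) E G₁²(x,y) G₂²(x,y)`. -/
noncomputable def overlapLR (u : ℝ → ℝ) (v : ℝ) (n : ℕ) (b θ : ℝ) (z₁ z₂ : ℂ) : ℂ :=
  pairing (siteKernel u n b) (b / (2 * n + 1))
    (fun ζ => resL (bandCoef u v n b) z₁ ζ * resL (bandCoef u v n b) z₁ ζ)
    fun ζ => resR (bandCoef u v n b) z₂ θ ζ * resR (bandCoef u v n b) z₂ θ ζ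

/-- The dimension and the bandwidth cancel, so the remainder constants do not depend on `n`, as
differentiating the limit requires. -/
theorem pairing_const_eq {n : ℕ} {b : ℝ} (hb : 0 < b) (C : ℝ) :
    |b / (2 * n + 1)| * (Fintype.card (Site n) * (u 0 / b * C)) = u 0 * C := by
  have hN : (0 : ℝ) < 2 * n + 1 := by positivity
  rw [abs_of_pos (by positivity), card_site]
  push_cast
  field_simp

theorem norm_overlap_second_order_le (hz₁ : z₁.im ≠ 0) (hz₂ : z₂.im ≠ 0)
    (hK₁ : 1 / |z₁.im| ≤ K) (hK₂ : 1 / |z₂.im| ≤ K) {n : ℕ} {b : ℝ} (hb : 0 < b)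
    (hU : KernelBound (siteKernel u n b) (u 0 / b)) (θ ε : ℝ) :
    ‖overlap u v n b θ z₁ (z₂ + ε) - overlap u v n b θ z₁ z₂ - ε * overlapR u v n b θ z₁ z₂‖ ≤
      u 0 * (K * K ^ 3) * ε ^ 2 := by
  have hA := bandCoef_isSymm (v := v) hU.symm
  rw [← pairing_const_eq hb]
  exact norm_pairing_second_order_le (mix_isSymm hA _ _) hz₂ hU (bcont_resL' hA hz₁)
    (resolv_linMat_opBound (mix_isSymm hA _ _) hz₁ hK₁) hK₂ ε

theorem norm_overlapR_second_order_le (hz₁ : z₁.im ≠ 0) (hz₂ : z₂.im ≠ 0)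
    (hK₁ : 1 / |z₁.im| ≤ K) (hK₂ : 1 / |z₂.im| ≤ K) {n : ℕ} {b : ℝ} (hb : 0 < b)
    (hU : KernelBound (siteKernel u n b) (u 0 / b)) (θ ε : ℝ) :
    ‖overlapR u v n b θ (z₁ + ε) z₂ - overlapR u v n b θ z₁ z₂ - ε * overlapLR u v n b θ z₁ z₂‖ ≤
      u 0 * (K * K * K ^ 3) * ε ^ 2 := by
  have hA := bandCoef_isSymm (v := v) hU.symm
  have hR : MatBCont (resR (bandCoef u v n b) z₂ θ) := bcont_resR' hA hz₂ θ
  have hO := resolv_linMat_opBound (mix_isSymm hA (Real.cos θ) (Real.sin θ)) hz₂ hK₂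
  rw [← pairing_const_eq hb]
  simp only [overlapR, overlapLR]
  rw [pairing_comm _ _ (resL _ (z₁ + ε)), pairing_comm _ _ (resL _ z₁),
    pairing_comm _ _ (fun ζ => resL _ z₁ ζ * resL _ z₁ ζ)]
  exact norm_pairing_second_order_le (mix_isSymm hA 1 0) hz₁ hU (hR.mul hR)
    (fun ζ => (hO ζ).mul (hO ζ)) hK₁ ε

theorem norm_overlapLR_le (hz₁ : z₁.im ≠ 0) (hz₂ : z₂.im ≠ 0)
    (hK₁ : 1 / |z₁.im| ≤ K) (hK₂ : 1 / |z₂.im| ≤ K) {n : ℕ} {b : ℝ} (hb : 0 < b)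
    (hU : KernelBound (siteKernel u n b) (u 0 / b)) (θ : ℝ) :
    ‖overlapLR u v n b θ z₁ z₂‖ ≤ u 0 * (K * K * (K * K)) := by
  have hA := bandCoef_isSymm (v := v) hU.symm
  have hL : MatBCont (resL (bandCoef u v n b) z₁) := bcont_resL' hA hz₁
  have hR : MatBCont (resR (bandCoef u v n b) z₂ θ) := bcont_resR' hA hz₂ θ
  have hO := resolv_linMat_opBound (mix_isSymm hA (Real.cos θ) (Real.sin θ)) hz₂ hK₂
  have hO' := resolv_linMat_opBound (mix_isSymm hA 1 0) hz₁ hK₁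
  rw [← pairing_const_eq hb]
  exact norm_pairing_le hU (hL.mul hL) (hR.mul hR) (fun ζ => (hO' ζ).mul (hO' ζ))
    fun ζ => (hO ζ).mul (hO ζ)

/-- The derivative of `overlapLimit`, as a function of `k = c v α`. -/
noncomputable def overlapProfile (u : ℝ → ℝ) (k : ℂ) : ℂ :=
  u 0 + 1 / (2 * Real.pi) * (2 * k * spectralMoment u 1 k + k ^ 2 * spectralMoment u 2 k)

/-- The derivative of `k ↦ k * overlapProfile u k`. -/
noncomputable def overlapProfileDeriv (u : ℝ → ℝ) (k : ℂ) : ℂ :=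
  u 0 + 1 / (2 * Real.pi) * (4 * k * spectralMoment u 1 k + 5 * k ^ 2 * spectralMoment u 2 k +
    2 * k ^ 3 * spectralMoment u 3 k)

theorem hasDerivAt_spectralMoment_comp (hu : IsProfile u) {m : ℕ} (hm : 1 ≤ m) {a α : ℂ}
    (hα : ‖a * α‖ ≤ 1 / 4) :
    HasDerivAt (fun α : ℂ => spectralMoment u m (a * α))
      (m * spectralMoment u (m + 1) (a * α) * a) α := by
  have h1 : HasDerivAt (fun α : ℂ => a * α) a α := by
    simpa using (hasDerivAt_id α).const_mul a
  exact (hasDerivAt_spectralMoment hu hm hα).comp α h1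

theorem hasDerivAt_overlapLimit (hu : IsProfile u) {c : ℝ} {α : ℂ}
    (hα : ‖(c : ℂ) * v * α‖ ≤ 1 / 4) :
    HasDerivAt (overlapLimit u v c) (overlapProfile u (c * v * α)) α := by
  have h1 : HasDerivAt (fun α : ℂ => (c : ℂ) * v * α) (c * v) α := by
    simpa using (hasDerivAt_id α).const_mul ((c : ℂ) * v)
  have h2 := hasDerivAt_spectralMoment_comp hu le_rfl hα
  have h := (hasDerivAt_id α).mul
    ((h1.mul (h2.const_mul (1 / (2 * (Real.pi : ℂ))))).const_add (u 0 : ℂ))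
  have e : overlapLimit u v c = fun α => id α * (u 0 + c * v * α * (1 / (2 * (Real.pi : ℂ)) *
      spectralMoment u 1 (c * v * α))) := by
    ext α
    simp only [overlapLimit, spectralMoment, pow_one, id]
  rw [e]
  refine h.congr_deriv ?_
  simp only [overlapProfile, id, Pi.mul_apply]
  push_cast
  ring

theorem hasDerivAt_mul_overlapProfile (hu : IsProfile u) {a α : ℂ} (hα : ‖a * α‖ ≤ 1 / 4) :
    HasDerivAt (fun α => α * overlapProfile u (a * α)) (overlapProfileDeriv u (a * α)) α := by
  have h1 : HasDerivAt (fun α : ℂ => a * α) a α := by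
    simpa using (hasDerivAt_id α).const_mul a
  have h2 := hasDerivAt_spectralMoment_comp hu (m := 1) le_rfl hα
  have h3 := hasDerivAt_spectralMoment_comp hu (m := 2) (by norm_num) hα
  have h := (hasDerivAt_id α).mul ((((((h1.const_mul 2).mul h2).add
    ((h1.pow 2).mul h3))).const_mul (1 / (2 * (Real.pi : ℂ)))).const_add (u 0 : ℂ))
  refine h.congr_deriv ?_
  simp only [overlapProfileDeriv, id, Pi.add_apply, Pi.mul_apply, Pi.pow_apply]
  push_cast
  ring

/-- The overlap converges at every real shift of `z₂`, so its derivative converges too; the limit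
depends on `z₂` only through `w₁ w₂`, and the chain rule applies. -/
theorem tendsto_overlapR (hu : IsProfile u) (hv : 0 < v) (hvK : v * K ^ 2 ≤ 1 / 4)
    (hz₁ : z₁.im ≠ 0) (hz₂ : z₂.im ≠ 0) (hK₁ : 1 / |z₁.im| ≤ K) (hK₂ : 1 / |z₂.im| ≤ K)
    {b : ℕ → ℝ} (hb : Tendsto b atTop atTop)
    (hbN : Tendsto (fun n : ℕ => b n / (2 * (n : ℝ) + 1)) atTop (𝓝 0)) (θ : ℝ) :
    Tendsto (fun n => overlapR u v n (b n) θ z₁ z₂) atTop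
      (𝓝 (overlapProfile u (Real.cos θ * v * (semicircleTransform v z₁ * semicircleTransform v z₂)) *
        (semicircleTransform v z₁ * (semicircleTransform v z₂ ^ 2 /
          (1 - v * semicircleTransform v z₂ ^ 2))))) := by
  have hzε : ∀ ε : ℝ, (z₂ + ε).im ≠ 0 := fun ε => by simpa using hz₂
  have hKε : ∀ ε : ℝ, 1 / |(z₂ + ε).im| ≤ K := fun ε => by simpa using hK₂
  have hw := (hasDerivAt_semicircle hv hvK hz₂ hK₂).const_mul (semicircleTransform v z₁)
  have hα := norm_mul_le_quarter hv.le hvK θ ((norm_semicircle_le hv hz₁).trans hK₁)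
    ((norm_semicircle_le hv hz₂).trans hK₂)
  refine tendsto_of_second_order (F := fun n ε => overlap u v n (b n) θ z₁ (z₂ + ε))
    (fun ε => tendsto_overlap hu hv hvK hz₁ (hzε ε) hK₁ (hKε ε) hb hbN θ)
    (C := u 0 * (K * K ^ 3)) ?_ ?_
  · filter_upwards [hb.eventually (eventually_kernelBound hu), hb.eventually_gt_atTop 0] with n hn h0
    intro ε
    simpa using norm_overlap_second_order_le (v := v) hz₁ hz₂ hK₁ hK₂ h0 (hn n) θ ε
  · refine HasDerivAt.comp (h₂ := overlapLimit u v (Real.cos θ)) (0 : ℝ) ?_ hw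
    simpa using hasDerivAt_overlapLimit hu hα

/-- The limit of `overlapLR`. -/
theorem tendsto_overlapLR (hu : IsProfile u) (hv : 0 < v) (hvK : v * K ^ 2 ≤ 1 / 4)
    (hz₁ : z₁.im ≠ 0) (hz₂ : z₂.im ≠ 0) (hK₁ : 1 / |z₁.im| ≤ K) (hK₂ : 1 / |z₂.im| ≤ K)
    {b : ℕ → ℝ} (hb : Tendsto b atTop atTop)
    (hbN : Tendsto (fun n : ℕ => b n / (2 * (n : ℝ) + 1)) atTop (𝓝 0)) (θ : ℝ) :
    Tendsto (fun n => overlapLR u v n (b n) θ z₁ z₂) atTop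
      (𝓝 (semicircleTransform v z₁ ^ 2 / (1 - v * semicircleTransform v z₁ ^ 2) *
        (semicircleTransform v z₂ ^ 2 / (1 - v * semicircleTransform v z₂ ^ 2)) *
        overlapProfileDeriv u (Real.cos θ * v *
          (semicircleTransform v z₁ * semicircleTransform v z₂)))) := by
  have hzε : ∀ ε : ℝ, (z₁ + ε).im ≠ 0 := fun ε => by simpa using hz₁
  have hKε : ∀ ε : ℝ, 1 / |(z₁ + ε).im| ≤ K := fun ε => by simpa using hK₁
  have hw := hasDerivAt_semicircle hv hvK hz₁ hK₁
  have hα := norm_mul_le_quarter hv.le hvK θ ((norm_semicircle_le hv hz₁).trans hK₁)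
    ((norm_semicircle_le hv hz₂).trans hK₂)
  set w₂ := semicircleTransform v z₂ with hw₂
  have hw₂0 : w₂ ≠ 0 := fun h => by
    have := semicircle_eq hv hz₂
    rw [← hw₂, h, mul_zero] at this
    norm_num at this
  refine tendsto_of_second_order (F := fun n ε => overlapR u v n (b n) θ (z₁ + ε) z₂)
    (fun ε => tendsto_overlapR hu hv hvK (hzε ε) hz₂ (hKε ε) hK₂ hb hbN θ)
    (C := u 0 * (K * K * K ^ 3)) ?_ ?_
  · filter_upwards [hb.eventually (eventually_kernelBound hu), hb.eventually_gt_atTop 0] with n hn h0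
    intro ε
    simpa using norm_overlapR_second_order_le (v := v) hz₁ hz₂ hK₁ hK₂ h0 (hn n) θ ε
  -- Pulling out `w₂ / (1 - v w₂²)` leaves `α * overlapProfile u (cos θ v α)` with `α = w₁ w₂`, so
  -- `z₁` enters only through `α`.
  · have h1 := HasDerivAt.comp (h₂ := fun α => α * overlapProfile u (Real.cos θ * v * α))
      (h := fun ε : ℝ => semicircleTransform v (z₁ + ε) * w₂) (0 : ℝ)
      (by simpa using hasDerivAt_mul_overlapProfile hu hα) (hw.mul_const w₂)
    have h2 := h1.mul_const (w₂ / (1 - v * w₂ ^ 2))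
    refine (h2.congr_deriv ?_).congr_of_eventuallyEq (Eventually.of_forall fun ε => ?_)
    · simp only [div_eq_mul_inv, Complex.ofReal_cos]
      ring
    · simp only [Function.comp, div_eq_mul_inv, ← hw₂]
      ring

end OverlapDerivative

/-! ### Covariance of the traces as an integral of overlaps. -/

section TraceCovariance

variable {κ : Type*} [Fintype κ] [DecidableEq κ] {S : Type*} [Fintype S] [DecidableEq S]
variable {A : κ → Matrix S S ℝ} {V : S → S → ℝ} {z₁ z₂ : ℂ}

/-- The covariance of the traces of two resolvents. -/
noncomputable def traceCov (A : κ → Matrix S S ℝ) (z₁ z₂ : ℂ) : ℂ :=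
  ∫ ζ, (resolv (linMat A ζ) z₁).trace * (resolv (linMat A ζ) z₂).trace ∂(stdGauss κ) -
    (∫ ζ, (resolv (linMat A ζ) z₁).trace ∂(stdGauss κ)) *
      ∫ ζ, (resolv (linMat A ζ) z₂).trace ∂(stdGauss κ)

theorem traceCov_eq_sum (hA : ∀ q, (A q).IsSymm) (hz₁ : z₁.im ≠ 0) (hz₂ : z₂.im ≠ 0) :
    traceCov A z₁ z₂ = ∑ i, ∑ k,
      (∫ ζ, resolv (linMat A ζ) z₁ i i * resolv (linMat A ζ) z₂ k k ∂(stdGauss κ) -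
      (∫ ζ, resolv (linMat A ζ) z₁ i i ∂(stdGauss κ)) *
        ∫ ζ, resolv (linMat A ζ) z₂ k k ∂(stdGauss κ)) := by
  have b1 := fun i => bcont_resolv hA hz₁ i i
  have b2 := fun i => bcont_resolv hA hz₂ i i
  simp only [traceCov, Matrix.trace, Matrix.diag, Finset.sum_mul_sum, Finset.sum_sub_distrib]
  rw [integral_finsetSum _ fun i _ => (b1 i).integrable _,
    integral_finsetSum _ fun i _ => (b2 i).integrable _, Finset.sum_mul_sum,
    integral_finsetSum _ fun i _ => (BCont.sum _ fun k _ => (b1 i).mul (b2 k)).integrable _]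
  congr 1
  exact Finset.sum_congr rfl fun i _ => integral_finsetSum _ fun k _ =>
    ((b1 i).mul (b2 k)).integrable _

/-- Summing over the two diagonal indices closes the resolvents into squares, and symmetry makes the
two contractions equal, whence the factor 2. -/
theorem sum_sum_interpolation (hA : ∀ q, (A q).IsSymm) (θ : ℝ)
    (ζ : κ ⊕ κ → ℝ) (a b : S) :
    ∑ i, ∑ k, ((resL A z₁ ζ i a * resL A z₁ ζ b i + resL A z₁ ζ i b * resL A z₁ ζ a i) *
        (resR A z₂ θ ζ k a * resR A z₂ θ ζ b k)) =
      2 * ((resL A z₁ ζ * resL A z₁ ζ) a b * (resR A z₂ θ ζ * resR A z₂ θ ζ) a b) := by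
  have s1 : ∀ x y, resL A z₁ ζ x y = resL A z₁ ζ y x := fun x y =>
    resolv_symm_apply (linMat_isSymm (mix_isSymm hA 1 0) ζ) x y
  have s2 : ∀ x y, resR A z₂ θ ζ x y = resR A z₂ θ ζ y x := fun x y =>
    resolv_symm_apply (linMat_isSymm (mix_isSymm hA _ _) ζ) x y
  rw [← Finset.sum_mul_sum, Finset.sum_add_distrib, Matrix.mul_apply, Matrix.mul_apply, ← mul_assoc,
    two_mul]
  congr 1
  · congr 1
    · exact Finset.sum_congr rfl fun i _ => by rw [s1 i a, s1 b i]
    · exact Finset.sum_congr rfl fun i _ => by rw [s1 i b, s1 a i, mul_comm, s1 i a, s1 b i]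
  · exact Finset.sum_congr rfl fun i _ => by rw [s2 i a, s2 b i]

theorem traceCov_eq_integral (hA : ∀ q, (A q).IsSymm) (hV : CovStruct A A V 1)
    (hz₁ : z₁.im ≠ 0) (hz₂ : z₂.im ≠ 0) :
    traceCov A z₁ z₂ = ∫ θ in (0 : ℝ)..(Real.pi / 2), 2 * Real.sin θ *
      pairing V 1 (fun ζ => resL A z₁ ζ * resL A z₁ ζ) fun ζ => resR A z₂ θ ζ * resR A z₂ θ ζ := by
  have hc := fun i k a b => continuous_covariance_integrand (V := V) hA hz₁ hz₂ i i k k a b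
  simp only [traceCov_eq_sum hA hz₁ hz₂, covariance_resolv hA hV hz₁ hz₂]
  rw [Finset.sum_congr rfl fun i _ => (intervalIntegral.integral_finsetSum fun k _ =>
    (continuous_finsetSum _ fun b _ => continuous_finsetSum _ fun a _ =>
      hc i k a b).intervalIntegrable _ _).symm, ← intervalIntegral.integral_finsetSum fun i _ =>
    (continuous_finsetSum _ fun k _ => continuous_finsetSum _ fun b _ =>
      continuous_finsetSum _ fun a _ => hc i k a b).intervalIntegrable _ _]
  refine intervalIntegral.integral_congr fun θ _ => ?_
  have hb : ∀ i k a b, BCont fun ζ => (Real.sin θ : ℂ) * V a b *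
      ((resL A z₁ ζ i a * resL A z₁ ζ b i + resL A z₁ ζ i b * resL A z₁ ζ a i) *
        (resR A z₂ θ ζ k a * resR A z₂ θ ζ b k)) := fun i k a b =>
    (BCont.const _).mul ((((bcont_resL' hA hz₁ i a).mul (bcont_resL' hA hz₁ b i)).add
      ((bcont_resL' hA hz₁ i b).mul (bcont_resL' hA hz₁ a i))).mul
      ((bcont_resR' hA hz₂ θ k a).mul (bcont_resR' hA hz₂ θ b k)))
  have h1 : ∀ a b, ∑ i, ∑ k, ∫ ζ, (Real.sin θ : ℂ) * V a b *
      ((resL A z₁ ζ i a * resL A z₁ ζ b i + resL A z₁ ζ i b * resL A z₁ ζ a i) *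
        (resR A z₂ θ ζ k a * resR A z₂ θ ζ b k)) ∂(stdGauss (κ ⊕ κ)) =
      2 * Real.sin θ * (V a b * ∫ ζ, (resL A z₁ ζ * resL A z₁ ζ) a b *
        (resR A z₂ θ ζ * resR A z₂ θ ζ) a b ∂(stdGauss (κ ⊕ κ))) := by
    intro a b
    rw [Finset.sum_congr rfl fun i _ => (integral_finsetSum _ fun k _ =>
      (hb i k a b).integrable _).symm, ← integral_finsetSum _ fun i _ =>
      (BCont.sum _ fun k _ => hb i k a b).integrable _]
    rw [← integral_const_mul, ← integral_const_mul]
    refine integral_congr_ae (ae_of_all _ fun ζ => ?_)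
    beta_reduce
    rw [Finset.sum_congr rfl fun i _ => (Finset.mul_sum _ _ _).symm, ← Finset.mul_sum,
      sum_sum_interpolation hA]
    ring
  simp only [pairing]
  rw [Complex.ofReal_one, one_mul, Finset.mul_sum]
  simp only [Finset.mul_sum, ← h1]
  calc _ = ∑ i, ∑ b, ∑ k, ∑ a, _ := Finset.sum_congr rfl fun i _ => Finset.sum_comm
    _ = ∑ b, ∑ i, ∑ k, ∑ a, _ := Finset.sum_comm
    _ = ∑ b, ∑ i, ∑ a, ∑ k, _ := Finset.sum_congr rfl fun b _ => Finset.sum_congr rfl fun i _ =>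
        Finset.sum_comm
    _ = ∑ b, ∑ a, ∑ i, ∑ k, _ := Finset.sum_congr rfl fun b _ => Finset.sum_comm
    _ = ∑ a, ∑ b, ∑ i, ∑ k, _ := Finset.sum_comm

theorem continuous_pairing_resR (hA : ∀ q, (A q).IsSymm) (hz₁ : z₁.im ≠ 0) (hz₂ : z₂.im ≠ 0)
    (s : ℝ) : Continuous fun θ : ℝ => pairing V s (fun ζ => resL A z₁ ζ * resL A z₁ ζ)
      fun ζ => resR A z₂ θ ζ * resR A z₂ θ ζ := by
  refine continuous_const.mul (continuous_finsetSum _ fun x _ => continuous_finsetSum _ fun y _ =>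
    continuous_const.mul (continuous_integral_of_bcont _ ?_))
  simp only [Matrix.mul_apply]
  exact (BCont.sum _ fun t _ => (bcont_resL hA hz₁ x t).mul (bcont_resL hA hz₁ t y)).mul
    (BCont.sum _ fun t _ => (bcont_resR hA hz₂ x t).mul (bcont_resR hA hz₂ t y))

end TraceCovariance

/-! ### Integration over the angle and the limit of the covariance. -/

section CovarianceLimit

variable {u : ℝ → ℝ} {v K : ℝ} {z₁ z₂ : ℂ}

theorem scaled_traceCov_eq (hv : 0 ≤ v) (hz₁ : z₁.im ≠ 0) (hz₂ : z₂.im ≠ 0) {n : ℕ} {b β : ℝ}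
    (hU : KernelBound (siteKernel u n b) β) :
    ((b / (2 * n + 1) : ℝ) : ℂ) * traceCov (bandCoef u v n b) z₁ z₂ =
      ∫ θ in (0 : ℝ)..(Real.pi / 2), 2 * v * Real.sin θ * overlapLR u v n b θ z₁ z₂ := by
  rw [traceCov_eq_integral (bandCoef_isSymm hU.symm) (covStruct_bandCoef hv hU) hz₁ hz₂,
    ← intervalIntegral.integral_const_mul]
  refine intervalIntegral.integral_congr fun θ _ => ?_
  simp only [overlapLR, pairing, Complex.ofReal_mul, Complex.ofReal_one, one_mul, mul_assoc,
    ← Finset.mul_sum]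
  ring

/-- With `k = a cos θ`, `overlapProfileDeriv` is the derivative of `k * overlapProfile u k`. So the
angular integrand has an explicit primitive, which vanishes at `π/2` and leaves the profile at `a`.
-/
theorem hasDerivAt_cos_mul_profile (hu : IsProfile u) {a : ℂ} (ha : ‖a‖ ≤ 1 / 4) (θ : ℝ) :
    HasDerivAt (fun θ : ℝ => -(Real.cos θ * overlapProfile u (a * Real.cos θ)))
      (Real.sin θ * overlapProfileDeriv u (a * Real.cos θ)) θ := by
  have hcos : HasDerivAt (fun θ : ℝ => (Real.cos θ : ℂ)) ((-Real.sin θ : ℝ) : ℂ) θ :=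
    (Real.hasDerivAt_cos θ).ofReal_comp
  have hk : ‖a * (Real.cos θ : ℂ)‖ ≤ 1 / 4 := by
    rw [norm_mul, Complex.norm_real, Real.norm_eq_abs]
    exact (mul_le_of_le_one_right (norm_nonneg a) (Real.abs_cos_le_one θ)).trans ha
  have h := (HasDerivAt.comp (h₂ := fun α : ℂ => α * overlapProfile u (a * α)) θ
    (hasDerivAt_mul_overlapProfile hu hk) hcos).neg
  refine h.congr_deriv ?_
  push_cast
  ring

theorem continuous_profileDeriv (hu : IsProfile u) {a : ℂ} (ha : ‖a‖ ≤ 1 / 4) :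
    Continuous fun θ : ℝ => overlapProfileDeriv u (a * Real.cos θ) := by
  have hk : ∀ θ : ℝ, ‖a * (Real.cos θ : ℂ)‖ ≤ 1 / 4 := fun θ => by
    rw [norm_mul, Complex.norm_real, Real.norm_eq_abs]
    exact (mul_le_of_le_one_right (norm_nonneg a) (Real.abs_cos_le_one θ)).trans ha
  have hc : Continuous fun θ : ℝ => a * (Real.cos θ : ℂ) := by fun_prop
  have hm : ∀ m : ℕ, 1 ≤ m → Continuous fun θ : ℝ => spectralMoment u m (a * Real.cos θ) :=
    fun m hm => continuous_iff_continuousAt.2 fun θ =>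
      ContinuousAt.comp (f := fun θ : ℝ => a * (Real.cos θ : ℂ))
        (hasDerivAt_spectralMoment hu hm (hk θ)).continuousAt hc.continuousAt
  have h1 := hm 1 le_rfl
  have h2 := hm 2 (by norm_num)
  have h3 := hm 3 (by norm_num)
  unfold overlapProfileDeriv
  fun_prop

theorem integral_sin_mul_profileDeriv (hu : IsProfile u) {a : ℂ} (ha : ‖a‖ ≤ 1 / 4) :
    ∫ θ in (0 : ℝ)..(Real.pi / 2), (Real.sin θ : ℂ) * overlapProfileDeriv u (a * Real.cos θ) =
      overlapProfile u a := by
  have hc : Continuous fun θ : ℝ => (Real.sin θ : ℂ) * overlapProfileDeriv u (a * Real.cos θ) :=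
    (by fun_prop : Continuous fun θ : ℝ => (Real.sin θ : ℂ)).mul (continuous_profileDeriv hu ha)
  rw [intervalIntegral.integral_eq_sub_of_hasDerivAt
    (fun θ _ => hasDerivAt_cos_mul_profile hu ha θ) (hc.intervalIntegrable _ _)]
  simp

/-- The rescaled covariance of the traces converges. -/
theorem tendsto_scaled_traceCov (hu : IsProfile u) (hv : 0 < v) (hvK : v * K ^ 2 ≤ 1 / 4)
    (hz₁ : z₁.im ≠ 0) (hz₂ : z₂.im ≠ 0) (hK₁ : 1 / |z₁.im| ≤ K) (hK₂ : 1 / |z₂.im| ≤ K)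
    {b : ℕ → ℝ} (hb : Tendsto b atTop atTop)
    (hbN : Tendsto (fun n : ℕ => b n / (2 * (n : ℝ) + 1)) atTop (𝓝 0)) :
    Tendsto (fun n : ℕ => ((b n / (2 * n + 1) : ℝ) : ℂ) * traceCov (bandCoef u v n (b n)) z₁ z₂)
      atTop (𝓝 (2 * v * (semicircleTransform v z₁ ^ 2 / (1 - v * semicircleTransform v z₁ ^ 2) *
        (semicircleTransform v z₂ ^ 2 / (1 - v * semicircleTransform v z₂ ^ 2))) *
        overlapProfile u (v * (semicircleTransform v z₁ * semicircleTransform v z₂)))) := by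
  set a : ℂ := v * (semicircleTransform v z₁ * semicircleTransform v z₂) with ha
  have ha' : ‖a‖ ≤ 1 / 4 := norm_mul_semicircle_le hv.le hvK ((norm_semicircle_le hv hz₁).trans hK₁)
    ((norm_semicircle_le hv hz₂).trans hK₂)
  set W : ℂ := semicircleTransform v z₁ ^ 2 / (1 - v * semicircleTransform v z₁ ^ 2) *
        (semicircleTransform v z₂ ^ 2 / (1 - v * semicircleTransform v z₂ ^ 2))
  have hlim : Tendsto (fun n => ∫ θ in (0 : ℝ)..(Real.pi / 2),
      2 * v * Real.sin θ * overlapLR u v n (b n) θ z₁ z₂) atTop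
      (𝓝 (∫ θ in (0 : ℝ)..(Real.pi / 2),
        2 * v * Real.sin θ * (W * overlapProfileDeriv u (a * Real.cos θ)))) := by
    refine intervalIntegral.tendsto_integral_filter_of_dominated_convergence
      (fun _ => 2 * v * (u 0 * (K * K * (K * K)))) ?_ ?_ intervalIntegrable_const ?_
    · filter_upwards [hb.eventually (eventually_kernelBound hu)] with n hn
      exact ((by fun_prop : Continuous fun θ : ℝ => 2 * (v : ℂ) * Real.sin θ).mul
        (continuous_pairing_resR (bandCoef_isSymm (hn n).symm) hz₁ hz₂ _)).aestronglyMeasurable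
    · filter_upwards [hb.eventually (eventually_kernelBound hu), hb.eventually_gt_atTop 0]
        with n hn h0
      refine ae_of_all _ fun θ _ => ?_
      rw [norm_mul, norm_mul, norm_mul, Complex.norm_real, Complex.norm_real, Complex.norm_ofNat,
        Real.norm_eq_abs, Real.norm_eq_abs, abs_of_pos hv]
      refine mul_le_mul ?_ (norm_overlapLR_le hz₁ hz₂ hK₁ hK₂ h0 (hn n) θ) (norm_nonneg _)
        (by positivity)
      exact mul_le_of_le_one_right (by positivity) (Real.abs_sin_le_one θ)
    · refine ae_of_all _ fun θ _ => ?_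
      have h := tendsto_overlapLR hu hv hvK hz₁ hz₂ hK₁ hK₂ hb hbN θ
      have e : (Real.cos θ : ℂ) * v * (semicircleTransform v z₁ * semicircleTransform v z₂) =
          a * Real.cos θ := by rw [ha]; ring
      rw [e] at h
      exact h.const_mul _
  have hval : ∫ θ in (0 : ℝ)..(Real.pi / 2),
      2 * v * Real.sin θ * (W * overlapProfileDeriv u (a * Real.cos θ)) =
      2 * v * W * overlapProfile u a := by
    rw [← integral_sin_mul_profileDeriv hu ha', ← intervalIntegral.integral_const_mul]
    refine intervalIntegral.integral_congr fun θ _ => ?_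
    ring
  rw [hval] at hlim
  refine hlim.congr' ?_
  filter_upwards [hb.eventually (eventually_kernelBound hu)] with n hn
  exact (scaled_traceCov_eq hv.le hz₁ hz₂ (hn n)).symm

end CovarianceLimit

/-! ### The sine integral: limit and uniform bound. -/

section SineIntegral

/-- The sine integral. -/
noncomputable def sineIntegral (x : ℝ) : ℝ := ∫ t in (0 : ℝ)..x, Real.sinc t

theorem integral_exp_neg_mul_Ioi {t : ℝ} (ht : 0 < t) :
    ∫ s in Set.Ioi (0 : ℝ), Real.exp (-t * s) = 1 / t := by
  rw [integral_exp_mul_Ioi (by linarith) 0, mul_zero, Real.exp_zero, neg_div_neg_eq]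

/-- Fubini is legitimate because the inner integral of the modulus is `|sin t| / t ≤ 1`. -/
theorem integrable_sin_mul_exp (x : ℝ) :
    Integrable (Function.uncurry fun t s : ℝ => Real.sin t * Real.exp (-t * s))
      ((volume.restrict (Set.Ioc 0 x)).prod (volume.restrict (Set.Ioi 0))) := by
  have hm : AEStronglyMeasurable (Function.uncurry fun t s : ℝ => Real.sin t * Real.exp (-t * s))
      ((volume.restrict (Set.Ioc 0 x)).prod (volume.restrict (Set.Ioi 0))) := by
    refine Continuous.aestronglyMeasurable ?_
    unfold Function.uncurry
    fun_prop
  rw [integrable_prod_iff hm]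
  refine ⟨?_, ?_⟩
  · filter_upwards [ae_restrict_mem measurableSet_Ioc] with t ht
    exact (exp_neg_integrableOn_Ioi 0 ht.1).const_mul (Real.sin t)
  · refine Integrable.mono' (g := fun _ => (1 : ℝ)) (integrableOn_const (by simp))
      hm.norm.integral_prod_right' ?_
    filter_upwards [ae_restrict_mem measurableSet_Ioc] with t ht
    simp only [Function.uncurry_apply_pair, norm_mul, Real.norm_eq_abs, Real.abs_exp]
    rw [integral_const_mul, integral_exp_neg_mul_Ioi ht.1, abs_of_nonneg
      (mul_nonneg (abs_nonneg _) (by have := ht.1; positivity)), mul_one_div, div_le_one ht.1]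
    exact (Real.abs_sin_le_abs).trans (abs_of_pos ht.1).le

theorem integral_sin_mul_exp (s x : ℝ) :
    ∫ t in (0 : ℝ)..x, Real.sin t * Real.exp (-t * s) =
      (1 + s ^ 2)⁻¹ - Real.exp (-x * s) * ((Real.cos x + s * Real.sin x) / (1 + s ^ 2)) := by
  have hs : (1 + s ^ 2) ≠ 0 := by positivity
  have h : ∀ t : ℝ, HasDerivAt
      (fun t => -(Real.exp (-t * s) * ((Real.cos t + s * Real.sin t) / (1 + s ^ 2))))
      (Real.sin t * Real.exp (-t * s)) t := by
    intro t
    have h1 : HasDerivAt (fun t : ℝ => Real.exp (-t * s)) (Real.exp (-t * s) * (-1 * s)) t :=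
      ((hasDerivAt_id t).neg.mul_const s).exp
    have h2 := (((Real.hasDerivAt_cos t).add ((Real.hasDerivAt_sin t).const_mul s)).div_const
      (1 + s ^ 2))
    refine (h1.mul h2).neg.congr_deriv ?_
    simp only [Pi.add_apply]
    field_simp
    ring
  rw [intervalIntegral.integral_eq_sub_of_hasDerivAt (fun t _ => h t)
    (Continuous.intervalIntegrable (by fun_prop) _ _)]
  simp
  ring

theorem norm_cos_add_sin_div_le (s x : ℝ) (hs : 0 ≤ s) :
    |(Real.cos x + s * Real.sin x) / (1 + s ^ 2)| ≤ 2 := by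
  have h1 : |Real.cos x + s * Real.sin x| ≤ 1 + s * 1 := by
    refine (abs_add_le _ _).trans (add_le_add (Real.abs_cos_le_one x) ?_)
    rw [abs_mul, abs_of_nonneg hs]
    exact mul_le_mul_of_nonneg_left (Real.abs_sin_le_one x) hs
  rw [abs_div, abs_of_pos (by positivity : 0 < 1 + s ^ 2), div_le_iff₀ (by positivity)]
  nlinarith [sq_nonneg (s - 1), sq_nonneg s]

/-- Write `1/t` as `∫ exp(-t s) ds` and exchange integrals: the main part is `∫ (1 + s²)⁻¹ = π/2`,
and the rest is at most `2 ∫ exp(-x s) ds = 2/x`. -/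
theorem abs_sineIntegral_sub_le {x : ℝ} (hx : 0 < x) :
    |sineIntegral x - Real.pi / 2| ≤ 2 / x := by
  have h1 : sineIntegral x = ∫ s in Set.Ioi (0 : ℝ), ((1 + s ^ 2)⁻¹ -
      Real.exp (-x * s) * ((Real.cos x + s * Real.sin x) / (1 + s ^ 2))) := by
    have h := integral_integral_swap (integrable_sin_mul_exp x)
    rw [sineIntegral, intervalIntegral.integral_of_le hx.le]
    refine Eq.trans ?_ (h.trans ?_)
    · refine setIntegral_congr_fun measurableSet_Ioc fun t ht => ?_
      rw [integral_const_mul, integral_exp_neg_mul_Ioi ht.1, Real.sinc_of_ne_zero ht.1.ne',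
        mul_one_div]
    · refine setIntegral_congr_fun measurableSet_Ioi fun s _ => ?_
      rw [← intervalIntegral.integral_of_le hx.le, integral_sin_mul_exp]
  have hi : IntegrableOn (fun s => Real.exp (-x * s)) (Set.Ioi 0) := exp_neg_integrableOn_Ioi 0 hx
  have hb : ∀ s ∈ Set.Ioi (0 : ℝ),
      ‖Real.exp (-x * s) * ((Real.cos x + s * Real.sin x) / (1 + s ^ 2))‖ ≤
        2 * Real.exp (-x * s) := by
    intro s hs
    rw [norm_mul, Real.norm_eq_abs, Real.norm_eq_abs, Real.abs_exp, mul_comm]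
    exact mul_le_mul_of_nonneg_right (norm_cos_add_sin_div_le s x (Set.mem_Ioi.1 hs).le)
      (Real.exp_pos _).le
  have hi2 : IntegrableOn (fun s => Real.exp (-x * s) *
      ((Real.cos x + s * Real.sin x) / (1 + s ^ 2))) (Set.Ioi 0) := by
    refine Integrable.mono' (hi.const_mul 2) (Measurable.aestronglyMeasurable (by fun_prop)) ?_
    filter_upwards [ae_restrict_mem measurableSet_Ioi] with s hs using hb s hs
  rw [integral_sub integrable_inv_one_add_sq.integrableOn hi2, integral_Ioi_inv_one_add_sq,
    Real.arctan_zero, sub_zero] at h1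
  rw [h1, sub_sub_cancel_left, abs_neg, ← Real.norm_eq_abs]
  refine (norm_integral_le_of_norm_le (hi.const_mul 2)
    ((ae_restrict_mem measurableSet_Ioi).mono hb)).trans (le_of_eq ?_)
  rw [integral_const_mul, integral_exp_neg_mul_Ioi hx, mul_one_div]

theorem tendsto_sineIntegral : Tendsto sineIntegral atTop (𝓝 (Real.pi / 2)) := by
  rw [tendsto_iff_norm_sub_tendsto_zero]
  refine squeeze_zero' (Eventually.of_forall fun _ => norm_nonneg _) ?_
    (tendsto_id.const_div_atTop (2 : ℝ))
  filter_upwards [eventually_gt_atTop 0] with x hx using abs_sineIntegral_sub_le hx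

theorem abs_sineIntegral_le {x : ℝ} (hx : 0 ≤ x) : |sineIntegral x| ≤ 4 := by
  rcases le_total x 1 with h | h
  · have h1 : ‖∫ t in (0 : ℝ)..x, Real.sinc t‖ ≤ 1 * |x - 0| :=
      intervalIntegral.norm_integral_le_of_norm_le_const fun t _ => Real.abs_sinc_le_one t
    rw [sub_zero, abs_of_nonneg hx] at h1
    rw [sineIntegral, ← Real.norm_eq_abs]
    linarith
  · have h1 := abs_sineIntegral_sub_le (by linarith : 0 < x)
    have h2 : 2 / x ≤ 2 := by rw [div_le_iff₀ (by linarith)]; linarith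
    have h3 := Real.pi_le_four
    have h4 := Real.pi_pos
    rw [abs_le] at h1 ⊢
    constructor <;> linarith

theorem integral_sinc_scaled (A r : ℝ) (hA : A ≠ 0) :
    ∫ t in (-r)..r, 2 * A * Real.sinc (A * t) = 4 * sineIntegral (A * r) := by
  have h0 : ∀ a b : ℝ, IntervalIntegrable Real.sinc volume a b := fun a b =>
    Real.continuous_sinc.intervalIntegrable a b
  rw [intervalIntegral.integral_const_mul, intervalIntegral.integral_comp_mul_left _ hA,
    smul_eq_mul, ← intervalIntegral.integral_add_adjacent_intervals (h0 _ 0) (h0 0 _)]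
  have h1 : ∫ t in (A * -r)..0, Real.sinc t = sineIntegral (A * r) := by
    have h := intervalIntegral.integral_comp_neg (f := Real.sinc) (a := 0) (b := A * r)
    simp only [Real.sinc_neg, neg_zero] at h
    rw [sineIntegral, h, mul_neg]
  rw [h1, sineIntegral]
  field_simp
  ring

end SineIntegral

/-! ### Fourier inversion at the origin for profiles. -/

section Dirichlet

variable {u : ℝ → ℝ}

/-- Monotonicity gives `t u(t) ≤ ∫₀ᵗ u`. It serves to bound the level sets. -/
theorem IsProfile.mul_le_one (hu : IsProfile u) {t : ℝ} (ht : 0 ≤ t) : t * u t ≤ 1 := by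
  have h1 : ∫ _ in Set.Ioc 0 t, u t ≤ ∫ s in Set.Ioc 0 t, u s :=
    setIntegral_mono_on (integrableOn_const (by simp)) hu.integrable.integrableOn measurableSet_Ioc
      fun s hs => hu.antitoneOn (Set.mem_Ici.2 hs.1.le) (Set.mem_Ici.2 ht) hs.2
  have h2 : ∫ s in Set.Ioc 0 t, u s ≤ ∫ s, u s :=
    setIntegral_le_integral hu.integrable (ae_of_all _ hu.nonneg)
  rw [hu.integral_eq_one] at h2
  simp only [integral_const, smul_eq_mul] at h1
  rw [measureReal_restrict_apply MeasurableSet.univ, Set.univ_inter, Real.volume_real_Ioc_of_le ht,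
    sub_zero] at h1
  exact h1.trans h2

/-- The level sets of a profile are intervals around the origin. -/
theorem IsProfile.exists_level (hu : IsProfile u) {s : ℝ} (hs : s ∈ Set.Ioo 0 (u 0)) :
    ∃ r, 0 < r ∧ {t | s < u t} =ᵐ[volume] Set.Ioc (-r) r := by
  set E := {t | 0 ≤ t ∧ s < u t} with hE
  have hbdd : BddAbove E := ⟨1 / s, fun t ht => by
    rw [le_div_iff₀ hs.1]
    exact (mul_le_mul_of_nonneg_left ht.2.le ht.1).trans (hu.mul_le_one ht.1)⟩
  -- Continuity at the origin enters here: it makes the level set of positive length for every level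
  -- below `u 0`.
  obtain ⟨δ, hδ, hδu⟩ := Metric.eventually_nhds_iff.1
    (hu.continuousAt_zero.eventually (lt_mem_nhds hs.2))
  have hmem : δ / 2 ∈ E := ⟨by positivity, hδu (by
    rw [Real.dist_eq, sub_zero, abs_of_pos (by positivity)]; linarith)⟩
  have hr : 0 < sSup E := lt_of_lt_of_le (by positivity) (le_csSup hbdd hmem)
  refine ⟨sSup E, hr, ?_⟩
  have hsub : {t | s < u t} ⊆ Set.Icc (-sSup E) (sSup E) := fun t ht => by
    rw [Set.mem_Icc, ← abs_le]
    exact le_csSup hbdd ⟨abs_nonneg t, by rw [hu.abs_eq]; exact ht⟩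
  have hsup : Set.Ioo (-sSup E) (sSup E) ⊆ {t | s < u t} := fun t ht => by
    rw [Set.mem_Ioo, ← abs_lt] at ht
    obtain ⟨t', ht', hlt⟩ := exists_lt_of_lt_csSup ⟨_, hmem⟩ ht
    exact lt_of_lt_of_le ht'.2 (hu.le_of_abs_le (by rw [abs_of_nonneg ht'.1]; exact hlt.le))
  exact (EventuallyLE.antisymm (LE.le.eventuallyLE hsub |>.trans
    Ioc_ae_eq_Icc.symm.le) (Ioo_ae_eq_Ioc.symm.le.trans
    (LE.le.eventuallyLE hsup)))

theorem measurableSet_sublevel (hu : IsProfile u) : MeasurableSet {q : ℝ × ℝ | q.2 < u q.1} :=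
  measurableSet_lt measurable_snd (hu.measurable.comp measurable_fst)

/-- The layer cake formula for the integral of a profile against a bounded function. -/
theorem integral_mul_eq_layer (hu : IsProfile u) {g : ℝ → ℝ} (hg : Continuous g) {C : ℝ}
    (hC : ∀ t, |g t| ≤ C) :
    Integrable (fun s => ∫ t in {t | s < u t}, g t) (volume.restrict (Set.Ioc 0 (u 0))) ∧
    ∫ t, u t * g t = ∫ s in Set.Ioc 0 (u 0), ∫ t in {t | s < u t}, g t := by
  set f : ℝ → ℝ → ℝ := fun t s => {q : ℝ × ℝ | q.2 < u q.1}.indicator (fun q => g q.1) (t, s)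
    with hf
  have hft : ∀ t, (fun s => f t s) = (Set.Iio (u t)).indicator fun _ => g t := by
    intro t
    ext s
    simp only [hf, Set.indicator, Set.mem_Iio, Set.mem_ofPred_eq]
  have hfs : ∀ s, (fun t => f t s) = {t | s < u t}.indicator g := by
    intro s
    ext t
    simp only [hf, Set.indicator, Set.mem_ofPred_eq]
  have hvol : ∀ (t c : ℝ), ∫ s in Set.Ioc 0 (u 0), (Set.Iio (u t)).indicator (fun _ => c) s =
      u t * c := by
    intro t c
    rw [setIntegral_indicator measurableSet_Iio]
    have h0 : Set.Ioc 0 (u 0) ∩ Set.Iio (u t) = Set.Ioo 0 (u t) := by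
      ext s
      simp only [Set.mem_inter_iff, Set.mem_Ioc, Set.mem_Iio, Set.mem_Ioo]
      have := hu.le_zero t
      constructor
      · rintro ⟨⟨h1, h2⟩, h3⟩
        exact ⟨h1, h3⟩
      · rintro ⟨h1, h2⟩
        exact ⟨⟨h1, by linarith⟩, h2⟩
    rw [h0, integral_const, smul_eq_mul, measureReal_restrict_apply MeasurableSet.univ,
      Set.univ_inter, Real.volume_real_Ioo_of_le (hu.nonneg t), sub_zero]
  have hm : AEStronglyMeasurable (Function.uncurry f)
      (volume.prod (volume.restrict (Set.Ioc 0 (u 0)))) :=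
    (StronglyMeasurable.indicator (hg.comp continuous_fst).stronglyMeasurable
      (measurableSet_sublevel hu)).aestronglyMeasurable
  have hint : Integrable (Function.uncurry f)
      (volume.prod (volume.restrict (Set.Ioc 0 (u 0)))) := by
    rw [integrable_prod_iff hm]
    constructor
    · refine ae_of_all _ fun t => ?_
      simp only [Function.uncurry_apply_pair]
      rw [hft t]
      exact (integrableOn_const (by simp)).indicator measurableSet_Iio
    · have e : (fun t => ∫ s in Set.Ioc 0 (u 0), ‖Function.uncurry f (t, s)‖) =
          fun t => u t * |g t| := by
        ext t
        rw [← hvol t |g t|]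
        refine integral_congr_ae (ae_of_all _ fun s => ?_)
        simp only [Function.uncurry_apply_pair]
        rw [congrFun (hft t) s, norm_indicator_eq_indicator_norm]
        rfl
      rw [e]
      exact (hu.integrable.mul_const C).mono' (hu.measurable.mul
        hg.abs.measurable).aestronglyMeasurable (ae_of_all _ fun t => by
          rw [norm_mul, Real.norm_eq_abs, Real.norm_eq_abs, abs_abs, abs_of_nonneg (hu.nonneg t)]
          exact mul_le_mul_of_nonneg_left (hC t) (hu.nonneg t))
  have hset : ∀ s, MeasurableSet {t | s < u t} := fun s => measurableSet_lt measurable_const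
    hu.measurable
  have e : ∀ s, ∫ t, f t s = ∫ t in {t | s < u t}, g t := fun s => by
    rw [hfs s, integral_indicator (hset s)]
  refine ⟨?_, ?_⟩
  · have := hint.integral_prod_right
    simpa only [Function.uncurry_apply_pair, e] using this
  · have := integral_integral_swap hint
    simp only [e] at this
    rw [← this]
    refine integral_congr_ae (ae_of_all _ fun t => ?_)
    beta_reduce
    rw [hft t, hvol t]

theorem integral_exp_symm (A t : ℝ) :
    ∫ p in (-A)..A, Complex.exp (Complex.I * p * t) = ((2 * A * Real.sinc (A * t) : ℝ) : ℂ) := by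
  by_cases ht : t = 0
  · subst ht
    simp
    ring
  by_cases hA : A = 0
  · subst hA
    simp
  have hc : (Complex.I * t) ≠ 0 := mul_ne_zero Complex.I_ne_zero (Complex.ofReal_ne_zero.2 ht)
  have h := integral_exp_mul_complex (a := -A) (b := A) hc
  have e : ∀ p : ℝ, Complex.exp (Complex.I * p * t) = Complex.exp (Complex.I * t * p) := fun p => by
    congr 1; ring
  simp only [e]
  rw [h, Real.sinc_of_ne_zero (mul_ne_zero hA ht)]
  have hA' : (A : ℂ) ≠ 0 := Complex.ofReal_ne_zero.2 hA
  have ht' : (t : ℂ) ≠ 0 := Complex.ofReal_ne_zero.2 ht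
  have hI := Complex.I_sq
  push_cast
  rw [Complex.sin]
  field_simp
  have e1 : Complex.exp (Complex.I * t * A) = Complex.exp (A * t * Complex.I) := by
    congr 1; ring
  have e2 : Complex.exp (-(Complex.I * t * A)) = Complex.exp (-(A * t * Complex.I)) := by
    congr 1; ring
  rw [e1, e2, hI]
  ring

theorem integral_fourierTransform_symm (hu : IsProfile u) {A : ℝ} :
    ∫ p in (-A)..A, fourierTransform u p =
      ((∫ t, u t * (2 * A * Real.sinc (A * t)) : ℝ) : ℂ) := by
  have hint : Integrable (Function.uncurry (wave u))
      ((volume.restrict (Set.uIoc (-A) A)).prod volume) := by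
    have h1 : Integrable (fun q : ℝ × ℝ => 1 * u q.2)
        ((volume.restrict (Set.uIoc (-A) A)).prod volume) :=
      Integrable.mul_prod (f := fun _ : ℝ => (1 : ℝ)) (integrableOn_const (by simp)) hu.integrable
    refine h1.mono' (Measurable.aestronglyMeasurable ?_) (ae_of_all _ fun q => ?_)
    · unfold wave Function.uncurry
      exact (Complex.measurable_ofReal.comp (hu.measurable.comp measurable_snd)).mul (by fun_prop)
    · rw [one_mul]
      exact (norm_wave hu q.1 q.2).le
  have h := intervalIntegral_integral_swap hint
  change ∫ p in (-A)..A, ∫ t, wave u p t = _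
  rw [h, ← integral_complex_ofReal]
  refine integral_congr_ae (ae_of_all _ fun t => ?_)
  simp only [wave]
  rw [intervalIntegral.integral_const_mul, integral_exp_symm]
  push_cast
  rfl

/-- The truncated integral is `∫ u(t) 2A sinc(At) dt`. Slicing `u` into level sets `(-r, r]` turns
each slice into `4 sineIntegral (A r)`, which tends to `2π` and is bounded by 16; integrating the
levels over `(0, u 0]` gives the limit. -/
theorem tendsto_integral_symm (hu : IsProfile u) :
    Tendsto (fun A : ℝ => ∫ p in (-A)..A, fourierTransform u p) atTop
      (𝓝 (2 * Real.pi * u 0)) := by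
  have hval : ∀ A : ℝ, 0 < A → ∀ s, ∀ r, {t | s < u t} =ᵐ[volume] Set.Ioc (-r) r → 0 < r →
      ∫ t in {t | s < u t}, 2 * A * Real.sinc (A * t) = 4 * sineIntegral (A * r) := by
    intro A hA s r he hr
    rw [setIntegral_congr_set he, ← intervalIntegral.integral_of_le (by linarith),
      integral_sinc_scaled A r hA.ne']
  have hlay := fun A : ℝ => integral_mul_eq_layer hu (g := fun t => 2 * A * Real.sinc (A * t))
    (continuous_const.mul (Real.continuous_sinc.comp (continuous_const_mul A)))
    (C := |2 * A|) (fun t => by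
      rw [abs_mul]
      exact mul_le_of_le_one_right (abs_nonneg _) (Real.abs_sinc_le_one _))
  have hae : ∀ᵐ s ∂(volume.restrict (Set.Ioc 0 (u 0))), s ∈ Set.Ioo 0 (u 0) := by
    rw [← restrict_Ioo_eq_restrict_Ioc]
    exact ae_restrict_mem measurableSet_Ioo
  have hlim : Tendsto (fun A : ℝ => ∫ s in Set.Ioc 0 (u 0), ∫ t in {t | s < u t},
      2 * A * Real.sinc (A * t)) atTop (𝓝 (∫ _ in Set.Ioc 0 (u 0), 2 * Real.pi)) := by
    refine tendsto_integral_filter_of_dominated_convergence (fun _ => 16)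
      (Eventually.of_forall fun A => (hlay A).1.aestronglyMeasurable) ?_
      (integrableOn_const (by simp)) ?_
    · filter_upwards [eventually_gt_atTop 0] with A hA
      filter_upwards [hae] with s hs
      obtain ⟨r, hr, he⟩ := hu.exists_level hs
      rw [hval A hA s r he hr, norm_mul, Real.norm_ofNat, Real.norm_eq_abs]
      have := abs_sineIntegral_le (mul_pos hA hr).le
      linarith
    · filter_upwards [hae] with s hs
      obtain ⟨r, hr, he⟩ := hu.exists_level hs
      have h1 : Tendsto (fun A : ℝ => 4 * sineIntegral (A * r)) atTop (𝓝 (4 * (Real.pi / 2))) :=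
        (tendsto_sineIntegral.comp (tendsto_id.atTop_mul_const hr)).const_mul 4
      rw [show 4 * (Real.pi / 2) = 2 * Real.pi by ring] at h1
      refine h1.congr' ?_
      filter_upwards [eventually_gt_atTop 0] with A hA using (hval A hA s r he hr).symm
  have hv : ∫ _ in Set.Ioc 0 (u 0), 2 * Real.pi = 2 * Real.pi * u 0 := by
    rw [integral_const, smul_eq_mul, measureReal_restrict_apply MeasurableSet.univ, Set.univ_inter,
      Real.volume_real_Ioc_of_le hu.zero_pos.le, sub_zero, mul_comm]
  rw [hv] at hlim
  have h2 := (Complex.continuous_ofReal.tendsto _).comp hlim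
  have e : ((2 * Real.pi * u 0 : ℝ) : ℂ) = 2 * Real.pi * u 0 := by push_cast; ring
  rw [e] at h2
  refine h2.congr fun A => ?_
  rw [integral_fourierTransform_symm hu, (hlay A).2]
  rfl

theorem fourierTransform_neg (hu : IsProfile u) (p : ℝ) :
    fourierTransform u (-p) = fourierTransform u p := by
  rw [fourierTransform, fourierTransform, ← integral_neg_eq_self]
  refine integral_congr_ae (ae_of_all _ fun t => ?_)
  beta_reduce
  rw [hu.even]
  congr 2
  push_cast
  ring

/-- Evenness of `û` upgrades symmetric truncations to independent endpoints, since each half-line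
integral is half of a symmetric one. -/
theorem hasImproperIntegral_fourierTransform (hu : IsProfile u) :
    HasImproperIntegral (fourierTransform u) (2 * Real.pi * u 0) := by
  have hi : ∀ a b, IntervalIntegrable (fourierTransform u) volume a b := fun a b =>
    (continuous_fourierTransform hu).intervalIntegrable a b
  have hneg : ∀ A : ℝ, ∫ p in (-A)..0, fourierTransform u p = ∫ p in 0..A, fourierTransform u p := by
    intro A
    have h := intervalIntegral.integral_comp_neg (f := fourierTransform u) (a := 0) (b := A)
    simp only [fourierTransform_neg hu, neg_zero] at h
    exact h.symm
  have hsym : ∀ A : ℝ, ∫ p in (-A)..A, fourierTransform u p =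
      2 * ∫ p in 0..A, fourierTransform u p := by
    intro A
    rw [← intervalIntegral.integral_add_adjacent_intervals (hi _ 0) (hi 0 _), hneg, two_mul]
  have h := tendsto_integral_symm hu
  have h1 := ((h.comp (tendsto_fst (f := atTop) (g := (atTop : Filter ℝ)))).add
    (h.comp tendsto_snd)).const_mul (1 / 2 : ℂ)
  refine (h1.congr fun q => ?_).mono_right (le_of_eq ?_)
  · simp only [Function.comp, hsym]
    rw [← intervalIntegral.integral_add_adjacent_intervals (hi (-q.1) 0) (hi 0 q.2), hneg]
    ring
  · congr 1; ring

end Dirichlet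

/-! ### The improper integral in the leading term. -/

section LeadingIntegral

variable {u : ℝ → ℝ} {v K : ℝ} {z₁ z₂ : ℂ}

theorem HasImproperIntegral.add_integrable {f g : ℝ → ℂ} {I : ℂ} (hf : HasImproperIntegral f I)
    (hfi : ∀ a b, IntervalIntegrable f volume a b) (hg : Integrable g) :
    HasImproperIntegral (fun p => f p + g p) (I + ∫ p, g p) := by
  have h : Tendsto (fun q : ℝ × ℝ => ∫ p in (-q.1)..q.2, g p) (atTop ×ˢ atTop) (𝓝 (∫ p, g p)) :=
    intervalIntegral_tendsto_integral hg (tendsto_neg_atTop_atBot.comp tendsto_fst) tendsto_snd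
  refine (hf.add h).congr fun q => ?_
  rw [intervalIntegral.integral_add (hfi _ _) hg.intervalIntegrable]

/-- The improper integral of the leading integrand. -/
theorem hasImproperIntegral_leadingIntegrand (hu : IsProfile u)
    (hk : ‖(v : ℂ) * (semicircleTransform v z₁ * semicircleTransform v z₂)‖ ≤ 1 / 4) :
    HasImproperIntegral (leadingIntegrand v u z₁ z₂)
      (semicircleTransform v z₁ ^ 2 * semicircleTransform v z₂ ^ 2 * (2 * Real.pi *
        overlapProfile u (v * (semicircleTransform v z₁ * semicircleTransform v z₂)))) := by
  set k : ℂ := v * (semicircleTransform v z₁ * semicircleTransform v z₂) with hkdef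
  have hk3 : ‖k‖ ≤ 1 / 3 := by linarith
  -- The integrand is split by `s / (1 - k s)² = s + 2 k s² / (1 - k s) + k² s³ / (1 - k s)²`; only
  -- the first term needs the improper limit.
  have i1 := integrable_spectral hu (m := 1) le_rfl 1 hk3
  have i2 := integrable_spectral hu (m := 2) (by norm_num) 2 hk3
  have h := ((hasImproperIntegral_fourierTransform hu).add_integrable
    (fun a b => (continuous_fourierTransform hu).intervalIntegrable a b)
    ((i1.const_mul (2 * k)).add (i2.const_mul (k ^ 2)))).const_mul
    (semicircleTransform v z₁ ^ 2 * semicircleTransform v z₂ ^ 2)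
  have hpi : (Real.pi : ℂ) ≠ 0 := Complex.ofReal_ne_zero.2 Real.pi_ne_zero
  have e : semicircleTransform v z₁ ^ 2 * semicircleTransform v z₂ ^ 2 * (2 * Real.pi *
        overlapProfile u k) = semicircleTransform v z₁ ^ 2 * semicircleTransform v z₂ ^ 2 *
        (2 * Real.pi * u 0 + ∫ p, (2 * k * (fourierTransform u p ^ (1 + 1) /
          (1 - k * fourierTransform u p) ^ 1) + k ^ 2 * (fourierTransform u p ^ (2 + 1) /
          (1 - k * fourierTransform u p) ^ 2))) := by
    rw [integral_add (i1.const_mul _) (i2.const_mul _), integral_const_mul, integral_const_mul]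
    simp only [overlapProfile, spectralMoment]
    field_simp
  rw [HasImproperIntegral, e]
  refine h.congr fun q => ?_
  rw [← intervalIntegral.integral_const_mul]
  refine intervalIntegral.integral_congr fun p _ => ?_
  have hne : 1 - k * fourierTransform u p ≠ 0 := fun h0 => by
    have := norm_one_sub_ge hk (norm_fourierTransform_le hu p)
    rw [h0, norm_zero] at this
    norm_num at this
  have e2 : 1 - (v : ℂ) * semicircleTransform v z₁ * semicircleTransform v z₂ *
      fourierTransform u p = 1 - k * fourierTransform u p := by rw [hkdef]; ring
  simp only [leadingIntegrand, Pi.add_apply, e2]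
  generalize fourierTransform u p = s at hne
  generalize hd : 1 - k * s = d at hne
  field_simp
  rw [← hd]
  ring

end LeadingIntegral

/-! ### From the given probability space to the standard Gaussian measure. -/

section Transfer

variable {Ω : Type*} [MeasurableSpace Ω] {P : Measure Ω} {v : ℝ≥0}
  {a : UpperPair → Ω → ℝ} {u : ℝ → ℝ}

/-- The independent entry at an ordered pair of sites. -/
def PairIdx.toUpper {n : ℕ} (p : PairIdx n) : UpperPair := ⟨((p.1.1 : ℤ), (p.1.2 : ℤ)), p.2⟩

theorem PairIdx.toUpper_injective {n : ℕ} : Function.Injective (PairIdx.toUpper (n := n)) := by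
  rintro ⟨⟨x, y⟩, h⟩ ⟨⟨x', y'⟩, h'⟩ e
  simp only [PairIdx.toUpper, Subtype.mk.injEq, Prod.mk.injEq] at e
  simp only [Subtype.mk.injEq, Prod.mk.injEq]
  exact ⟨Subtype.ext e.1, Subtype.ext e.2⟩

theorem toUpper_pairIdx {n : ℕ} (x y : Site n) : (pairIdx x y).toUpper = sortedPair x y := by
  refine Subtype.ext (Prod.ext ?_ ?_)
  · rcases le_total x y with h | h
    · simp [PairIdx.toUpper, pairIdx, sortedPair, h]
    · simp [PairIdx.toUpper, pairIdx, sortedPair, h]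
  · rcases le_total x y with h | h
    · simp [PairIdx.toUpper, pairIdx, sortedPair, h]
    · simp [PairIdx.toUpper, pairIdx, sortedPair, h]

/-- The entries normalized to unit variance. -/
noncomputable def unitEntry {Ω : Type*} (v : ℝ≥0) (a : UpperPair → Ω → ℝ) {n : ℕ} (p : PairIdx n) (ω : Ω) : ℝ :=
  a p.toUpper ω / √(v * (1 + if p.1.1 = p.1.2 then 1 else 0))

theorem hasLaw_unitEntry (hv : 0 < v) (ha : IsGaussianFamily P v a) {n : ℕ} (p : PairIdx n) :
    HasLaw (unitEntry v a p) (gaussianReal 0 1) P := by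
  have h := gaussianReal_div_const (ha.hasLaw p.toUpper) √(v * (1 + if p.1.1 = p.1.2 then 1 else 0))
  have hv' : (v : ℝ) ≠ 0 := by exact_mod_cast hv.ne'
  convert h using 2
  · rfl
  · simp
  · refine NNReal.eq ?_
    have e : (p.toUpper.1.1 = p.toUpper.1.2) ↔ p.1.1 = p.1.2 := Subtype.ext_iff.symm
    have h0 : (0 : ℝ) ≤ v * (1 + if p.1.1 = p.1.2 then 1 else 0) := by split_ifs <;> positivity
    simp only [e, NNReal.coe_div, NNReal.coe_mk, Real.sq_sqrt h0, NNReal.coe_one]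
    split_ifs <;> push_cast <;> field_simp

theorem hasLaw_unitEntries (hv : 0 < v) (ha : IsGaussianFamily P v a) (n : ℕ) :
    HasLaw (fun ω (p : PairIdx n) => unitEntry v a p ω) (stdGauss (PairIdx n)) P := by
  have hind : iIndepFun (fun p : PairIdx n => unitEntry v a p) P :=
    (ha.indep.precomp PairIdx.toUpper_injective).comp
      (fun p t => t / √(v * (1 + if p.1.1 = p.1.2 then 1 else 0))) fun p => by fun_prop
  exact hind.hasLaw_pi fun p => hasLaw_unitEntry hv ha p

theorem bandKernel_comm (hu : IsProfile u) (b : ℝ) (x y : ℤ) :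
    bandKernel u b x y = bandKernel u b y x := by
  rw [bandKernel, bandKernel, ← hu.even, ← neg_div, neg_sub]

theorem siteKernel_comm (hu : IsProfile u) (n : ℕ) (b : ℝ) (x y : Site n) :
    siteKernel u n b x y = siteKernel u n b y x := bandKernel_comm hu b x y

theorem bandMatrix_eq_linMat {Ω : Type*} {a : UpperPair → Ω → ℝ} (hv : 0 < v) (hu : IsProfile u) (n : ℕ) (b : ℝ) (ω : Ω) :
    bandMatrix a u n b ω = linMat (bandCoef u v n b) fun p => unitEntry v a p ω := by
  ext x y
  have hk : bandKernel u b (min (x : ℤ) y) (max (x : ℤ) y) = siteKernel u n b x y := by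
    rcases le_total (x : ℤ) y with h | h
    · rw [min_eq_left h, max_eq_right h, siteKernel]
    · rw [min_eq_right h, max_eq_left h, siteKernel, bandKernel_comm hu]
  have hd : ((pairIdx x y).1.1 = (pairIdx x y).1.2) ↔ x = y := by
    simp [pairIdx]
  have hne : √((v : ℝ) * (1 + if x = y then 1 else 0)) ≠ 0 := by
    have hv' : (0 : ℝ) < v := by exact_mod_cast hv
    refine (Real.sqrt_pos.2 ?_).ne'
    split_ifs <;> positivity
  rw [linMat_bandCoef, bandMatrix, Matrix.of_apply, hk, unitEntry, toUpper_pairIdx, entryDev]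
  simp only [hd]
  field_simp

/-- Only the joint law of the normalized entries matters, and by independence it is the standard
Gaussian product measure. -/
theorem correlation_eq_traceCov (hv : 0 < v) (ha : IsGaussianFamily P v a) (hu : IsProfile u)
    (n : ℕ) (b : ℝ) {z₁ z₂ : ℂ} (hz₁ : z₁.im ≠ 0) (hz₂ : z₂.im ≠ 0) :
    correlation P a u n b z₁ z₂ =
      (1 / (2 * (n : ℂ) + 1)) ^ 2 * traceCov (bandCoef u v n b) z₁ z₂ := by
  have hA := bandCoef_isSymm (v := v) (b := b) (siteKernel_comm hu n b)
  have hX := hasLaw_unitEntries hv ha n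
  have hc : ∀ z : ℂ, z.im ≠ 0 → BCont fun ζ : PairIdx n → ℝ =>
      (resolv (linMat (bandCoef u v n b) ζ) z).trace := fun z hz =>
    BCont.sum _ fun i _ => bcont_resolv hA hz i i
  have ht : ∀ z ω, normalizedTrace a u n b z ω = 1 / (2 * (n : ℂ) + 1) *
      (resolv (linMat (bandCoef u v n b) fun p => unitEntry v a p ω) z).trace := fun z ω => by
    rw [normalizedTrace, resolventMatrix, bandMatrix_eq_linMat hv hu, resolv]
  have h1 : ∀ z : ℂ, z.im ≠ 0 → ∫ ω, normalizedTrace a u n b z ω ∂P = 1 / (2 * (n : ℂ) + 1) *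
      ∫ ζ, (resolv (linMat (bandCoef u v n b) ζ) z).trace ∂(stdGauss (PairIdx n)) := by
    intro z hz
    simp only [ht]
    rw [integral_const_mul, ← hX.integral_comp (hc z hz).1.aestronglyMeasurable]
    rfl
  have h2 : ∫ ω, normalizedTrace a u n b z₁ ω * normalizedTrace a u n b z₂ ω ∂P =
      (1 / (2 * (n : ℂ) + 1)) ^ 2 * ∫ ζ, (resolv (linMat (bandCoef u v n b) ζ) z₁).trace *
        (resolv (linMat (bandCoef u v n b) ζ) z₂).trace ∂(stdGauss (PairIdx n)) := by
    rw [← hX.integral_comp ((hc z₁ hz₁).mul (hc z₂ hz₂)).1.aestronglyMeasurable,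
      ← integral_const_mul]
    refine integral_congr_ae (ae_of_all _ fun ω => ?_)
    simp only [ht, Function.comp]
    ring
  rw [correlation, h1 z₁ hz₁, h1 z₂ hz₂, h2, traceCov]
  ring

end Transfer

/-! ### Choice of scales and conclusion. -/

theorem tendsto_natCast_rpow_div {χ : ℝ} (hχ : χ < 1) :
    Tendsto (fun n : ℕ => (n : ℝ) ^ χ / (2 * (n : ℝ) + 1)) atTop (𝓝 0) := by
  have h1 : Tendsto (fun n : ℕ => (n : ℝ) ^ (-(1 - χ))) atTop (𝓝 0) :=
    (tendsto_rpow_neg_atTop (by linarith)).comp tendsto_natCast_atTop_atTop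
  refine squeeze_zero' (Eventually.of_forall fun n => by positivity) ?_ h1
  filter_upwards [eventually_ge_atTop 1] with n hn
  have hn' : (0 : ℝ) < n := by exact_mod_cast hn
  rw [neg_sub, Real.rpow_sub_one hn'.ne']
  gcongr
  linarith

/-- With `K = 1 / (2√v + 1)`, the inequality `(2√v + 1)² ≥ 4 v` gives `v K² ≤ 1/4`, the smallness
behind both contractions: for the diagonal and for `1 - k U`. -/
theorem bound_of_im {v : ℝ} (hv : 0 ≤ v) {z : ℂ} (hz : 2 * √v + 1 ≤ |z.im|) :
    z.im ≠ 0 ∧ 1 / |z.im| ≤ 1 / (2 * √v + 1) ∧ v * (1 / (2 * √v + 1)) ^ 2 ≤ 1 / 4 := by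
  have h0 := Real.sqrt_nonneg v
  have h1 : 0 < 2 * √v + 1 := by positivity
  refine ⟨fun h => ?_, one_div_le_one_div_of_le h1 hz, ?_⟩
  · rw [h, abs_zero] at hz
    linarith
  · rw [div_pow, one_pow, mul_one_div, div_le_iff₀ (by positivity)]
    nlinarith [Real.sq_sqrt hv]

end BandMatrix

theorem theorem3p2 {Ω : Type*} [MeasurableSpace Ω] (P : Measure Ω) [IsProbabilityMeasure P]
    (v : ℝ≥0) (hv : 0 < v)
    (a : BandMatrix.UpperPair → Ω → ℝ) (ha : BandMatrix.IsGaussianFamily P v a)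
    (u : ℝ → ℝ) (hu : BandMatrix.IsProfile u)
    (χ : ℝ) (hχ : 1 / 3 < χ) (hχ_lt : χ < 1)
    (z₁ z₂ : ℂ) (hz₁ : 2 * Real.sqrt v + 1 ≤ |z₁.im|) (hz₂ : 2 * Real.sqrt v + 1 ≤ |z₂.im|) :
    ∃ I : ℂ, BandMatrix.HasImproperIntegral (BandMatrix.leadingIntegrand v u z₁ z₂) I ∧
      (fun n : ℕ =>
          BandMatrix.correlation P a u n ((n : ℝ) ^ χ) z₁ z₂ -
            1 / ((2 * (n : ℂ) + 1) * (((n : ℝ) ^ χ : ℝ) : ℂ)) *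
              BandMatrix.leadingTerm v z₁ z₂ (1 / (2 * (Real.pi : ℂ)) * I))
        =o[atTop] fun n : ℕ => 1 / ((2 * (n : ℝ) + 1) * (n : ℝ) ^ χ) := by
  have hv' : (0 : ℝ) < v := by exact_mod_cast hv
  obtain ⟨hi₁, hK₁, hvK⟩ := BandMatrix.bound_of_im hv'.le hz₁
  obtain ⟨hi₂, hK₂, -⟩ := BandMatrix.bound_of_im hv'.le hz₂
  have hb : Tendsto (fun n : ℕ => (n : ℝ) ^ χ) atTop atTop :=
    (tendsto_rpow_atTop (by linarith)).comp tendsto_natCast_atTop_atTop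
  have hk := BandMatrix.norm_mul_semicircle_le hv'.le hvK
    ((BandMatrix.norm_semicircle_le hv' hi₁).trans hK₁)
    ((BandMatrix.norm_semicircle_le hv' hi₂).trans hK₂)
  refine ⟨_, BandMatrix.hasImproperIntegral_leadingIntegrand hu hk, ?_⟩
  have hlim := BandMatrix.tendsto_scaled_traceCov hu hv' hvK hi₁ hi₂ hK₁ hK₂ hb
    (BandMatrix.tendsto_natCast_rpow_div hχ_lt)
  set L := BandMatrix.leadingTerm v z₁ z₂ (1 / (2 * (Real.pi : ℂ)) *
    (BandMatrix.semicircleTransform v z₁ ^ 2 * BandMatrix.semicircleTransform v z₂ ^ 2 *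
      (2 * Real.pi * BandMatrix.overlapProfile u (v * (BandMatrix.semicircleTransform v z₁ *
        BandMatrix.semicircleTransform v z₂))))) with hL
  have hpi : (Real.pi : ℂ) ≠ 0 := Complex.ofReal_ne_zero.2 Real.pi_ne_zero
  have eL : 2 * (v : ℝ) * (BandMatrix.semicircleTransform v z₁ ^ 2 /
      (1 - (v : ℝ) * BandMatrix.semicircleTransform v z₁ ^ 2) *
      (BandMatrix.semicircleTransform v z₂ ^ 2 /
        (1 - (v : ℝ) * BandMatrix.semicircleTransform v z₂ ^ 2))) *
      BandMatrix.overlapProfile u ((v : ℝ) * (BandMatrix.semicircleTransform v z₁ *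
        BandMatrix.semicircleTransform v z₂)) = L := by
    have : ∀ X : ℂ, 1 / (2 * (Real.pi : ℂ)) *
        (BandMatrix.semicircleTransform v z₁ ^ 2 * BandMatrix.semicircleTransform v z₂ ^ 2 *
        (2 * Real.pi * X)) = BandMatrix.semicircleTransform v z₁ ^ 2 *
        BandMatrix.semicircleTransform v z₂ ^ 2 * X := fun X => by field_simp
    rw [hL, this, BandMatrix.leadingTerm]
    simp only [div_eq_mul_inv, mul_inv]
    ring
  rw [eL] at hlim
  -- The error is `1 / (N b)` times the difference between the rescaled covariance and its limit,
  -- which is `o(1)`.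
  have ho := (isLittleO_one_iff ℝ).2 (tendsto_sub_nhds_zero_iff.2 hlim)
  have hO : (fun n : ℕ => 1 / ((2 * (n : ℂ) + 1) * (((n : ℝ) ^ χ : ℝ) : ℂ))) =O[atTop]
      fun n : ℕ => 1 / ((2 * (n : ℝ) + 1) * (n : ℝ) ^ χ) := by
    refine IsBigO.of_bound 1 (Eventually.of_forall fun n => le_of_eq ?_)
    rw [one_mul, ← Complex.norm_real]
    push_cast
    rfl
  have h := hO.mul_isLittleO ho
  simp only [mul_one] at h
  refine h.congr' ?_ EventuallyEq.rfl
  -- At `n = 0` the bandwidth vanishes and cannot be cancelled.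
  filter_upwards [eventually_ge_atTop 1] with n hn
  have hn' : (0 : ℝ) < n := by exact_mod_cast hn
  have hb0 : (((n : ℝ) ^ χ : ℝ) : ℂ) ≠ 0 := Complex.ofReal_ne_zero.2 (Real.rpow_pos_of_pos hn' χ).ne'
  have hN : (2 * (n : ℂ) + 1) ≠ 0 := by exact_mod_cast (by omega : 2 * n + 1 ≠ 0)
  rw [BandMatrix.correlation_eq_traceCov hv ha hu n _ hi₁ hi₂, mul_sub, Complex.ofReal_div]
  congr 1
  push_cast
  field_simp
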